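/- Let $\mathfrak a$ be a nonzero ideal of $\mathbb C[x]=\mathbb C[x_1,\dots,x_n]$ generated by monomials, and let $f_1,\dots,f_r$ be nonzero polynomials generating $\mathfrak a$. Bernstein–Sato polynomial. Let $D$ be the ring of differential operators of $\mathbb A^n$, generated by $\mathbb C[x]$ and $\partial_{x_1},\dots,\partial_{x_n}$. It acts naturally on $\mathcal M=\mathbb C[x][\prod_j f_j^{-1},s_1,\dots,s_r]\prod_j f_j^{s_j}$, where $s_1,\dots,s_r$ are independent variables. Let $t_i$ be the invertible $D$-linear operator $t_i\bigl(u(s_1,\dots,s_r)\prod_j f_j^{s_j}\bigr)=u(s_1,\dots,s_i+1,\dots,s_r)\,f_i\prod_j f_j^{s_j}$, and put $s_{i,j}=s_it_i^{-1}t_j$. The Bernstein–Sato polynomial $b_{\mathfrak a}$ is the monic polynomial $b\in\mathbb C[s]$ of lowest degree for which $$b(s_1+\dots+s_r)\prod_j f_j^{s_j}=\sum_{k=1}^r P_kt_k\prod_j f_j^{s_j}$$ holds with $P_1,\dots,P_r$ in the ring generated by $D$ and the $s_{i,j}$. Newton polyhedron. Let $P_{\mathfrak a}\subseteq\mathbb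 R^n$ be the convex hull of $\{u\in\mathbb N^n : x^u\in\mathfrak a\}$. A facet is a nonempty face of dimension $\dim P_{\mathfrak a}-1$. If $Q$ is a facet of $P_{\mathfrak a}$ that is not contained in any coordinate hyperplane $\{x_i=0\}$, let $L_Q$ be the unique linear form on $\mathbb R^n$ with $L_Q=1$ on $Q$ (it has rational coefficients), and let $m_Q$ be the smallest positive integer such that $m_QL_Q$ has integral coefficients. Theorem. The polynomial $b_{\mathfrak a}$ exists and is unique, all its complex roots are rational, and the set of their classes in $\mathbb Q/\mathbb Z$ is $$\{\,[\alpha] : b_{\mathfrak a}(\alpha)=0\,\}=\bigcup_{Q}\ \Bigl\langle \tfrac1{m_Q}\Bigr\rangle\subseteq\mathbb Q/\mathbb Z,$$ where $Q$ runs over the facets of $P_{\mathfrak a}$ that are not contained in any coordinate hyperplane, and $\langle 1/m_Q\rangle$ is the subgroup generated by the class of $1/m_Q$. In particular, this set depends only on $P_{\mathfrak a}$, and only on the integral closure of $\mathfrak a$: if $\mathfrak a'$ is another nonzero monomial ideal of $\mathbb C[x]$ with the same Newton polyhedron, or with the same integral closure, then the roots of $b_{\mathfrak a'}$ have the same set of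 classes in $\mathbb Q/\mathbb Z$. -/

import Mathlib

noncomputable section

/-! ## Derivations on localizations -/

/-- The ring homomorphism `g ↦ g + D g · ε` from `R` to the dual numbers over the localization
`M⁻¹R`, for a derivation `D` of `R`. -/
def Derivation.toLocalizationDual {k R : Type*} [CommRing k] [CommRing R] [Algebra k R]
    (M : Submonoid R) (D : Derivation k R R) :
    R →+* TrivSqZeroExt (Localization M) (Localization M) where
  toFun g := TrivSqZeroExt.inl (algebraMap R (Localization M) g)
    + TrivSqZeroExt.inr (algebraMap R (Localization M) (D g))
  map_one' := by ext <;> simp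
  map_zero' := by ext <;> simp
  map_add' x y := by ext <;> simp [Algebra.smul_def]
  map_mul' x y := by
    ext
    · simp
    · simp only [TrivSqZeroExt.snd_mul, TrivSqZeroExt.snd_add, TrivSqZeroExt.snd_inl,
        TrivSqZeroExt.snd_inr, TrivSqZeroExt.fst_add, TrivSqZeroExt.fst_inl,
        TrivSqZeroExt.fst_inr, zero_add, add_zero, Derivation.leibniz, map_add, smul_eq_mul,
        map_mul, MulOpposite.smul_eq_mul_unop, MulOpposite.unop_op]
      ring

theorem Derivation.isUnit_toLocalizationDual {k R : Type*} [CommRing k] [CommRing R] [Algebra k R]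
    (M : Submonoid R) (D : Derivation k R R) (y : M) :
    IsUnit (D.toLocalizationDual M y) := by
  rw [TrivSqZeroExt.isUnit_iff_isUnit_fst]
  simpa [Derivation.toLocalizationDual] using IsLocalization.map_units (Localization M) y

/-- The extension of `Derivation.toLocalizationDual` to the localization. -/
def Derivation.localizationDual {k R : Type*} [CommRing k] [CommRing R] [Algebra k R]
    (M : Submonoid R) (D : Derivation k R R) :
    Localization M →+* TrivSqZeroExt (Localization M) (Localization M) :=
  IsLocalization.lift (M := M) (D.isUnit_toLocalizationDual M)

theorem Derivation.localizationDual_algebraMap {k R : Type*} [CommRing k] [CommRing R]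
    [Algebra k R] (M : Submonoid R) (D : Derivation k R R) (g : R) :
    D.localizationDual M (algebraMap R (Localization M) g)
      = TrivSqZeroExt.inl (algebraMap R (Localization M) g)
        + TrivSqZeroExt.inr (algebraMap R (Localization M) (D g)) :=
  IsLocalization.lift_eq _ _

theorem Derivation.fst_localizationDual {k R : Type*} [CommRing k] [CommRing R] [Algebra k R]
    (M : Submonoid R) (D : Derivation k R R) (x : Localization M) :
    (D.localizationDual M x).fst = x := by
  have h : (TrivSqZeroExt.fstHom (Localization M) (Localization M)
      (Localization M)).toRingHom.comp (D.localizationDual M) = RingHom.id _ := by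
    apply IsLocalization.ringHom_ext M
    ext g
    simp [Derivation.localizationDual_algebraMap]
  exact congrArg (fun φ : Localization M →+* Localization M => φ x) h

/-- The unique extension of a `k`-derivation of `R` to the localization `M⁻¹R`
(given by the quotient rule). -/
def Derivation.localization {k R : Type*} [CommRing k] [CommRing R] [Algebra k R]
    (M : Submonoid R) (D : Derivation k R R) :
    Derivation k (Localization M) (Localization M) :=
  Derivation.mk'
    { toFun := fun x => (D.localizationDual M x).snd
      map_add' := fun x y => by simp
      map_smul' := fun c x => by
        have hc : D.localizationDual M (algebraMap k (Localization M) c)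
            = TrivSqZeroExt.inl (algebraMap k (Localization M) c) := by
          rw [IsScalarTower.algebraMap_apply k R (Localization M),
            Derivation.localizationDual_algebraMap]
          simp
        rw [Algebra.smul_def, map_mul, hc]
        simp [Algebra.smul_def] }
    (fun x y => by simp [Derivation.fst_localizationDual, mul_comm])

theorem Derivation.localization_algebraMap {k R : Type*} [CommRing k] [CommRing R] [Algebra k R]
    (M : Submonoid R) (D : Derivation k R R) (g : R) :
    D.localization M (algebraMap R (Localization M) g) = algebraMap R (Localization M) (D g) := by
  change (D.localizationDual M (algebraMap R (Localization M) g)).snd = _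
  rw [Derivation.localizationDual_algebraMap, TrivSqZeroExt.snd_add, TrivSqZeroExt.snd_inl,
    TrivSqZeroExt.snd_inr, zero_add]

namespace BernsteinSato

/-! ## The Bernstein–Sato polynomial of a tuple of polynomials -/

/-- The polynomial ring `ℂ[x₁, …, xₙ]`. -/
abbrev PolyRing (n : ℕ) : Type := MvPolynomial (Fin n) ℂ

/-- The ring `ℂ[x][∏ⱼ fⱼ⁻¹]`. -/
abbrev Loc {n r : ℕ} (f : Fin r → PolyRing n) : Type := Localization.Away (∏ j, f j)

/-- The module `ℂ[x][∏ⱼ fⱼ⁻¹, s₁, …, s_r] ∏ⱼ fⱼ^{sⱼ}`: it is free of rank one over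
`ℂ[x][∏ⱼ fⱼ⁻¹, s₁, …, s_r]`, and the element `u · ∏ⱼ fⱼ^{sⱼ}` is represented by `u`. -/
abbrev FsModule {n r : ℕ} (f : Fin r → PolyRing n) : Type := MvPolynomial (Fin r) (Loc f)

/-- `fⱼ⁻¹` in `ℂ[x][∏ⱼ fⱼ⁻¹]` (where `fⱼ` is a unit). -/
def fInv {n r : ℕ} (f : Fin r → PolyRing n) (j : Fin r) : Loc f :=
  Ring.inverse (algebraMap (PolyRing n) (Loc f) (f j))

theorem mul_fInv {n r : ℕ} (f : Fin r → PolyRing n) (j : Fin r) :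
    algebraMap (PolyRing n) (Loc f) (f j) * fInv f j = 1 := by
  apply Ring.mul_inverse_cancel
  have h : IsUnit (algebraMap (PolyRing n) (Loc f) (∏ j, f j)) :=
    IsLocalization.Away.algebraMap_isUnit _
  exact isUnit_of_dvd_unit (map_dvd _ (Finset.dvd_prod_of_mem f (Finset.mem_univ j))) h

/-- The action of `∂/∂xᵢ` on `ℂ[x][∏ⱼ fⱼ⁻¹]`. -/
def locPderiv {n r : ℕ} (f : Fin r → PolyRing n) (i : Fin n) : Derivation ℂ (Loc f) (Loc f) :=
  (MvPolynomial.pderiv i).localization (Submonoid.powers (∏ j, f j))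

/-- `∂/∂xᵢ` applied to the coefficients of a polynomial in `s₁, …, s_r` over
`ℂ[x][∏ⱼ fⱼ⁻¹]`. -/
def coeffPderiv {n r : ℕ} (f : Fin r → PolyRing n) (i : Fin n) : Module.End ℂ (FsModule f) :=
  (AddMonoidAlgebra.coeffLinearEquiv ℂ).symm.toLinearMap ∘ₗ
    Finsupp.mapRange.linearMap (locPderiv f i).toLinearMap ∘ₗ
    (AddMonoidAlgebra.coeffLinearEquiv ℂ).toLinearMap

theorem coeff_coeffPderiv {n r : ℕ} (f : Fin r → PolyRing n) (i : Fin n) (u : FsModule f)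
    (m : Fin r →₀ ℕ) :
    MvPolynomial.coeff m (coeffPderiv f i u) = locPderiv f i (MvPolynomial.coeff m u) := rfl

/-- Multiplication by `g ∈ ℂ[x]`. -/
def actPoly {n r : ℕ} (f : Fin r → PolyRing n) (g : PolyRing n) : Module.End ℂ (FsModule f) :=
  LinearMap.mulLeft ℂ (MvPolynomial.C (algebraMap (PolyRing n) (Loc f) g))

/-- The action of `∂/∂xᵢ`:
`∂ᵢ (u ∏ⱼ fⱼ^{sⱼ}) = (∂ᵢ u + ∑ⱼ sⱼ (∂ᵢ fⱼ) fⱼ⁻¹ u) ∏ⱼ fⱼ^{sⱼ}`. -/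
def actPartial {n r : ℕ} (f : Fin r → PolyRing n) (i : Fin n) : Module.End ℂ (FsModule f) :=
  coeffPderiv f i + LinearMap.mulLeft ℂ
    (∑ j, MvPolynomial.X j *
      MvPolynomial.C (algebraMap (PolyRing n) (Loc f) (MvPolynomial.pderiv i (f j)) * fInv f j))

/-- The substitution `sⱼ ↦ sⱼ + c`, with the other variables fixed. -/
def shift {n r : ℕ} (f : Fin r → PolyRing n) (j : Fin r) (c : ℤ) : Module.End ℂ (FsModule f) :=
  ((MvPolynomial.aeval (fun k : Fin r =>
      (MvPolynomial.X k + if k = j then (c : FsModule f) else 0 : FsModule f)) :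
    FsModule f →ₐ[Loc f] FsModule f).toLinearMap).restrictScalars ℂ

/-- The action of `tⱼ`: `tⱼ` sends `sⱼ` to `sⱼ + 1`, so that
`tⱼ (u(s) ∏ₖ fₖ^{sₖ}) = u(s + eⱼ) fⱼ ∏ₖ fₖ^{sₖ}`. -/
def actT {n r : ℕ} (f : Fin r → PolyRing n) (j : Fin r) : Module.End ℂ (FsModule f) :=
  LinearMap.mulLeft ℂ (MvPolynomial.C (algebraMap (PolyRing n) (Loc f) (f j))) ∘ₗ shift f j 1

/-- The action of `tⱼ⁻¹`: `tⱼ⁻¹ (u(s) ∏ₖ fₖ^{sₖ}) = u(s - eⱼ) fⱼ⁻¹ ∏ₖ fₖ^{sₖ}`. -/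
def actTInv {n r : ℕ} (f : Fin r → PolyRing n) (j : Fin r) : Module.End ℂ (FsModule f) :=
  LinearMap.mulLeft ℂ (MvPolynomial.C (fInv f j)) ∘ₗ shift f j (-1)

/-- The action of `s_{i,j} = sᵢ tᵢ⁻¹ tⱼ`. -/
def actS {n r : ℕ} (f : Fin r → PolyRing n) (i j : Fin r) : Module.End ℂ (FsModule f) :=
  LinearMap.mulLeft ℂ (MvPolynomial.X i) ∘ₗ actTInv f i ∘ₗ actT f j

/-- The ring of operators on `ℂ[x][∏ⱼ fⱼ⁻¹, s] ∏ⱼ fⱼ^{sⱼ}` generated by the ring of differential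
operators of affine space (that is, by `ℂ[x]` and the `∂/∂xᵢ`) and the `s_{i,j}`. -/
def operatorRing {n r : ℕ} (f : Fin r → PolyRing n) : Subalgebra ℂ (Module.End ℂ (FsModule f)) :=
  Algebra.adjoin ℂ
    (Set.range (actPoly f) ∪ Set.range (actPartial f) ∪
      Set.range (fun p : Fin r × Fin r => actS f p.1 p.2))

/-- The functional equation
`b(s₁ + ⋯ + s_r) ∏ⱼ fⱼ^{sⱼ} = ∑ₖ Pₖ tₖ ∏ⱼ fⱼ^{sⱼ}` with the `Pₖ` in `operatorRing f`. -/
def FunctionalEquation {n r : ℕ} (f : Fin r → PolyRing n) (b : Polynomial ℂ) : Prop :=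
  ∃ P : Fin r → Module.End ℂ (FsModule f), (∀ k, P k ∈ operatorRing f) ∧
    Polynomial.aeval (∑ j, MvPolynomial.X j : FsModule f) b = ∑ k, P k (actT f k 1)

/-- `b` is the Bernstein–Sato polynomial of `f = (f₁, …, f_r)`: a monic polynomial of lowest degree
which satisfies the functional equation. -/
def IsBernsteinSatoPolynomial {n r : ℕ} (f : Fin r → PolyRing n) (b : Polynomial ℂ) : Prop :=
  b.Monic ∧ FunctionalEquation f b ∧
    ∀ p : Polynomial ℂ, p.Monic → FunctionalEquation f p → b.natDegree ≤ p.natDegree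

/-- The group `ℚ/ℤ`. -/
abbrev QmodZ : Type := ℚ ⧸ AddSubgroup.zmultiples (1 : ℚ)

/-- The set of classes in `ℚ/ℤ` of the rational roots of a complex polynomial. -/
def rootClasses (b : Polynomial ℂ) : Set QmodZ :=
  {x | ∃ q : ℚ, b.IsRoot (q : ℂ) ∧ (QuotientAddGroup.mk q : QmodZ) = x}

/-! ## Monomial ideals, Newton polyhedra and integral closure -/

/-- An ideal of `ℂ[x₁, …, xₙ]` generated by monomials. -/
def IsMonomialIdeal {n : ℕ} (a : Ideal (PolyRing n)) : Prop :=
  ∃ S : Set (Fin n →₀ ℕ), a = Ideal.span ((fun u => MvPolynomial.monomial u (1 : ℂ)) '' S)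

/-- The set of exponents `u ∈ ℕⁿ` with `x^u ∈ a`. -/
def exponents {n : ℕ} (a : Ideal (PolyRing n)) : Set (Fin n →₀ ℕ) :=
  {u | MvPolynomial.monomial u (1 : ℂ) ∈ a}

/-- The Newton polyhedron of `a`: the convex hull in `ℝⁿ` of the exponents of the monomials
in `a`. -/
def newtonPolyhedron {n : ℕ} (a : Ideal (PolyRing n)) : Set (Fin n → ℝ) :=
  convexHull ℝ ((fun (u : Fin n →₀ ℕ) (i : Fin n) => (u i : ℝ)) '' exponents a)

/-- `Q` is a facet of the polyhedron `P`: a nonempty face (the set where some linear form attains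
its maximum on `P`) of dimension `dim P - 1`. -/
def IsFacet {n : ℕ} (P Q : Set (Fin n → ℝ)) : Prop :=
  Q.Nonempty ∧ IsExposed ℝ P Q ∧
    Module.finrank ℝ (vectorSpan ℝ Q) + 1 = Module.finrank ℝ (vectorSpan ℝ P)

/-- The facets of `P` which are not contained in any coordinate hyperplane `{xᵢ = 0}`. -/
def noncoordinateFacets {n : ℕ} (P : Set (Fin n → ℝ)) : Set (Set (Fin n → ℝ)) :=
  {Q | IsFacet P Q ∧ ∀ i, ¬ Q ⊆ {x | x i = 0}}

/-- The number `m_Q`: the smallest positive integer `m` such that `m L_Q` has integral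
coefficients, where `L_Q` is the linear form with `L_Q = 1` on `Q`. (For a facet `Q` of the Newton
polyhedron, not contained in a coordinate hyperplane, `L_Q` exists, is unique, and has rational
coefficients.) -/
def facetDenominator {n : ℕ} (Q : Set (Fin n → ℝ)) : ℕ :=
  sInf {m : ℕ | 0 < m ∧ ∃ L : (Fin n → ℝ) →ₗ[ℝ] ℝ, (∀ x ∈ Q, L x = 1) ∧
    ∀ i, ∃ z : ℤ, (m : ℝ) * L (Pi.single i 1) = z}

/-- The integral closure of an ideal `a`: the elements `z` with an equation
`z^d + c₁ z^(d-1) + ⋯ + c_d = 0`, where `d ≥ 1` and `cₖ ∈ a^k`. -/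
def idealIntegralClosure {R : Type*} [CommRing R] (a : Ideal R) : Set R :=
  {z | ∃ d : ℕ, 0 < d ∧ ∃ c : ℕ → R, (∀ k, c k ∈ a ^ k) ∧
    z ^ d + ∑ k ∈ Finset.Icc 1 d, c k * z ^ (d - k) = 0}

end BernsteinSato

end

/-!
# Bernstein–Sato polynomials of monomial ideals modulo the integers

The functional equation is carried, through injective maps which commute with the operators, to
modules in which it is easier to read.

*Change of generators.* An element `u(s) ∏ⱼ fⱼ^{sⱼ}` is determined by the values `u(μ) f^μ` for
`μ ∈ ℕʳ`, that is, by the linear map `t^μ x^α ↦ x^α u(μ) f^μ` on `ℂ[t, x]`. In this way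
`∏ⱼ fⱼ^{sⱼ}` becomes the delta distribution of the graph of `f`, and `sⱼ` becomes `-∂_{tⱼ} tⱼ`
(`functionalEquation_iff_graphFunEq`). If generators are added to `f`, the new graph is the image
of the old one under a closed embedding, and a comparison of the two `V`-filtrations shows that the
equation depends only on the ideal (`graphFunEq_iff_of_span_eq`). So the generators may be taken to
be monomials `x^{eₖ}`.

*Monomial generators.* For monomials the module is graded by the exponents of `x`, and the degree
`0` part of the right hand side is an explicit ideal of `ℂ[s]`: it is generated by the products
`∏_{cₖ < 0} [sₖ]_{-cₖ} · ∏_{ℓᵢ(c) > 0} [ℓᵢ(s) + ℓᵢ(c)]_{ℓᵢ(c)}` for `c ∈ ℤʳ` with `∑ₖ cₖ = 1`,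
where `ℓᵢ(s) = ∑ₖ sₖ e_{k,i}` and `[z]_m` is the falling factorial
(`graphFunEq_monomial_iff_mem`). By the Nullstellensatz the roots of the Bernstein–Sato polynomial
are the values of `∑ₖ sₖ` on the zero set of this ideal, as soon as these are finite in number
(`exists_generator`).

*The zero set.* A point `s` is in the zero set exactly if there is no `c` with `∑ₖ cₖ = 1` such that
in `s + c` all the `sₖ` which are natural numbers remain so, and all the `ℓᵢ(s)` which are negative
integers remain so. By Farkas' lemma this gives a vertex `β` of the polyhedron
`{β ≥ 0, β · eₖ ≥ 1}` such that `ℓᵢ(s)` is a negative integer when `βᵢ ≠ 0`, and `sₖ` is a natural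
number when `β · eₖ ≠ 1`. Then `∑ₖ sₖ = ∑ᵢ βᵢ ℓᵢ(s) - ∑ₖ (β · eₖ - 1) sₖ` is an integral multiple
of `1/m`, where `m` is the common denominator of the `βᵢ` (`exists_denom_of_mem_zeroSet`). As it is
rational, it is constant on the affine subspaces of which the zero set is a finite union
(`finite_sums`). Conversely, for a vertex `β` the points with these integrality conditions and with
`∑ₖ sₖ` in a given class modulo `ℤ` have bounded sums, and one with the largest sum is in the zero
set (`exists_mem_zeroSet`).

*Facets.* The vertices `β` are the coefficient vectors of the linear forms `L_Q`, for the facets `Q`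
of the Newton polyhedron which are not in a coordinate hyperplane
(`noncoordinateFacets_newtonHull`). Finally, a monomial `x^u` which is integral over a
monomial ideal has its exponent in the Newton polyhedron, so that the polyhedron depends only on the
integral closure
(`newtonPolyhedron_subset_of_integralClosure_subset`).
-/

noncomputable section

namespace BernsteinSato

open MvPolynomial

/-! ### Functional equations in abstract modules -/

/-- Labels for the generators of the ring of operators in the functional equation:
`x i` for a coordinate, `d i` for `∂/∂xᵢ`, and `s i j` for `s_{i,j}`. -/
inductive Gen (n : ℕ) (κ : Type*)
  | x (i : Fin n)
  | d (i : Fin n)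
  | s (i j : κ)

/-- The smallest subspace which contains `S` and is stable under the operators `ρ γ`; that is, the
submodule generated by `S` over the algebra generated by the `ρ γ`. -/
def opSpan {K Γ : Type*} [AddCommGroup K] [Module ℂ K] (ρ : Γ → Module.End ℂ K) (S : Set K) :
    Submodule ℂ K :=
  sInf {W | S ⊆ W ∧ ∀ γ, W ≤ W.comap (ρ γ)}

section opSpan

variable {K K' Γ : Type*} [AddCommGroup K] [Module ℂ K] [AddCommGroup K'] [Module ℂ K']

theorem subset_opSpan (ρ : Γ → Module.End ℂ K) (S : Set K) : S ⊆ opSpan ρ S := by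
  intro v hv
  simp only [opSpan, SetLike.mem_coe, Submodule.mem_sInf]
  exact fun W hW => hW.1 hv

theorem apply_mem_opSpan {ρ : Γ → Module.End ℂ K} {S : Set K} (γ : Γ) {v : K}
    (hv : v ∈ opSpan ρ S) : ρ γ v ∈ opSpan ρ S := by
  simp only [opSpan, Submodule.mem_sInf] at hv ⊢
  exact fun W hW => hW.2 γ (hv W hW)

theorem opSpan_le {ρ : Γ → Module.End ℂ K} {S : Set K} {W : Submodule ℂ K} (hS : S ⊆ W)
    (hρ : ∀ γ, ∀ v ∈ W, ρ γ v ∈ W) : opSpan ρ S ≤ W :=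
  sInf_le ⟨hS, hρ⟩

theorem opSpan_image {ρ : Γ → Module.End ℂ K} {ρ' : Γ → Module.End ℂ K'} (φ : K →ₗ[ℂ] K')
    (h : ∀ γ v, φ (ρ γ v) = ρ' γ (φ v)) (S : Set K) :
    opSpan ρ' (φ '' S) = (opSpan ρ S).map φ := by
  apply le_antisymm
  · refine opSpan_le (Set.image_mono (subset_opSpan ρ S)) ?_
    rintro γ _ ⟨v, hv, rfl⟩
    exact ⟨ρ γ v, apply_mem_opSpan γ hv, h γ v⟩
  · rw [Submodule.map_le_iff_le_comap]
    refine opSpan_le (fun v hv => subset_opSpan _ _ ⟨v, hv, rfl⟩) fun γ v hv => ?_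
    rw [Submodule.mem_comap, h]
    exact apply_mem_opSpan γ hv

theorem aeval_comm_of_comm (φ : K →ₗ[ℂ] K') {A : Module.End ℂ K} {A' : Module.End ℂ K'}
    (h : ∀ v, φ (A v) = A' (φ v)) (b : Polynomial ℂ) (v : K) :
    φ (Polynomial.aeval A b v) = Polynomial.aeval A' b (φ v) := by
  induction b using Polynomial.induction_on' generalizing v with
  | add p q hp hq => simp [hp, hq]
  | monomial m c =>
    have key : ∀ m : ℕ, φ ((A ^ m) v) = (A' ^ m) (φ v) := by
      intro m
      induction m with
      | zero => simp
      | succ m ih => rw [pow_succ', pow_succ', Module.End.mul_apply, Module.End.mul_apply, h, ih]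
    simp [Polynomial.aeval_monomial, key, Algebra.algebraMap_eq_smul_one]

end opSpan

/-- The functional equation `b(s₁ + ⋯ + s_r) δ ∈ ∑ₖ D[s_{i,j}] tₖ δ` in a module `K` on which the
generators act through `ρ`; here `T k` stands for the vector `tₖ δ`, and `s i i` acts as `sᵢ`. -/
def BFunEq {n : ℕ} {κ K : Type*} [Fintype κ] [AddCommGroup K] [Module ℂ K]
    (ρ : Gen n κ → Module.End ℂ K) (T : κ → K) (δ : K) (b : Polynomial ℂ) : Prop :=
  Polynomial.aeval (∑ j, ρ (.s j j)) b δ ∈ opSpan ρ (Set.range T)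

/-- An injective linear map which commutes with the operators transports the functional equation. -/
theorem bFunEq_iff_of_injective {n : ℕ} {κ K K' : Type*} [Fintype κ] [AddCommGroup K] [Module ℂ K]
    [AddCommGroup K'] [Module ℂ K'] {ρ : Gen n κ → Module.End ℂ K}
    {ρ' : Gen n κ → Module.End ℂ K'} {T : κ → K} {T' : κ → K'} {δ : K} {δ' : K'}
    (φ : K →ₗ[ℂ] K') (hφ : Function.Injective φ) (hρ : ∀ γ v, φ (ρ γ v) = ρ' γ (φ v))
    (hT : ∀ k, φ (T k) = T' k) (hδ : φ δ = δ') (b : Polynomial ℂ) :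
    BFunEq ρ T δ b ↔ BFunEq ρ' T' δ' b := by
  have h1 : Set.range T' = φ '' Set.range T := by
    rw [← Set.range_comp]; exact congrArg Set.range (funext fun k => (hT k).symm)
  unfold BFunEq
  rw [h1, opSpan_image φ hρ, ← hδ, ← aeval_comm_of_comm φ (A := ∑ j, ρ (.s j j))]
  · exact (hφ.mem_set_image (s := (opSpan ρ (Set.range T) : Set K))).symm
  · intro v; simp [hρ]

/-! ### Distributions along the graph -/

section Dist

variable {n : ℕ} {κ : Type*} {A : Type*} [AddCommGroup A] [Module ℂ A]

/-- Linear maps from `ℂ[t, x]` to `A`. For `A = ℂ[x]` the evaluation at `t = f(x)` is such a map,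
the delta distribution of the graph of `f`; the Weyl algebra in `t, x` acts on distributions. -/
abbrev Dist (n : ℕ) (κ A : Type*) [AddCommGroup A] [Module ℂ A] : Type _ :=
  MvPolynomial (κ ⊕ Fin n) ℂ →ₗ[ℂ] A

/-- Multiplication of a distribution by a polynomial. -/
def Dist.mul (q : MvPolynomial (κ ⊕ Fin n) ℂ) : Module.End ℂ (Dist n κ A) :=
  LinearMap.lcomp ℂ A (LinearMap.mulLeft ℂ q)

/-- The action of `-∂/∂tₖ` on distributions, which is the transpose of `∂/∂tₖ`. -/
def Dist.negDt (k : κ) : Module.End ℂ (Dist n κ A) :=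
  LinearMap.lcomp ℂ A (pderiv (Sum.inl k)).toLinearMap

/-- The action of `∂/∂xᵢ` on distributions with values in a space `A` on which `∂/∂xᵢ`
acts as `d i`. -/
def Dist.dx (d : Fin n → Module.End ℂ A) (i : Fin n) : Module.End ℂ (Dist n κ A) :=
  LinearMap.compRight ℂ (d i) - LinearMap.lcomp ℂ A (pderiv (Sum.inr i)).toLinearMap

@[simp] theorem Dist.mul_apply (q p : MvPolynomial (κ ⊕ Fin n) ℂ) (ℓ : Dist n κ A) :
    Dist.mul q ℓ p = ℓ (q * p) := rfl

@[simp] theorem Dist.negDt_apply (k : κ) (ℓ : Dist n κ A) (p : MvPolynomial (κ ⊕ Fin n) ℂ) :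
    Dist.negDt k ℓ p = ℓ (pderiv (Sum.inl k) p) := rfl

@[simp] theorem Dist.dx_apply (d : Fin n → Module.End ℂ A) (i : Fin n) (ℓ : Dist n κ A)
    (p : MvPolynomial (κ ⊕ Fin n) ℂ) :
    Dist.dx d i ℓ p = d i (ℓ p) - ℓ (pderiv (Sum.inr i) p) := rfl

/-- The action of the generators on distributions; `s_{i,j}` acts as `-∂_{tᵢ} tⱼ`. -/
def Dist.act (d : Fin n → Module.End ℂ A) : Gen n κ → Module.End ℂ (Dist n κ A)
  | .x i => Dist.mul (X (Sum.inr i))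
  | .d i => Dist.dx d i
  | .s i j => Dist.negDt i * Dist.mul (X (Sum.inl j))

/-- The partial derivatives on `ℂ[x]`. -/
def polyD (n : ℕ) (i : Fin n) : Module.End ℂ (PolyRing n) := (pderiv i).toLinearMap

/-- The delta distribution of the graph of `f`: evaluation at `t = f(x)`. -/
def graphDelta (f : κ → PolyRing n) : Dist n κ (PolyRing n) :=
  (aeval (Sum.elim f X)).toLinearMap

/-- A polynomial in `x`, as a polynomial in `t` and `x`. -/
abbrev constT (κ : Type*) : PolyRing n →ₐ[ℂ] MvPolynomial (κ ⊕ Fin n) ℂ := rename Sum.inr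

theorem pderiv_inl_constT (k : κ) (g : PolyRing n) : pderiv (Sum.inl k) (constT κ g) = 0 := by
  induction g using MvPolynomial.induction_on with
  | C a => simp
  | add p q hp hq => simp [hp, hq]
  | mul_X p i hp =>
    rw [map_mul, Derivation.leibniz, hp]
    simp

theorem pderiv_inr_constT (i : Fin n) (g : PolyRing n) :
    pderiv (Sum.inr i) (constT κ g) = constT κ (pderiv i g) :=
  pderiv_rename Sum.inr_injective i g

theorem pderiv_pderiv_comm {σ : Type*} (i j : σ) (p : MvPolynomial σ ℂ) :
    pderiv i (pderiv j p) = pderiv j (pderiv i p) := by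
  classical
  induction p using MvPolynomial.induction_on with
  | C a => simp
  | add p q hp hq => simp [hp, hq]
  | mul_X p k hp =>
    simp only [Derivation.leibniz, map_add, smul_eq_mul, hp, pderiv_X, Pi.single_apply]
    split_ifs <;> simp <;> ring

@[simp] theorem Dist.mul_zero_poly (v : Dist n κ A) : Dist.mul 0 v = 0 :=
  LinearMap.ext fun p => by simp

@[simp] theorem Dist.mul_one_poly (v : Dist n κ A) : Dist.mul 1 v = v :=
  LinearMap.ext fun p => by simp

theorem Dist.mul_mul (q q' : MvPolynomial (κ ⊕ Fin n) ℂ) (v : Dist n κ A) :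
    Dist.mul q (Dist.mul q' v) = Dist.mul (q * q') v :=
  LinearMap.ext fun p => by simp only [Dist.mul_apply]; congr 1; ring

theorem Dist.mul_mul_comm (q q' : MvPolynomial (κ ⊕ Fin n) ℂ) (v : Dist n κ A) :
    Dist.mul q (Dist.mul q' v) = Dist.mul q' (Dist.mul q v) := by
  rw [Dist.mul_mul, Dist.mul_mul, mul_comm]

theorem Dist.mul_add_poly (q q' : MvPolynomial (κ ⊕ Fin n) ℂ) (v : Dist n κ A) :
    Dist.mul (q + q') v = Dist.mul q v + Dist.mul q' v :=
  LinearMap.ext fun p => by simp [add_mul]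

theorem Dist.mul_C (c : ℂ) (v : Dist n κ A) : Dist.mul (C c) v = c • v :=
  LinearMap.ext fun p => by simp [← smul_eq_C_mul]

theorem Dist.mul_negDt (q : MvPolynomial (κ ⊕ Fin n) ℂ) (k : κ) (v : Dist n κ A) :
    Dist.mul q (Dist.negDt k v) =
      Dist.negDt k (Dist.mul q v) + Dist.mul (pderiv (Sum.inl k) q) v :=
  LinearMap.ext fun p => by simp [Derivation.leibniz, mul_comm]

theorem Dist.mul_dx (d : Fin n → Module.End ℂ A) (q : MvPolynomial (κ ⊕ Fin n) ℂ) (i : Fin n)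
    (v : Dist n κ A) :
    Dist.mul q (Dist.dx d i v) =
      Dist.dx d i (Dist.mul q v) - Dist.mul (pderiv (Sum.inr i) q) v :=
  LinearMap.ext fun p => by simp [Derivation.leibniz, mul_comm, sub_sub]

theorem Dist.negDt_comm (j k : κ) (v : Dist n κ A) :
    Dist.negDt j (Dist.negDt k v) = Dist.negDt k (Dist.negDt j v) :=
  LinearMap.ext fun p => by simp [pderiv_pderiv_comm (Sum.inl j)]

theorem Dist.negDt_dx (d : Fin n → Module.End ℂ A) (k : κ) (i : Fin n) (v : Dist n κ A) :
    Dist.negDt k (Dist.dx d i v) = Dist.dx d i (Dist.negDt k v) :=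
  LinearMap.ext fun p => by simp [pderiv_pderiv_comm (Sum.inl k)]

theorem mul_constT_mem {W : Submodule ℂ (Dist n κ A)}
    (hW : ∀ i, ∀ v ∈ W, Dist.mul (X (Sum.inr i)) v ∈ W) (g : PolyRing n) :
    ∀ v ∈ W, Dist.mul (constT κ g) v ∈ W := by
  induction g using MvPolynomial.induction_on with
  | C a =>
    intro v hv
    rw [algHom_C, algebraMap_eq, Dist.mul_C]
    exact W.smul_mem a hv
  | add p q hp hq =>
    intro v hv
    rw [map_add, Dist.mul_add_poly]
    exact W.add_mem (hp v hv) (hq v hv)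
  | mul_X p i hp =>
    intro v hv
    rw [map_mul, rename_X, ← Dist.mul_mul]
    exact hp _ (hW i v hv)

/-- The steps of the `V`-filtration on the module generated by `δ`: the submodule generated by the
products of `m` of the `tⱼ`, applied to `δ`. -/
def vStep (d : Fin n → Module.End ℂ A) (δ : Dist n κ A) (m : ℕ) : Submodule ℂ (Dist n κ A) :=
  opSpan (Dist.act d)
    {v | ∃ L : List κ, L.length = m ∧ v = Dist.mul (L.map fun j => X (Sum.inl j)).prod δ}

theorem vStep_one (d : Fin n → Module.End ℂ A) (δ : Dist n κ A) :
    vStep d δ 1 = opSpan (Dist.act d) (Set.range fun k => Dist.mul (X (Sum.inl k)) δ) := by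
  unfold vStep
  congr 1
  ext v
  constructor
  · rintro ⟨L, hL, rfl⟩
    obtain ⟨k, rfl⟩ := List.length_eq_one_iff.1 hL
    exact ⟨k, by simp⟩
  · rintro ⟨k, rfl⟩
    exact ⟨[k], rfl, by simp⟩

variable {d : Fin n → Module.End ℂ A} {δ : Dist n κ A} {m : ℕ}

theorem act_mem_vStep (γ : Gen n κ) {v : Dist n κ A} (hv : v ∈ vStep d δ m) :
    Dist.act d γ v ∈ vStep d δ m :=
  apply_mem_opSpan γ hv

theorem mul_constT_mem_vStep (g : PolyRing n) {v : Dist n κ A} (hv : v ∈ vStep d δ m) :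
    Dist.mul (constT κ g) v ∈ vStep d δ m :=
  mul_constT_mem (fun i _ hv => act_mem_vStep (.x i) hv) g v hv

/-- Multiplication by `tₖ` raises the step of the `V`-filtration by one. -/
theorem mul_X_mem_vStep {v : Dist n κ A} (hv : v ∈ vStep d δ m) (k : κ) :
    Dist.mul (X (Sum.inl k)) v ∈ vStep d δ (m + 1) := by
  classical
  have : vStep d δ m ≤ ⨅ k, (vStep d δ (m + 1)).comap (Dist.mul (X (Sum.inl k))) := by
    refine opSpan_le ?_ ?_
    · rintro _ ⟨L, hL, rfl⟩
      simp only [SetLike.mem_coe, Submodule.mem_iInf, Submodule.mem_comap]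
      intro k
      exact subset_opSpan _ _ ⟨k :: L, by simp [hL], by simp [Dist.mul_mul]⟩
    · intro γ v hv
      simp only [Submodule.mem_iInf, Submodule.mem_comap] at hv ⊢
      intro k
      cases γ with
      | x i =>
        simp only [Dist.act]
        rw [Dist.mul_mul_comm]
        exact act_mem_vStep (.x i) (hv k)
      | d i =>
        have h := act_mem_vStep (.d i) (hv k)
        simp only [Dist.act] at h ⊢
        rw [Dist.mul_dx, pderiv_X_of_ne (by simp)]
        simpa using h
      | s i j =>
        have h := act_mem_vStep (.s i j) (hv k)
        simp only [Dist.act, Module.End.mul_apply] at h ⊢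
        rw [Dist.mul_negDt, Dist.mul_mul_comm]
        refine add_mem h ?_
        rw [pderiv_X, Pi.single_apply]
        split_ifs
        · rw [Dist.mul_one_poly]; exact hv j
        · simp
  have h2 := this hv
  simp only [Submodule.mem_iInf, Submodule.mem_comap] at h2
  exact h2 k

/-- The derivative `∂/∂tₖ` lowers the step of the `V`-filtration by one. -/
theorem negDt_mem_vStep {v : Dist n κ A} (hv : v ∈ vStep d δ (m + 1)) (k : κ) :
    Dist.negDt k v ∈ vStep d δ m := by
  classical
  have : vStep d δ (m + 1) ≤ (⨅ k, (vStep d δ m).comap (Dist.negDt k)) := by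
    refine opSpan_le ?_ ?_
    · rintro _ ⟨L, hL, rfl⟩
      simp only [SetLike.mem_coe, Submodule.mem_iInf, Submodule.mem_comap]
      intro k
      cases L with
      | nil => simp at hL
      | cons j L =>
        have h : Dist.mul (L.map fun j => X (Sum.inl j)).prod δ ∈ vStep d δ m :=
          subset_opSpan _ _ ⟨L, by simpa using hL, rfl⟩
        rw [List.map_cons, List.prod_cons, ← Dist.mul_mul]
        exact act_mem_vStep (.s k j) h
    · intro γ v hv
      simp only [Submodule.mem_iInf, Submodule.mem_comap] at hv ⊢
      intro k
      cases γ with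
      | x i =>
        have h := Dist.mul_negDt (X (Sum.inr i)) k v
        rw [pderiv_X_of_ne (by simp)] at h
        simp only [Dist.act]
        convert act_mem_vStep (.x i) (hv k) using 1
        simpa [Dist.act] using h.symm
      | d i =>
        simp only [Dist.act]
        rw [Dist.negDt_dx]
        exact act_mem_vStep (.d i) (hv k)
      | s i j =>
        have h := act_mem_vStep (.s i j) (hv k)
        simp only [Dist.act, Module.End.mul_apply] at h ⊢
        rw [Dist.mul_negDt, map_add, Dist.negDt_comm] at h
        refine (Submodule.add_mem_iff_left _ ?_).1 h
        rw [pderiv_X, Pi.single_apply]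
        split_ifs
        · simpa using hv i
        · simp
  have h2 := this hv
  simp only [Submodule.mem_iInf, Submodule.mem_comap] at h2
  exact h2 k

end Dist

/-! ### Independence of the generators -/

section Independence

variable {n : ℕ} {κ κ' : Type*} {A : Type*} [AddCommGroup A] [Module ℂ A]

/-- Restriction of distributions to the polynomials in a subset of the variables `t`. -/
def Dist.restrict (ι : κ → κ') : Dist n κ' A →ₗ[ℂ] Dist n κ A :=
  LinearMap.lcomp ℂ A (rename (Sum.map ι id)).toLinearMap

@[simp] theorem Dist.restrict_apply (ι : κ → κ') (v : Dist n κ' A)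
    (p : MvPolynomial (κ ⊕ Fin n) ℂ) :
    Dist.restrict ι v p = v (rename (Sum.map ι id) p) := rfl

theorem Dist.restrict_mul (ι : κ → κ') (q : MvPolynomial (κ ⊕ Fin n) ℂ) (v : Dist n κ' A) :
    Dist.restrict ι (Dist.mul (rename (Sum.map ι id) q) v) = Dist.mul q (Dist.restrict ι v) :=
  LinearMap.ext fun p => by simp

theorem Dist.restrict_mul_constT (ι : κ → κ') (g : PolyRing n) (v : Dist n κ' A) :
    Dist.restrict ι (Dist.mul (constT κ' g) v) = Dist.mul (constT κ g) (Dist.restrict ι v) := by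
  rw [← Dist.restrict_mul, rename_rename]; rfl

theorem Dist.restrict_mul_X (ι : κ → κ') (j : κ) (v : Dist n κ' A) :
    Dist.restrict ι (Dist.mul (X (Sum.inl (ι j))) v) =
      Dist.mul (X (Sum.inl j)) (Dist.restrict ι v) := by
  rw [← Dist.restrict_mul, rename_X]; rfl

theorem sumMap_injective {ι : κ → κ'} (hι : Function.Injective ι) :
    Function.Injective (Sum.map ι (id : Fin n → Fin n)) :=
  hι.sumMap Function.injective_id

theorem Dist.restrict_negDt {ι : κ → κ'} (hι : Function.Injective ι) (j : κ) (v : Dist n κ' A) :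
    Dist.restrict ι (Dist.negDt (ι j) v) = Dist.negDt j (Dist.restrict ι v) :=
  LinearMap.ext fun p => congrArg v (pderiv_rename (sumMap_injective hι) (Sum.inl j) p)

theorem Dist.restrict_dx {ι : κ → κ'} (hι : Function.Injective ι) (d : Fin n → Module.End ℂ A)
    (i : Fin n) (v : Dist n κ' A) :
    Dist.restrict ι (Dist.dx d i v) = Dist.dx d i (Dist.restrict ι v) :=
  LinearMap.ext fun p => congrArg (fun q => d i _ - v q)
    (pderiv_rename (sumMap_injective hι) (Sum.inr i) p)

theorem Dist.restrict_negDt_of_notMem {ι : κ → κ'} {k : κ'} (hk : k ∉ Set.range ι)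
    (v : Dist n κ' A) : Dist.restrict ι (Dist.negDt k v) = 0 := by
  refine LinearMap.ext fun p => ?_
  have : pderiv (Sum.inl k) (rename (Sum.map ι (id : Fin n → Fin n)) p) = 0 := by
    induction p using MvPolynomial.induction_on with
    | C a => simp
    | add p q hp hq => simp [hp, hq]
    | mul_X p i hp =>
      rw [map_mul, Derivation.leibniz, hp, rename_X, pderiv_X_of_ne, smul_zero, smul_zero,
        add_zero]
      cases i with
      | inl j => simpa using fun h => hk ⟨j, h⟩
      | inr i => simp
  simp [this]

theorem graphDelta_restrict (h : κ' → PolyRing n) (ι : κ → κ') :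
    Dist.restrict ι (graphDelta h) = graphDelta (h ∘ ι) := by
  refine LinearMap.ext fun p => ?_
  simp only [Dist.restrict_apply, graphDelta, AlgHom.toLinearMap_apply, aeval_rename]
  congr 2
  ext i
  cases i <;> rfl

theorem graphDelta_constT_mul (f : κ → PolyRing n) (g : PolyRing n)
    (p : MvPolynomial (κ ⊕ Fin n) ℂ) :
    graphDelta f (constT κ g * p) = g * graphDelta f p := by
  simp only [graphDelta, AlgHom.toLinearMap_apply, map_mul, aeval_rename]
  congr 1
  exact aeval_X_left_apply g

theorem graphDelta_X_mul (f : κ → PolyRing n) (k : κ) (p : MvPolynomial (κ ⊕ Fin n) ℂ) :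
    graphDelta f (X (Sum.inl k) * p) = f k * graphDelta f p := by
  simp [graphDelta]

variable [Fintype κ]

/-- The functions `t'ₖ - ∑ⱼ aₖⱼ tⱼ`, which vanish on the image of the embedding
`t ↦ (∑ⱼ aₖⱼ tⱼ)ₖ`. -/
def relPoly (ι : κ → κ') (a : κ' → κ → PolyRing n) (k : κ') : MvPolynomial (κ' ⊕ Fin n) ℂ :=
  X (Sum.inl k) - ∑ j, constT κ' (a k j) * X (Sum.inl (ι j))

/-- The distributions in the variables `t'` whose coefficients, when they are expanded in normal
derivatives along the subspace `t'ₖ = ∑ⱼ aₖⱼ tⱼ`, lie in the `V`-filtration of `δ`: the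
coefficient of a derivative of order `l` lies in step `m + l`. -/
def extStep (ι : κ → κ') (a : κ' → κ → PolyRing n) (d : Fin n → Module.End ℂ A)
    (δ : Dist n κ A) (m : ℕ) : Submodule ℂ (Dist n κ' A) :=
  ⨅ L : List κ', (vStep d δ (m + L.length)).comap
    (Dist.restrict ι ∘ₗ Dist.mul (L.map (relPoly ι a)).prod)

variable {ι : κ → κ'} {a : κ' → κ → PolyRing n} {d : Fin n → Module.End ℂ A}
  {δ : Dist n κ A} {m : ℕ}

theorem mem_extStep {v : Dist n κ' A} : v ∈ extStep ι a d δ m ↔ ∀ L : List κ',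
    Dist.restrict ι (Dist.mul (L.map (relPoly ι a)).prod v) ∈ vStep d δ (m + L.length) := by
  simp [extStep]

theorem restrict_mem_vStep {v : Dist n κ' A} (hv : v ∈ extStep ι a d δ m) :
    Dist.restrict ι v ∈ vStep d δ m := by
  simpa using mem_extStep.1 hv []

theorem mul_relPoly_mem_extStep {v : Dist n κ' A} (hv : v ∈ extStep ι a d δ m) (k : κ') :
    Dist.mul (relPoly ι a k) v ∈ extStep ι a d δ (m + 1) := by
  rw [mem_extStep] at hv ⊢
  intro L
  have := hv (k :: L)
  rw [List.map_cons, List.prod_cons, mul_comm, ← Dist.mul_mul, List.length_cons] at this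
  convert this using 2
  ring

/-- Membership in `extStep` by induction on the order of the normal derivative. -/
theorem mem_extStep_of_relPoly (P : ℕ → Dist n κ' A → Prop)
    (h1 : ∀ m v, P m v → Dist.restrict ι v ∈ vStep d δ m)
    (h2 : ∀ m v, P m v → ∀ k, ∃ v₁ v₂, P (m + 1) v₁ ∧ v₂ ∈ extStep ι a d δ (m + 1) ∧
      Dist.mul (relPoly ι a k) v = v₁ + v₂) {v : Dist n κ' A} (hv : P m v) :
    v ∈ extStep ι a d δ m := by
  rw [mem_extStep]
  intro L
  induction L generalizing m v with
  | nil => simpa using h1 m v hv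
  | cons k L ih =>
    obtain ⟨v₁, v₂, hv₁, hv₂, h⟩ := h2 m v hv k
    rw [List.map_cons, List.prod_cons, mul_comm, ← Dist.mul_mul, h, map_add, map_add,
      List.length_cons, add_comm L.length, ← add_assoc]
    exact add_mem (ih hv₁) (mem_extStep.1 hv₂ L)

theorem mul_constT_mem_extStep (g : PolyRing n) {v : Dist n κ' A}
    (hv : v ∈ extStep ι a d δ m) : Dist.mul (constT κ' g) v ∈ extStep ι a d δ m := by
  refine mem_extStep_of_relPoly
    (fun m w => ∃ v ∈ extStep ι a d δ m, w = Dist.mul (constT κ' g) v) ?_ ?_ ⟨v, hv, rfl⟩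
  · rintro m _ ⟨v, hv, rfl⟩
    rw [Dist.restrict_mul_constT]
    exact mul_constT_mem_vStep g (restrict_mem_vStep hv)
  · rintro m _ ⟨v, hv, rfl⟩ k
    exact ⟨_, 0, ⟨_, mul_relPoly_mem_extStep hv k, rfl⟩, zero_mem _, by
      rw [add_zero, Dist.mul_mul_comm]⟩

theorem mul_X_range_mem_extStep (j : κ) {v : Dist n κ' A} (hv : v ∈ extStep ι a d δ m) :
    Dist.mul (X (Sum.inl (ι j))) v ∈ extStep ι a d δ (m + 1) := by
  refine mem_extStep_of_relPoly
    (fun m w => ∃ m', m = m' + 1 ∧ ∃ v ∈ extStep ι a d δ m',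
      w = Dist.mul (X (Sum.inl (ι j))) v) ?_ ?_ ⟨m, rfl, v, hv, rfl⟩
  · rintro _ _ ⟨m, rfl, v, hv, rfl⟩
    rw [Dist.restrict_mul_X]
    exact mul_X_mem_vStep (restrict_mem_vStep hv) j
  · rintro _ _ ⟨m, rfl, v, hv, rfl⟩ k
    exact ⟨_, 0, ⟨_, rfl, _, mul_relPoly_mem_extStep hv k, rfl⟩, zero_mem _, by
      rw [add_zero, Dist.mul_mul_comm]⟩

theorem Dist.mul_sum {β : Type*} (s : Finset β) (q : β → MvPolynomial (κ' ⊕ Fin n) ℂ)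
    (v : Dist n κ' A) : Dist.mul (∑ i ∈ s, q i) v = ∑ i ∈ s, Dist.mul (q i) v :=
  LinearMap.ext fun p => by simp [Finset.sum_mul]

theorem mul_sum_mem_extStep (g : κ → PolyRing n) {v : Dist n κ' A}
    (hv : v ∈ extStep ι a d δ m) :
    Dist.mul (∑ j, constT κ' (g j) * X (Sum.inl (ι j))) v ∈ extStep ι a d δ (m + 1) := by
  rw [Dist.mul_sum]
  refine sum_mem fun j _ => ?_
  rw [← Dist.mul_mul]
  exact mul_constT_mem_extStep _ (mul_X_range_mem_extStep j hv)

theorem mul_X_mem_extStep (k : κ') {v : Dist n κ' A} (hv : v ∈ extStep ι a d δ m) :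
    Dist.mul (X (Sum.inl k)) v ∈ extStep ι a d δ (m + 1) := by
  have h : (X (Sum.inl k) : MvPolynomial (κ' ⊕ Fin n) ℂ) =
      relPoly ι a k + ∑ j, constT κ' (a k j) * X (Sum.inl (ι j)) := by
    simp [relPoly]
  rw [h, Dist.mul_add_poly]
  exact add_mem (mul_relPoly_mem_extStep hv k) (mul_sum_mem_extStep _ hv)

theorem pderiv_inl_relPoly (ι : κ → κ') (a : κ' → κ → PolyRing n) (k l : κ') :
    ∃ g, pderiv (Sum.inl l) (relPoly ι a k) = constT κ' g := by
  classical
  refine ⟨(if k = l then 1 else 0) - ∑ j, a k j * if ι j = l then 1 else 0, ?_⟩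
  simp only [relPoly, map_sub, map_sum, Derivation.leibniz, pderiv_inl_constT, pderiv_X,
    Pi.single_apply, Sum.inl.injEq, smul_eq_mul, map_mul]
  congr 1
  · split_ifs <;> simp
  · refine Finset.sum_congr rfl fun j _ => ?_
    split_ifs <;> simp

theorem negDt_mem_extStep (hι : Function.Injective ι) (l : κ') {v : Dist n κ' A}
    (hv : v ∈ extStep ι a d δ (m + 1)) : Dist.negDt l v ∈ extStep ι a d δ m := by
  refine mem_extStep_of_relPoly
    (fun m w => ∃ v ∈ extStep ι a d δ (m + 1), w = Dist.negDt l v) ?_ ?_ ⟨v, hv, rfl⟩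
  · rintro m _ ⟨v, hv, rfl⟩
    by_cases hl : l ∈ Set.range ι
    · obtain ⟨j, rfl⟩ := hl
      rw [Dist.restrict_negDt hι]
      exact negDt_mem_vStep (restrict_mem_vStep hv) j
    · rw [Dist.restrict_negDt_of_notMem hl]
      exact zero_mem _
  · rintro m _ ⟨v, hv, rfl⟩ k
    obtain ⟨g, hg⟩ := pderiv_inl_relPoly ι a k l
    exact ⟨_, _, ⟨_, mul_relPoly_mem_extStep hv k, rfl⟩, mul_constT_mem_extStep g hv, by
      rw [Dist.mul_negDt, hg]⟩

theorem pderiv_inr_relPoly (ι : κ → κ') (a : κ' → κ → PolyRing n) (k : κ') (i : Fin n) :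
    pderiv (Sum.inr i) (relPoly ι a k) =
      ∑ j, constT κ' (-pderiv i (a k j)) * X (Sum.inl (ι j)) := by
  simp only [relPoly, map_sub, map_sum, Derivation.leibniz, pderiv_inr_constT, smul_eq_mul]
  rw [pderiv_X_of_ne (by simp), zero_sub, ← Finset.sum_neg_distrib]
  refine Finset.sum_congr rfl fun j _ => ?_
  rw [pderiv_X_of_ne (by simp), map_neg]
  ring

theorem dx_mem_extStep (hι : Function.Injective ι) (i : Fin n) {v : Dist n κ' A}
    (hv : v ∈ extStep ι a d δ m) : Dist.dx d i v ∈ extStep ι a d δ m := by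
  refine mem_extStep_of_relPoly
    (fun m w => ∃ v ∈ extStep ι a d δ m, w = Dist.dx d i v) ?_ ?_ ⟨v, hv, rfl⟩
  · rintro m _ ⟨v, hv, rfl⟩
    rw [Dist.restrict_dx hι]
    exact act_mem_vStep (.d i) (restrict_mem_vStep hv)
  · rintro m _ ⟨v, hv, rfl⟩ k
    refine ⟨_, -Dist.mul (pderiv (Sum.inr i) (relPoly ι a k)) v,
      ⟨_, mul_relPoly_mem_extStep hv k, rfl⟩, ?_, ?_⟩
    · rw [pderiv_inr_relPoly]
      exact neg_mem (mul_sum_mem_extStep _ hv)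
    · rw [Dist.mul_dx, sub_eq_add_neg]

theorem act_mem_extStep (hι : Function.Injective ι) (γ : Gen n κ') {v : Dist n κ' A}
    (hv : v ∈ extStep ι a d δ m) : Dist.act d γ v ∈ extStep ι a d δ m := by
  cases γ with
  | x i =>
    have := mul_constT_mem_extStep (X i) hv
    rwa [rename_X] at this
  | d i => exact dx_mem_extStep hι i hv
  | s i j => exact negDt_mem_extStep hι i (mul_X_mem_extStep j hv)

/-- The functional equation `BFunEq` for the delta distribution of the graph of `f`. -/
def GraphFunEq {κ : Type*} [Fintype κ] (f : κ → PolyRing n) (b : Polynomial ℂ) : Prop :=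
  BFunEq (Dist.act (polyD n)) (fun k => Dist.mul (X (Sum.inl k)) (graphDelta f)) (graphDelta f) b

/-- The algebra homomorphism `t'ₖ ↦ ∑ⱼ aₖⱼ tⱼ`. -/
def relSubst (a : κ' → κ → PolyRing n) :
    MvPolynomial (κ' ⊕ Fin n) ℂ →ₐ[ℂ] MvPolynomial (κ ⊕ Fin n) ℂ :=
  aeval (Sum.elim (fun k => ∑ j, constT κ (a k j) * X (Sum.inl j)) fun i => X (Sum.inr i))

theorem relSubst_constT (a : κ' → κ → PolyRing n) (g : PolyRing n) :
    relSubst a (constT κ' g) = constT κ g := by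
  have : (relSubst a).comp (constT κ') = constT κ :=
    MvPolynomial.algHom_ext fun i => by simp [relSubst]
  exact DFunLike.congr_fun this g

/-- Push-forward of distributions along the embedding `t ↦ (∑ⱼ aₖⱼ tⱼ)ₖ`. -/
def Dist.push (a : κ' → κ → PolyRing n) : Dist n κ A →ₗ[ℂ] Dist n κ' A :=
  LinearMap.lcomp ℂ A (relSubst a).toLinearMap

@[simp] theorem Dist.push_apply (a : κ' → κ → PolyRing n) (v : Dist n κ A)
    (p : MvPolynomial (κ' ⊕ Fin n) ℂ) : Dist.push a v p = v (relSubst a p) := rfl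

theorem mul_relPoly_graphDelta {h : κ' → PolyRing n} (ha : ∀ k, h k = ∑ j, a k j * h (ι j))
    (k : κ') : Dist.mul (relPoly ι a k) (graphDelta h) = 0 := by
  refine LinearMap.ext fun p => ?_
  simp only [Dist.mul_apply, relPoly, sub_mul, map_sub, graphDelta_X_mul, Finset.sum_mul, map_sum,
    mul_assoc, graphDelta_constT_mul, LinearMap.zero_apply]
  rw [ha k, Finset.sum_mul, sub_eq_zero]
  exact Finset.sum_congr rfl fun j _ => by ring

variable [Fintype κ']

theorem Dist.restrict_sum_s (hι : Function.Injective ι) (v : Dist n κ' A) :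
    Dist.restrict ι ((∑ k, Dist.act d (.s k k)) v) =
      (∑ j, Dist.act d (.s j j)) (Dist.restrict ι v) := by
  classical
  simp only [LinearMap.sum_apply, map_sum, Dist.act, Module.End.mul_apply]
  rw [← Finset.sum_subset (Finset.subset_univ (Finset.univ.image ι)),
    Finset.sum_image hι.injOn]
  · simp only [Dist.restrict_negDt hι, Dist.restrict_mul_X]
  · intro k _ hk
    exact Dist.restrict_negDt_of_notMem (by simpa using hk) _

/-- The functional equation descends to a part of the generators which generates the same ideal.
A distribution on the larger space is restricted to the polynomials in fewer variables, and
`extStep` contains the right hand side, since `δ` is killed by the `relPoly`. -/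
theorem graphFunEq_comp {h : κ' → PolyRing n} (hι : Function.Injective ι)
    (ha : ∀ k, h k = ∑ j, a k j * h (ι j)) {b : Polynomial ℂ} (hb : GraphFunEq h b) :
    GraphFunEq (h ∘ ι) b := by
  unfold GraphFunEq BFunEq at hb ⊢
  rw [← vStep_one, ← graphDelta_restrict h ι,
    ← aeval_comm_of_comm (Dist.restrict ι) (Dist.restrict_sum_s hι)]
  have h0 : graphDelta h ∈ extStep ι a (polyD n) (Dist.restrict ι (graphDelta h)) 0 := by
    rw [mem_extStep]
    intro L
    cases L with
    | nil => exact subset_opSpan _ _ ⟨[], rfl, by simp⟩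
    | cons k L =>
      rw [List.map_cons, List.prod_cons, mul_comm, ← Dist.mul_mul, mul_relPoly_graphDelta ha]
      simp
  refine restrict_mem_vStep (a := a) (opSpan_le ?_ (fun γ v hv => act_mem_extStep hι γ hv) hb)
  rintro _ ⟨k, rfl⟩
  exact mul_X_mem_extStep k h0

theorem pderiv_inl_relSubst (a : κ' → κ → PolyRing n) (j : κ)
    (p : MvPolynomial (κ' ⊕ Fin n) ℂ) :
    pderiv (Sum.inl j) (relSubst a p) =
      ∑ k, constT κ (a k j) * relSubst a (pderiv (Sum.inl k) p) := by
  classical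
  induction p using MvPolynomial.induction_on with
  | C c => simp [relSubst]
  | add p q hp hq => simp [hp, hq, mul_add, Finset.sum_add_distrib]
  | mul_X p i hp =>
    have hX : pderiv (Sum.inl j) (relSubst a (X i)) =
        ∑ k, constT κ (a k j) * relSubst a (pderiv (Sum.inl k) (X i)) := by
      cases i with
      | inl l =>
        simp [relSubst, Derivation.leibniz, pderiv_inl_constT, pderiv_X, Pi.single_apply,
          apply_ite]
      | inr i => simp [relSubst, pderiv_X]
    simp only [map_mul, Derivation.leibniz, hX, hp, smul_eq_mul, map_add, Finset.mul_sum,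
      mul_add, Finset.sum_add_distrib]
    refine congrArg₂ (· + ·) ?_ ?_ <;> exact Finset.sum_congr rfl fun k _ => by ring

theorem pderiv_inr_relSubst (a : κ' → κ → PolyRing n) (i : Fin n)
    (p : MvPolynomial (κ' ⊕ Fin n) ℂ) :
    pderiv (Sum.inr i) (relSubst a p) = relSubst a (pderiv (Sum.inr i) p) +
      ∑ k, ∑ j, X (Sum.inl j) * (constT κ (pderiv i (a k j)) *
        relSubst a (pderiv (Sum.inl k) p)) := by
  classical
  induction p using MvPolynomial.induction_on with
  | C c => simp [relSubst]
  | add p q hp hq =>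
    simp only [map_add, hp, hq, mul_add, Finset.sum_add_distrib]
    ring
  | mul_X p l hp =>
    have hX : pderiv (Sum.inr i) (relSubst a (X l)) = relSubst a (pderiv (Sum.inr i) (X l)) +
        ∑ k, ∑ j, X (Sum.inl j) * (constT κ (pderiv i (a k j)) *
          relSubst a (pderiv (Sum.inl k) (X l))) := by
      cases l with
      | inl l =>
        simp [relSubst, Derivation.leibniz, pderiv_inr_constT, pderiv_X, Pi.single_apply,
          apply_ite]
      | inr l => simp [relSubst, pderiv_X, Pi.single_apply, apply_ite]
    simp only [map_mul, Derivation.leibniz, hX, hp, smul_eq_mul, map_add, Finset.mul_sum,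
      mul_add, Finset.sum_add_distrib]
    have h1 : ∀ x y z w : MvPolynomial (κ ⊕ Fin n) ℂ, ∀ x' y' z' w',
      x = x' → y = y' → z = z' → w = w' → x + y + (z + w) = x' + z' + (y' + w') := by
      rintro x y z w _ _ _ _ rfl rfl rfl rfl; ring
    refine h1 _ _ _ _ _ _ _ _ rfl ?_ rfl ?_ <;>
    exact Finset.sum_congr rfl fun k _ => Finset.sum_congr rfl fun j _ => by ring

/-- The functional equation extends from a part of the generators which generates the same ideal,
by push-forward of distributions. -/
theorem graphFunEq_of_comp {h : κ' → PolyRing n}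
    (ha : ∀ k, h k = ∑ j, a k j * h (ι j))
    (hι : ∀ j, relSubst a (X (Sum.inl (ι j))) = X (Sum.inl j)) {b : Polynomial ℂ}
    (hb : GraphFunEq (h ∘ ι) b) : GraphFunEq h b := by
  unfold GraphFunEq BFunEq at hb ⊢
  have hδ : Dist.push a (graphDelta (h ∘ ι)) = graphDelta h := by
    refine LinearMap.ext fun p => ?_
    have : (aeval (Sum.elim (h ∘ ι) X)).comp (relSubst a) = aeval (Sum.elim h X) := by
      refine MvPolynomial.algHom_ext fun i => ?_
      cases i with
      | inl k =>
        have hc : ∀ g : PolyRing n, aeval (Sum.elim (h ∘ ι) X) (constT κ g) = g := by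
          intro g
          simpa [graphDelta] using graphDelta_constT_mul (h ∘ ι) g 1
        simp only [relSubst, AlgHom.comp_apply, aeval_X, Sum.elim_inl, map_sum, map_mul, hc, ha k,
          Function.comp]
      | inr i => simp [relSubst]
    exact DFunLike.congr_fun this p
  have hs : ∀ v, Dist.push a ((∑ j, Dist.act (polyD n) (.s j j)) v) =
      (∑ k, Dist.act (polyD n) (.s k k)) (Dist.push a v) := by
    intro v
    refine LinearMap.ext fun p => ?_
    simp only [LinearMap.sum_apply, Dist.act, Module.End.mul_apply, Dist.push_apply,
      Dist.negDt_apply, Dist.mul_apply, pderiv_inl_relSubst]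
    rw [← map_sum v, ← map_sum v]
    congr 1
    simp only [Finset.mul_sum, map_mul]
    rw [Finset.sum_comm]
    refine Finset.sum_congr rfl fun k _ => ?_
    simp only [relSubst, aeval_X, Sum.elim_inl, Finset.sum_mul]
    exact Finset.sum_congr rfl fun j _ => by ring
  rw [← hδ, ← aeval_comm_of_comm (Dist.push a) hs]
  set W := opSpan (Dist.act (polyD n)) (Set.range fun k => Dist.mul (X (Sum.inl k))
    (Dist.push a (graphDelta (h ∘ ι)))) with hW
  have hWc : ∀ g : PolyRing n, ∀ v ∈ W, Dist.mul (constT κ' g) v ∈ W :=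
    fun g v hv => mul_constT_mem (fun i v hv => apply_mem_opSpan (.x i) hv) g v hv
  suffices H : opSpan (Dist.act (polyD n)) (Set.range fun k => Dist.mul (X (Sum.inl k))
      (graphDelta (h ∘ ι))) ≤ W.comap (Dist.push a) from H hb
  refine opSpan_le ?_ ?_
  · rintro _ ⟨j, rfl⟩
    refine subset_opSpan _ _ ⟨ι j, LinearMap.ext fun p => ?_⟩
    simp [hι]
  · intro γ v hv
    rw [Submodule.mem_comap] at hv ⊢
    cases γ with
    | x i =>
      convert apply_mem_opSpan (ρ := Dist.act (polyD n)) (.x i) hv using 1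
      refine LinearMap.ext fun p => ?_
      simp [Dist.act, relSubst]
    | d i =>
      have : Dist.push a (Dist.act (polyD n) (.d i) v) =
          Dist.act (polyD n) (.d i) (Dist.push a v) - ∑ k, ∑ j,
            Dist.mul (constT κ' (pderiv i (a k j)))
              (Dist.act (polyD n) (.s k (ι j)) (Dist.push a v)) := by
        refine LinearMap.ext fun p => ?_
        simp [Dist.act, pderiv_inr_relSubst, Derivation.leibniz, pderiv_inl_constT, hι,
          relSubst_constT, sub_sub]
      rw [this]
      exact sub_mem (apply_mem_opSpan _ hv) (sum_mem fun k _ => sum_mem fun j _ =>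
        hWc _ _ (apply_mem_opSpan _ hv))
    | s i j =>
      have : Dist.push a (Dist.act (polyD n) (.s i j) v) = ∑ k,
            Dist.mul (constT κ' (a k i))
              (Dist.act (polyD n) (.s k (ι j)) (Dist.push a v)) := by
        refine LinearMap.ext fun p => ?_
        simp [Dist.act, pderiv_inl_relSubst, Derivation.leibniz, pderiv_inl_constT, hι,
          relSubst_constT]
      rw [this]
      exact sum_mem fun k _ => hWc _ _ (apply_mem_opSpan _ hv)

end Independence

/-- The functional equation only depends on the ideal generated by the `fₖ`. -/
theorem graphFunEq_iff_of_span_eq {n : ℕ} {κ κ' : Type*} [Fintype κ] [Fintype κ']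
    {f : κ → PolyRing n} {g : κ' → PolyRing n}
    (hfg : Ideal.span (Set.range f) = Ideal.span (Set.range g)) (b : Polynomial ℂ) :
    GraphFunEq f b ↔ GraphFunEq g b := by
  classical
  have hf : ∀ k, ∃ c : κ' → PolyRing n, f k = ∑ j, c j * g j := by
    intro k
    have : f k ∈ Ideal.span (Set.range g) := hfg ▸ Ideal.subset_span ⟨k, rfl⟩
    obtain ⟨c, hc⟩ := Ideal.mem_span_range_iff_exists_fun.1 this
    exact ⟨c, hc.symm⟩
  have hg : ∀ k, ∃ c : κ → PolyRing n, g k = ∑ j, c j * f j := by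
    intro k
    have : g k ∈ Ideal.span (Set.range f) := hfg ▸ Ideal.subset_span ⟨k, rfl⟩
    obtain ⟨c, hc⟩ := Ideal.mem_span_range_iff_exists_fun.1 this
    exact ⟨c, hc.symm⟩
  choose cf hcf using hf
  choose cg hcg using hg
  have e1 : GraphFunEq f b ↔ GraphFunEq (Sum.elim f g) b := by
    have ha : ∀ k, Sum.elim f g k = ∑ j, (Sum.elim (fun j => Pi.single j 1) cg :
        κ ⊕ κ' → κ → PolyRing n) k j * Sum.elim f g (Sum.inl j) := by
      rintro (k | k)
      · simp [Pi.single_apply]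
      · simp [← hcg]
    exact ⟨graphFunEq_of_comp ha fun j => by simp [relSubst, Pi.single_apply, apply_ite],
      fun h => graphFunEq_comp Sum.inl_injective ha h⟩
  have e2 : GraphFunEq g b ↔ GraphFunEq (Sum.elim f g) b := by
    have ha : ∀ k, Sum.elim f g k = ∑ j, (Sum.elim cf (fun j => Pi.single j 1) :
        κ ⊕ κ' → κ' → PolyRing n) k j * Sum.elim f g (Sum.inr j) := by
      rintro (k | k)
      · simp [← hcf]
      · simp [Pi.single_apply]
    exact ⟨graphFunEq_of_comp ha fun j => by simp [relSubst, Pi.single_apply, apply_ite],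
      fun h => graphFunEq_comp Sum.inr_injective ha h⟩
  rw [e1, e2]

/-! ### Comparison with the module of the definition -/

section FsModule

variable {n r : ℕ} (f : Fin r → PolyRing n)

/-- The action of the generators on `ℂ[x][∏ⱼ fⱼ⁻¹, s] ∏ⱼ fⱼ^{sⱼ}`. -/
def fsAct : Gen n (Fin r) → Module.End ℂ (FsModule f)
  | .x i => actPoly f (X i)
  | .d i => actPartial f i
  | .s i j => actS f i j

theorem actPoly_mem {W : Submodule ℂ (FsModule f)} (hW : ∀ i, ∀ v ∈ W, actPoly f (X i) v ∈ W)
    (g : PolyRing n) : ∀ v ∈ W, actPoly f g v ∈ W := by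
  induction g using MvPolynomial.induction_on with
  | C c =>
    intro v hv
    convert W.smul_mem c hv using 1
    have : algebraMap (PolyRing n) (Loc f) (C c) = algebraMap ℂ (Loc f) c :=
      (IsScalarTower.algebraMap_apply ℂ (PolyRing n) (Loc f) c).symm
    simp only [actPoly, LinearMap.mulLeft_apply, this]
    rw [← algebraMap_eq, ← IsScalarTower.algebraMap_apply ℂ (Loc f) (FsModule f),
      ← Algebra.smul_def]
  | add p q hp hq =>
    intro v hv
    convert W.add_mem (hp v hv) (hq v hv) using 1
    simp [actPoly, add_mul]
  | mul_X p i hp =>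
    intro v hv
    convert hp _ (hW i v hv) using 1
    simp [actPoly]

theorem actS_self (j : Fin r) (u : FsModule f) : actS f j j u = X j * u := by
  have hs : ∀ u : FsModule f, shift f j (-1) (shift f j 1 u) = u := by
    intro u
    have : (aeval fun k : Fin r => (X k + if k = j then ((-1 : ℤ) : FsModule f) else 0)).comp
        (aeval fun k : Fin r => (X k + if k = j then ((1 : ℤ) : FsModule f) else 0)) =
        AlgHom.id (Loc f) (FsModule f) := by
      refine MvPolynomial.algHom_ext fun k => ?_
      by_cases h : k = j <;> simp [h]
    exact DFunLike.congr_fun this u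
  have hm : ∀ (c : ℤ) (g : Loc f) (u : FsModule f),
      shift f j c (C g * u) = C g * shift f j c u := by
    intro c g u
    simp [shift, algebraMap_eq]
  simp only [actS, actT, actTInv, LinearMap.comp_apply, LinearMap.mulLeft_apply, hm, hs]
  rw [← mul_assoc (C _), ← C_mul, mul_comm (fInv f j), mul_fInv, C_1, one_mul]

theorem functionalEquation_iff_bFunEq (b : Polynomial ℂ) :
    FunctionalEquation f b ↔ BFunEq (fsAct f) (fun k => actT f k 1) 1 b := by
  have h1 : Polynomial.aeval (∑ j, fsAct f (.s j j)) b 1 =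
      Polynomial.aeval (∑ j, X j : FsModule f) b := by
    have := aeval_comm_of_comm (LinearMap.id : FsModule f →ₗ[ℂ] FsModule f)
      (A := ∑ j, fsAct f (.s j j)) (A' := LinearMap.mulLeft ℂ (∑ j, X j : FsModule f))
      (fun v => by simp [fsAct, actS_self, Finset.sum_mul]) b 1
    rw [LinearMap.id_apply, LinearMap.id_apply] at this
    rw [this]
    have h2 : Polynomial.aeval (LinearMap.mulLeft ℂ (∑ j, X j : FsModule f)) b =
        LinearMap.mulLeft ℂ (Polynomial.aeval (∑ j, X j : FsModule f) b) :=
      Polynomial.aeval_algHom_apply (Algebra.lmul ℂ (FsModule f)) (∑ j, X j) b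
    rw [h2, LinearMap.mulLeft_apply, mul_one]
  unfold BFunEq FunctionalEquation
  rw [h1]
  generalize Polynomial.aeval (∑ j, X j : FsModule f) b = w
  constructor
  · rintro ⟨P, hP, rfl⟩
    refine sum_mem fun k _ => ?_
    have hk := subset_opSpan (fsAct f) _ (Set.mem_range_self (f := fun k => actT f k 1) k)
    generalize actT f k 1 = v at hk
    have := hP k
    unfold operatorRing at this
    generalize P k = p at this
    induction this using Algebra.adjoin_induction generalizing v with
    | mem x hx =>
      rcases hx with (⟨g, rfl⟩ | ⟨i, rfl⟩) | ⟨p, rfl⟩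
      · exact actPoly_mem f (fun i v hv => apply_mem_opSpan (ρ := fsAct f) (.x i) hv) g v hk
      · exact apply_mem_opSpan (ρ := fsAct f) (.d i) hk
      · exact apply_mem_opSpan (ρ := fsAct f) (.s p.1 p.2) hk
    | algebraMap c =>
      rw [Module.algebraMap_end_apply]
      exact Submodule.smul_mem _ c hk
    | add x y _ _ hx hy => exact add_mem (hx v hk) (hy v hk)
    | mul x y _ _ hx hy => exact hx _ (hy _ hk)
  · intro hw
    let W : Submodule ℂ (FsModule f) :=
      { carrier := {w | ∃ P : Fin r → Module.End ℂ (FsModule f), (∀ k, P k ∈ operatorRing f) ∧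
          w = ∑ k, P k (actT f k 1)}
        zero_mem' := ⟨0, fun k => zero_mem _, by simp⟩
        add_mem' := by
          rintro _ _ ⟨P, hP, rfl⟩ ⟨Q, hQ, rfl⟩
          exact ⟨P + Q, fun k => add_mem (hP k) (hQ k), by simp [Finset.sum_add_distrib]⟩
        smul_mem' := by
          rintro c _ ⟨P, hP, rfl⟩
          exact ⟨c • P, fun k => Subalgebra.smul_mem _ (hP k) c, by simp [Finset.smul_sum]⟩ }
    refine opSpan_le (W := W) ?_ ?_ hw
    · rintro _ ⟨k, rfl⟩
      refine ⟨Pi.single k 1, fun j => ?_, ?_⟩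
      · by_cases h : j = k
        · subst h; simp
        · simp [h]
      · rw [Finset.sum_eq_single k]
        · simp
        · intro j _ h; simp [h]
        · simp
    · rintro γ _ ⟨P, hP, rfl⟩
      refine ⟨fun k => fsAct f γ * P k, fun k => mul_mem ?_ (hP k), by simp⟩
      refine Algebra.subset_adjoin ?_
      cases γ with
      | x i => exact Or.inl (Or.inl ⟨X i, rfl⟩)
      | d i => exact Or.inl (Or.inr ⟨i, rfl⟩)
      | s i j => exact Or.inr ⟨(i, j), rfl⟩

/-- The delta distribution of the graph of `f`, with values in `ℂ[x][∏ⱼ fⱼ⁻¹]`. -/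
def locDelta : MvPolynomial (Fin r ⊕ Fin n) ℂ →ₐ[ℂ] Loc f :=
  aeval (Sum.elim (fun j => algebraMap (PolyRing n) (Loc f) (f j))
    fun i => algebraMap (PolyRing n) (Loc f) (X i))

/-- Evaluation of the variables `s` at a vector of natural numbers. -/
def evalNat (m : Fin r → ℕ) : FsModule f →ₐ[Loc f] Loc f := aeval fun j => (m j : Loc f)

/-- The distribution `t^μ x^α ↦ x^α u(μ) ∏ⱼ fⱼ^{μⱼ}` of an element `u ∏ⱼ fⱼ^{sⱼ}`. -/
def fsToDist : FsModule f →ₗ[ℂ] Dist n (Fin r) (Loc f) :=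
  ((basisMonomials (Fin r ⊕ Fin n) ℂ).constr ℂ).toLinearMap ∘ₗ LinearMap.pi fun m =>
    LinearMap.mulLeft ℂ (locDelta f (monomial m 1)) ∘ₗ
      (evalNat f fun j => m (Sum.inl j)).toLinearMap.restrictScalars ℂ

theorem fsToDist_monomial (u : FsModule f) (m : Fin r ⊕ Fin n →₀ ℕ) :
    fsToDist f u (monomial m 1) =
      locDelta f (monomial m 1) * evalNat f (fun j => m (Sum.inl j)) u := by
  have := (basisMonomials (Fin r ⊕ Fin n) ℂ).constr_basis ℂ (fun m =>
    locDelta f (monomial m 1) * evalNat f (fun j => m (Sum.inl j)) u) m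
  rw [coe_basisMonomials] at this
  exact this

theorem dist_ext {κ A : Type*} [AddCommGroup A] [Module ℂ A] {v w : Dist n κ A}
    (h : ∀ m, v (monomial m 1) = w (monomial m 1)) : v = w :=
  (basisMonomials (κ ⊕ Fin n) ℂ).ext fun m => by simpa using h m

theorem X_mul_monomial {σ : Type*} (i : σ) (m : σ →₀ ℕ) :
    (X i * monomial m 1 : MvPolynomial σ ℂ) = monomial (m + Finsupp.single i 1) 1 := by
  rw [mul_comm, X, monomial_mul, one_mul]

theorem evalNat_shift (k : Fin r) (m m' : Fin r → ℕ) (c : ℤ)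
    (h : ∀ j, (m' j : ℤ) = m j + if j = k then c else 0) (u : FsModule f) :
    evalNat f m (shift f k c u) = evalNat f m' u := by
  have : (evalNat f m).comp (aeval fun j : Fin r =>
      (X j + if j = k then (c : FsModule f) else 0)) = evalNat f m' := by
    refine MvPolynomial.algHom_ext fun j => ?_
    have h' := congrArg (Int.cast : ℤ → Loc f) (h j)
    by_cases hj : j = k
    · simpa [evalNat, hj] using (by simpa [hj] using h' : (m' k : Loc f) = _).symm
    · simpa [evalNat, hj] using (by simpa [hj] using h' : (m' j : Loc f) = _).symm
  exact DFunLike.congr_fun this u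

theorem fsToDist_actT (k : Fin r) (u : FsModule f) :
    fsToDist f (actT f k u) = Dist.mul (X (Sum.inl k)) (fsToDist f u) := by
  refine dist_ext fun m => ?_
  rw [Dist.mul_apply, X_mul_monomial, fsToDist_monomial, fsToDist_monomial, ← X_mul_monomial,
    map_mul]
  simp only [actT, LinearMap.comp_apply, LinearMap.mulLeft_apply, map_mul]
  rw [evalNat_shift f k _
    (fun j => (m + Finsupp.single (Sum.inl k) 1 : Fin r ⊕ Fin n →₀ ℕ) (Sum.inl j))]
  · simp [evalNat, locDelta]
    ring
  · intro j
    by_cases h : j = k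
    · simp [h]
    · simp [h]

theorem fsToDist_actS (i j : Fin r) (u : FsModule f) :
    fsToDist f (actS f i j u) = Dist.negDt i (Dist.mul (X (Sum.inl j)) (fsToDist f u)) := by
  rw [← fsToDist_actT]
  refine dist_ext fun m => ?_
  have e : actS f i j u = X i * actTInv f i (actT f j u) := rfl
  rw [e]
  generalize actT f j u = w
  rw [Dist.negDt_apply, pderiv_monomial, one_mul, fsToDist_monomial, map_mul]
  have hX : evalNat f (fun j => m (Sum.inl j)) (X i) = (m (Sum.inl i) : Loc f) := by
    simp [evalNat]
  rw [hX]
  rcases Nat.eq_zero_or_pos (m (Sum.inl i)) with h0 | hpos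
  · simp [h0]
  · obtain ⟨m', rfl⟩ : ∃ m', m = m' + Finsupp.single (Sum.inl i) 1 :=
      ⟨m - Finsupp.single (Sum.inl i) 1,
        (tsub_add_cancel_of_le (Finsupp.single_le_iff.2 hpos)).symm⟩
    have hc : (monomial m'
        (((m' + Finsupp.single (Sum.inl i) 1 : Fin r ⊕ Fin n →₀ ℕ) (Sum.inl i) : ℕ) : ℂ) :
        MvPolynomial (Fin r ⊕ Fin n) ℂ) =
        (((m' + Finsupp.single (Sum.inl i) 1 : Fin r ⊕ Fin n →₀ ℕ) (Sum.inl i) : ℕ) : ℂ) •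
          monomial m' 1 := by
      rw [smul_monomial, smul_eq_mul, mul_one]
    rw [add_tsub_cancel_right, hc, map_smul, fsToDist_monomial, ← X_mul_monomial, map_mul]
    simp only [actTInv, LinearMap.comp_apply, LinearMap.mulLeft_apply, map_mul]
    rw [evalNat_shift f i _ (fun j => m' (Sum.inl j))]
    · have hF : locDelta f (X (Sum.inl i)) = algebraMap _ _ (f i) := by simp [locDelta]
      have hI : ∀ m, evalNat f m (C (fInv f i)) = fInv f i := fun m => by simp [evalNat]
      rw [hF, hI, Algebra.smul_def, map_natCast]
      linear_combination (locDelta f (monomial m' 1) *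
        (((m' + Finsupp.single (Sum.inl i) 1 : Fin r ⊕ Fin n →₀ ℕ) (Sum.inl i) : ℕ) : Loc f) *
        evalNat f (fun j => m' (Sum.inl j)) w) * mul_fInv f i
    · intro j
      by_cases h : j = i
      · simp [h]
      · simp [h]

theorem evalNat_coeffPderiv (i : Fin n) (m : Fin r → ℕ) (u : FsModule f) :
    evalNat f m (coeffPderiv f i u) = locPderiv f i (evalNat f m u) := by
  induction u using MvPolynomial.induction_on' with
  | add p q hp hq => simp [hp, hq]
  | monomial μ c =>
    have h : coeffPderiv f i (monomial μ c) = monomial μ (locPderiv f i c) := by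
      refine MvPolynomial.ext _ _ fun ν => ?_
      rw [coeff_coeffPderiv, coeff_monomial, coeff_monomial]
      split_ifs <;> simp
    have hn : ∀ k : ℕ, locPderiv f i (c * k) = locPderiv f i c * k := by
      intro k; simp [Derivation.leibniz, mul_comm]
    rw [h]
    simp only [evalNat, aeval_monomial, Finsupp.prod]
    have : ∏ x ∈ μ.support, (m x : Loc f) ^ μ x = ((∏ x ∈ μ.support, m x ^ μ x : ℕ) : Loc f) := by
      push_cast; rfl
    rw [this]
    exact (hn _).symm

theorem locPderiv_locDelta (i : Fin n) (p : MvPolynomial (Fin r ⊕ Fin n) ℂ) :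
    locPderiv f i (locDelta f p) = locDelta f (pderiv (Sum.inr i) p) +
      ∑ j, locDelta f (pderiv (Sum.inl j) p) * algebraMap _ _ (pderiv i (f j)) := by
  classical
  induction p using MvPolynomial.induction_on with
  | C c => simp [algHom_C]
  | add p q hp hq =>
    simp only [map_add, hp, hq, add_mul, Finset.sum_add_distrib]
    ring
  | mul_X p l hp =>
    have hX : locPderiv f i (locDelta f (X l)) = locDelta f (pderiv (Sum.inr i) (X l)) +
      ∑ j, locDelta f (pderiv (Sum.inl j) (X l)) * algebraMap _ _ (pderiv i (f j)) := by
      cases l with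
      | inl l =>
        simp [locDelta, locPderiv, Derivation.localization_algebraMap, pderiv_X, Pi.single_apply,
          apply_ite]
      | inr l =>
        by_cases h : l = i <;>
        simp [locDelta, locPderiv, Derivation.localization_algebraMap, pderiv_X, h]
    simp only [map_mul, Derivation.leibniz, hX, hp, smul_eq_mul, map_add, Finset.mul_sum,
      mul_add, add_mul, Finset.sum_add_distrib]
    have h1 : ∀ x y z w x' y' z' w' : Loc f,
      x = x' → y = y' → z = z' → w = w' → x + y + (z + w) = x' + z' + (y' + w') := by
      rintro x y z w _ _ _ _ rfl rfl rfl rfl; ring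
    refine h1 _ _ _ _ _ _ _ _ rfl ?_ rfl ?_ <;>
    exact Finset.sum_congr rfl fun k _ => by ring

theorem locDelta_pderiv_inl (j : Fin r) (m : Fin r ⊕ Fin n →₀ ℕ) :
    locDelta f (pderiv (Sum.inl j) (monomial m 1)) =
      m (Sum.inl j) * fInv f j * locDelta f (monomial m 1) := by
  have h := congrArg (locDelta f) (X_mul_pderiv_monomial (i := Sum.inl j) (m := m) (r := (1 : ℂ)))
  have hF : locDelta f (X (Sum.inl j)) = algebraMap _ _ (f j) := by simp [locDelta]
  rw [map_mul, hF, map_nsmul, nsmul_eq_mul] at h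
  linear_combination fInv f j * h - locDelta f (pderiv (Sum.inl j) (monomial m 1)) * mul_fInv f j

theorem fsToDist_actPartial (i : Fin n) (u : FsModule f) :
    fsToDist f (actPartial f i u) = Dist.dx (fun i => (locPderiv f i).toLinearMap) i
      (fsToDist f u) := by
  refine dist_ext fun m => ?_
  rw [Dist.dx_apply, fsToDist_monomial, fsToDist_monomial]
  have h2 : fsToDist f u (pderiv (Sum.inr i) (monomial m 1)) =
      locDelta f (pderiv (Sum.inr i) (monomial m 1)) * evalNat f (fun j => m (Sum.inl j)) u := by
    rw [pderiv_monomial, one_mul]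
    have hc : ∀ (m' : Fin r ⊕ Fin n →₀ ℕ) (c : ℂ),
      (monomial m' c : MvPolynomial (Fin r ⊕ Fin n) ℂ) = c • monomial m' 1 := by
      intro m' c; rw [smul_monomial, smul_eq_mul, mul_one]
    rw [hc, map_smul, map_smul, fsToDist_monomial, smul_mul_assoc]
    congr 4
    funext j
    simp
  rw [h2]
  have h3 : evalNat f (fun j => m (Sum.inl j)) (actPartial f i u) =
      locPderiv f i (evalNat f (fun j => m (Sum.inl j)) u) + (∑ j, m (Sum.inl j) *
        (algebraMap _ _ (pderiv i (f j)) * fInv f j)) * evalNat f (fun j => m (Sum.inl j)) u := by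
    rw [← evalNat_coeffPderiv]
    simp [actPartial, evalNat]
  rw [h3]
  simp only [Derivation.coeFn_coe, Derivation.leibniz, smul_eq_mul, locPderiv_locDelta,
    locDelta_pderiv_inl]
  have h4 : ∑ j, m (Sum.inl j) * fInv f j * locDelta f (monomial m 1) *
        algebraMap _ _ (pderiv i (f j)) = locDelta f (monomial m 1) * ∑ j, m (Sum.inl j) *
        (algebraMap _ _ (pderiv i (f j)) * fInv f j) := by
    rw [Finset.mul_sum]
    exact Finset.sum_congr rfl fun j _ => by ring
  rw [h4]
  ring

theorem fsToDist_act (γ : Gen n (Fin r)) (u : FsModule f) :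
    fsToDist f (fsAct f γ u) =
      Dist.act (fun i => (locPderiv f i).toLinearMap) γ (fsToDist f u) := by
  cases γ with
  | x i =>
    refine dist_ext fun m => ?_
    simp only [Dist.act]
    rw [Dist.mul_apply, X_mul_monomial, fsToDist_monomial, fsToDist_monomial, ← X_mul_monomial,
      map_mul]
    simp [fsAct, actPoly, evalNat, locDelta]
    ring
  | d i => exact fsToDist_actPartial f i u
  | s i j => exact fsToDist_actS f i j u

/-- An element `u ∏ⱼ fⱼ^{sⱼ}` is determined by its distribution: a polynomial over a domain of
characteristic zero is determined by its values at the vectors of natural numbers. -/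
theorem fsToDist_injective (hf : ∀ j, f j ≠ 0) : Function.Injective (fsToDist f) := by
  have hM : Submonoid.powers (∏ j, f j) ≤ nonZeroDivisors (PolyRing n) :=
    powers_le_nonZeroDivisors_of_noZeroDivisors (Finset.prod_ne_zero_iff.2 fun j _ => hf j)
  have : IsDomain (Loc f) := IsLocalization.isDomain_localization hM
  have : CharZero (Loc f) := algebraRat.charZero _
  rw [← LinearMap.ker_eq_bot, LinearMap.ker_eq_bot']
  intro u hu
  refine MvPolynomial.funext_set (fun _ => Set.range (Nat.cast : ℕ → Loc f))
    (fun _ => Set.infinite_range_of_injective Nat.cast_injective) fun s hs => ?_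
  choose m hm using fun j => hs j (Set.mem_univ j)
  obtain rfl : (fun j => (m j : Loc f)) = s := funext hm
  let μ : Fin r ⊕ Fin n →₀ ℕ := Finsupp.equivFunOnFinite.symm (Sum.elim m 0)
  have h := fsToDist_monomial f u μ
  rw [hu, LinearMap.zero_apply] at h
  have hne : locDelta f (monomial μ 1) ≠ 0 := by
    rw [locDelta, aeval_monomial, map_one, one_mul, Finsupp.prod, Finset.prod_ne_zero_iff]
    rintro (j | i) hi
    · refine pow_ne_zero _ ?_
      simpa using (map_ne_zero_iff _ (IsLocalization.injective (Loc f) hM)).2 (hf j)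
    · simp [μ] at hi
  have h0 := (mul_eq_zero.1 h.symm).resolve_left hne
  rw [map_zero]
  exact h0

/-- The functional equation of `∏ⱼ fⱼ^{sⱼ}` is that of the delta distribution of the graph: both
embed into the distributions with values in `ℂ[x][∏ⱼ fⱼ⁻¹]`. -/
theorem functionalEquation_iff_graphFunEq (hf : ∀ j, f j ≠ 0) (b : Polynomial ℂ) :
    FunctionalEquation f b ↔ GraphFunEq f b := by
  have hM : Submonoid.powers (∏ j, f j) ≤ nonZeroDivisors (PolyRing n) :=
    powers_le_nonZeroDivisors_of_noZeroDivisors (Finset.prod_ne_zero_iff.2 fun j _ => hf j)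
  have hone : fsToDist f 1 = (locDelta f).toLinearMap := by
    refine dist_ext fun m => ?_
    rw [fsToDist_monomial]
    simp
  have hδ : LinearMap.compRight ℂ (Algebra.linearMap (PolyRing n) (Loc f) |>.restrictScalars ℂ)
      (graphDelta f) = (locDelta f).toLinearMap := by
    refine LinearMap.ext fun p => ?_
    have : (IsScalarTower.toAlgHom ℂ (PolyRing n) (Loc f)).comp (aeval (Sum.elim f X)) =
        locDelta f := by
      refine MvPolynomial.algHom_ext fun i => ?_
      cases i <;> simp [locDelta]
    exact DFunLike.congr_fun this p
  rw [functionalEquation_iff_bFunEq, bFunEq_iff_of_injective (fsToDist f) (fsToDist_injective f hf)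
    (fsToDist_act f) (fsToDist_actT f · 1) rfl, hone]
  refine (bFunEq_iff_of_injective
    (LinearMap.compRight ℂ (Algebra.linearMap (PolyRing n) (Loc f) |>.restrictScalars ℂ))
    ?_ ?_ ?_ hδ b).symm
  · intro v w h
    exact LinearMap.ext fun p => IsLocalization.injective (Loc f) hM (DFunLike.congr_fun h p)
  · intro γ v
    refine LinearMap.ext fun p => ?_
    cases γ with
    | x i => rfl
    | d i =>
      simp [Dist.act, polyD, locPderiv, Derivation.localization_algebraMap]
    | s i j => rfl
  · intro k
    rw [← hδ]
    rfl

end FsModule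

/-! ### Monomial generators -/

section Monomial

variable {n : ℕ} {κ : Type*}

/-- The substitution `s ↦ s + c`. -/
def shiftBy (c : κ → ℤ) : MvPolynomial κ ℂ →ₐ[ℂ] MvPolynomial κ ℂ :=
  aeval fun k => X k + (c k : MvPolynomial κ ℂ)

/-- The evaluation of a polynomial in `s` at a vector of natural numbers. -/
def evalAtNat (m : κ → ℕ) : MvPolynomial κ ℂ →ₐ[ℂ] ℂ := aeval fun k => (m k : ℂ)

theorem evalAtNat_shiftBy (c : κ → ℤ) (m m' : κ → ℕ) (h : ∀ k, (m' k : ℤ) = m k + c k)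
    (p : MvPolynomial κ ℂ) : evalAtNat m (shiftBy c p) = evalAtNat m' p := by
  have : (evalAtNat m).comp (shiftBy c) = evalAtNat m' := by
    refine MvPolynomial.algHom_ext fun k => ?_
    have h' := congrArg (Int.cast : ℤ → ℂ) (h k)
    push_cast at h'
    simp [evalAtNat, shiftBy, h']
  exact DFunLike.congr_fun this p

variable (e : κ → Fin n →₀ ℕ)

/-- The exponent of the power of `tₖ`, as an integral vector. -/
def expVec (k : κ) (i : Fin n) : ℤ := e k i

/-- The partial derivatives on families of coefficients of Laurent series in `x`. -/
def seriesD (i : Fin n) : Module.End ℂ ((Fin n → ℤ) → ℂ) :=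
  LinearMap.pi fun v => LinearMap.mulLeft ℂ (v i + 1 : ℂ) ∘ₗ LinearMap.proj (v + Pi.single i 1)

theorem seriesD_apply (i : Fin n) (G : (Fin n → ℤ) → ℂ) (v : Fin n → ℤ) :
    seriesD i G v = (v i + 1) * G (v + Pi.single i 1) := rfl

/-- An exponent vector as an integral vector. -/
def toInt (m : Fin n →₀ ℕ) (i : Fin n) : ℤ := m i

theorem toInt_injective : Function.Injective (toInt (n := n)) := fun m m' h =>
  Finsupp.ext fun i => by simpa [toInt] using congrFun h i

/-- The family of coefficients of a polynomial. -/
def coeffFamily : PolyRing n →ₗ[ℂ] ((Fin n → ℤ) → ℂ) :=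
  (basisMonomials (Fin n) ℂ).constr ℂ fun m => Pi.single (toInt m) 1

theorem coeffFamily_monomial (m : Fin n →₀ ℕ) :
    coeffFamily (monomial m 1) = Pi.single (toInt m) 1 := by
  have := (basisMonomials (Fin n) ℂ).constr_basis ℂ
    (fun m => (Pi.single (toInt m) 1 : (Fin n → ℤ) → ℂ)) m
  rwa [coe_basisMonomials] at this

theorem monomial_eq_smul {σ : Type*} (m : σ →₀ ℕ) (c : ℂ) :
    (monomial m c : MvPolynomial σ ℂ) = c • monomial m 1 := by
  rw [smul_monomial, smul_eq_mul, mul_one]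

theorem coeffFamily_toInt (p : PolyRing n) (m : Fin n →₀ ℕ) :
    coeffFamily p (toInt m) = coeff m p := by
  induction p using MvPolynomial.induction_on' with
  | add p q hp hq => simp [hp, hq]
  | monomial m' c =>
    rw [monomial_eq_smul, map_smul, coeffFamily_monomial]
    by_cases h : m' = m
    · simp [h]
    · simp [coeff_monomial, h, toInt_injective.eq_iff, Ne.symm h]

theorem coeffFamily_injective : Function.Injective (coeffFamily (n := n)) := fun p q h =>
  MvPolynomial.ext _ _ fun m => by rw [← coeffFamily_toInt, h, coeffFamily_toInt]

theorem coeffFamily_pderiv (i : Fin n) (p : PolyRing n) :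
    coeffFamily (pderiv i p) = seriesD i (coeffFamily p) := by
  induction p using MvPolynomial.induction_on' with
  | add p q hp hq => simp [hp, hq]
  | monomial m c =>
    rw [monomial_eq_smul m c, Derivation.map_smul, map_smul, map_smul, map_smul, pderiv_monomial,
      one_mul, monomial_eq_smul, map_smul, coeffFamily_monomial, coeffFamily_monomial]
    congr 1
    ext v
    rw [seriesD_apply, Pi.smul_apply, smul_eq_mul]
    rcases Nat.eq_zero_or_pos (m i) with h0 | hpos
    · rw [h0, Nat.cast_zero, zero_mul, eq_comm, mul_eq_zero, or_iff_not_imp_right]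
      intro h
      have hv : v + Pi.single i 1 = toInt m := by
        by_contra hne
        exact h (Pi.single_eq_of_ne hne _)
      have := congrFun hv i
      simp only [Pi.add_apply, Pi.single_eq_same, toInt, h0, Nat.cast_zero] at this
      exact_mod_cast this
    · obtain ⟨m', rfl⟩ : ∃ m', m = m' + Finsupp.single i 1 :=
        ⟨m - Finsupp.single i 1, (tsub_add_cancel_of_le (Finsupp.single_le_iff.2 hpos)).symm⟩
      rw [add_tsub_cancel_right]
      have hm : toInt (m' + Finsupp.single i 1) = toInt m' + Pi.single i 1 := by
        ext j
        by_cases h : j = i <;> simp [toInt, h]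
      rw [hm]
      by_cases h : v = toInt m'
      · simp [h, toInt]
      · rw [Pi.single_eq_of_ne h, Pi.single_eq_of_ne (by simpa using h)]
        simp

variable [Fintype κ]

/-- The linear map `c ↦ ∑ₖ cₖ eₖ` on integral vectors. -/
def expSum (c : κ → ℤ) (i : Fin n) : ℤ := ∑ k, c k * e k i

/-- The linear form `ℓᵢ(s) = ∑ₖ e_{k,i} sₖ`. -/
def expForm (i : Fin n) : MvPolynomial κ ℂ := ∑ k, (e k i : MvPolynomial κ ℂ) * X k

/-- The exponent of `x` in the monomial `t^μ x^α` after the substitution `tₖ = x^{eₖ}`. -/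
def weight (m : κ ⊕ Fin n →₀ ℕ) (i : Fin n) : ℤ :=
  m (Sum.inr i) + ∑ k, (m (Sum.inl k) : ℤ) * e k i

theorem weight_add_inl (m : κ ⊕ Fin n →₀ ℕ) (k : κ) :
    weight e (m + Finsupp.single (Sum.inl k) 1) = weight e m + expVec e k := by
  classical
  ext i
  simp [weight, add_mul, Finset.sum_add_distrib, expVec, Finsupp.single_apply, add_assoc]

theorem weight_add_inr (m : κ ⊕ Fin n →₀ ℕ) (i : Fin n) :
    weight e (m + Finsupp.single (Sum.inr i) 1) = weight e m + Pi.single i 1 := by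
  ext j
  by_cases h : j = i
  · simp [weight, h]; ring
  · simp [weight, h]

/-- The distribution of a family `G`: it maps `t^μ x^α` to the family of coefficients of
`x^α ∑_u G_u(μ) x^u ∏ₖ x^{μₖ eₖ}`. -/
def monToDist : ((Fin n → ℤ) → MvPolynomial κ ℂ) →ₗ[ℂ] Dist n κ ((Fin n → ℤ) → ℂ) :=
  ((basisMonomials (κ ⊕ Fin n) ℂ).constr ℂ).toLinearMap ∘ₗ LinearMap.pi fun m =>
    LinearMap.pi fun v => (evalAtNat fun k => m (Sum.inl k)).toLinearMap ∘ₗ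
      LinearMap.proj (v - weight e m)

theorem monToDist_monomial (G : (Fin n → ℤ) → MvPolynomial κ ℂ) (m : κ ⊕ Fin n →₀ ℕ)
    (v : Fin n → ℤ) : monToDist e G (monomial m 1) v =
      evalAtNat (fun k => m (Sum.inl k)) (G (v - weight e m)) := by
  have := (basisMonomials (κ ⊕ Fin n) ℂ).constr_basis ℂ (fun m v =>
    evalAtNat (fun k => m (Sum.inl k)) (G (v - weight e m))) m
  rw [coe_basisMonomials] at this
  exact congrFun this v

theorem evalAtNat_expForm (m : κ → ℕ) (i : Fin n) :
    evalAtNat m (expForm e i) = ∑ k, (m k : ℂ) * e k i := by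
  simp [evalAtNat, expForm, mul_comm]

theorem monToDist_injective : Function.Injective (monToDist e) := by
  rw [← LinearMap.ker_eq_bot, LinearMap.ker_eq_bot']
  intro G hG
  funext u
  refine MvPolynomial.funext_set (fun _ => Set.range (Nat.cast : ℕ → ℂ))
    (fun _ => Set.infinite_range_of_injective Nat.cast_injective) fun s hs => ?_
  choose m hm using fun j => hs j (Set.mem_univ j)
  obtain rfl : (fun j => (m j : ℂ)) = s := funext hm
  let μ : κ ⊕ Fin n →₀ ℕ := Finsupp.equivFunOnFinite.symm (Sum.elim m 0)
  have h := monToDist_monomial e G μ (u + weight e μ)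
  rw [hG, add_sub_cancel_right] at h
  rw [Pi.zero_apply, map_zero]
  exact h.symm

theorem graphDelta_monomial (m : κ ⊕ Fin n →₀ ℕ) :
    coeffFamily (graphDelta (fun k => monomial (e k) 1) (monomial m 1)) =
      Pi.single (weight e m) 1 := by
  suffices H : ∃ w, graphDelta (fun k => monomial (e k) 1) (monomial m 1) = monomial w 1 ∧
      toInt w = weight e m by
    obtain ⟨w, h1, h2⟩ := H
    rw [h1, coeffFamily_monomial, h2]
  classical
  induction m using Finsupp.induction_linear with
  | zero => exact ⟨0, by simp [graphDelta], by ext; simp [toInt, weight]⟩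
  | add m m' hm hm' =>
    obtain ⟨w, h1, h2⟩ := hm
    obtain ⟨w', h1', h2'⟩ := hm'
    refine ⟨w + w', ?_, ?_⟩
    · have hm : ∀ {σ : Type _} (m m' : σ →₀ ℕ), (monomial (m + m') 1 : MvPolynomial σ ℂ) =
          monomial m 1 * monomial m' 1 := fun m m' => by rw [monomial_mul, one_mul]
      have hw : (monomial (w + w') 1 : PolyRing n) = monomial w 1 * monomial w' 1 := by
        rw [monomial_mul, one_mul]
      rw [hm, hw, ← h1, ← h1']
      simp only [graphDelta, AlgHom.toLinearMap_apply, map_mul]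
    · ext i
      have h3 := congrFun h2 i
      have h3' := congrFun h2' i
      simp only [toInt, weight, Finsupp.add_apply, Nat.cast_add, add_mul, Finset.sum_add_distrib]
        at h3 h3' ⊢
      rw [h3, h3']; ring
  | single l c =>
    rw [← X_pow_eq_monomial]
    simp only [graphDelta, AlgHom.toLinearMap_apply, map_pow, aeval_X]
    cases l with
    | inl k =>
      refine ⟨c • e k, by simp [monomial_pow], ?_⟩
      ext i
      simp [toInt, weight, Finsupp.single_apply]
    | inr i =>
      refine ⟨Finsupp.single i c, by simp [X_pow_eq_monomial], ?_⟩
      ext j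
      simp [toInt, weight, Finsupp.single_apply]

variable [DecidableEq κ]

/-- The action of the generators on families `(G_u)` of polynomials in `s`, where the family `G`
stands for `∑_u G_u(s) x^u ∏ₖ x^{sₖ eₖ}`. -/
def monAct : Gen n κ → Module.End ℂ ((Fin n → ℤ) → MvPolynomial κ ℂ)
  | .x i => LinearMap.funLeft ℂ _ fun u => u - Pi.single i 1
  | .d i => LinearMap.pi fun u => LinearMap.mulLeft ℂ ((u i + 1 : ℤ) + expForm e i) ∘ₗ
      LinearMap.proj (u + Pi.single i 1)
  | .s j k => LinearMap.pi fun u => LinearMap.mulLeft ℂ (X j) ∘ₗ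
      (shiftBy (Pi.single k 1 - Pi.single j 1)).toLinearMap ∘ₗ
        LinearMap.proj (u + expVec e j - expVec e k)

theorem monAct_x (i : Fin n) (G : (Fin n → ℤ) → MvPolynomial κ ℂ) (u : Fin n → ℤ) :
    monAct e (.x i) G u = G (u - Pi.single i 1) := rfl

theorem monAct_d (i : Fin n) (G : (Fin n → ℤ) → MvPolynomial κ ℂ) (u : Fin n → ℤ) :
    monAct e (.d i) G u = ((u i + 1 : ℤ) + expForm e i) * G (u + Pi.single i 1) := rfl

theorem monAct_s (j k : κ) (G : (Fin n → ℤ) → MvPolynomial κ ℂ) (u : Fin n → ℤ) :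
    monAct e (.s j k) G u = X j * shiftBy (Pi.single k 1 - Pi.single j 1)
      (G (u + expVec e j - expVec e k)) := rfl

theorem monToDist_act (γ : Gen n κ) (G : (Fin n → ℤ) → MvPolynomial κ ℂ) :
    monToDist e (monAct e γ G) = Dist.act seriesD γ (monToDist e G) := by
  refine dist_ext fun m => funext fun v => ?_
  rw [monToDist_monomial]
  cases γ with
  | x i =>
    simp only [Dist.act]
    rw [Dist.mul_apply, X_mul_monomial, monToDist_monomial, monAct_x, weight_add_inr, sub_sub]
    simp
  | d i =>
    simp only [Dist.act]
    rw [Dist.dx_apply, monAct_d, Pi.sub_apply, Pi.sub_apply, seriesD_apply, monToDist_monomial,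
      pderiv_monomial, one_mul, monomial_eq_smul, map_smul, Pi.smul_apply, monToDist_monomial,
      map_mul, map_add, evalAtNat_expForm]
    rcases Nat.eq_zero_or_pos (m (Sum.inr i)) with h0 | hpos
    · rw [h0, sub_add_eq_add_sub, map_intCast]
      simp only [weight, h0, Int.cast_add, Int.cast_sub, Int.cast_sum, Int.cast_mul,
        Int.cast_natCast, Int.cast_one, Nat.cast_zero, zero_smul, sub_zero, Int.cast_zero]
      ring_nf
    · obtain ⟨m', rfl⟩ : ∃ m', m = m' + Finsupp.single (Sum.inr i) 1 :=
        ⟨m - Finsupp.single (Sum.inr i) 1,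
          (tsub_add_cancel_of_le (Finsupp.single_le_iff.2 hpos)).symm⟩
      have hs1 : v - (weight e m' + Pi.single i 1) + Pi.single i 1 = v - weight e m' := by abel
      have hs2 : v + Pi.single i 1 - (weight e m' + Pi.single i 1) = v - weight e m' := by abel
      rw [add_tsub_cancel_right, weight_add_inr, hs1, hs2]
      simp [weight]
      ring
  | s j k =>
    simp only [Dist.act, Module.End.mul_apply]
    rw [Dist.negDt_apply, Dist.mul_apply, monAct_s, pderiv_monomial, one_mul, monomial_eq_smul,
      mul_smul_comm, X_mul_monomial, map_smul, Pi.smul_apply, monToDist_monomial, map_mul]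
    have hX : evalAtNat (fun k => m (Sum.inl k)) (X j) = (m (Sum.inl j) : ℂ) := by
      simp [evalAtNat]
    rw [hX, smul_eq_mul]
    rcases Nat.eq_zero_or_pos (m (Sum.inl j)) with h0 | hpos
    · simp [h0]
    · obtain ⟨m', rfl⟩ : ∃ m', m = m' + Finsupp.single (Sum.inl j) 1 :=
        ⟨m - Finsupp.single (Sum.inl j) 1,
          (tsub_add_cancel_of_le (Finsupp.single_le_iff.2 hpos)).symm⟩
      congr 1
      rw [add_tsub_cancel_right, weight_add_inl, weight_add_inl]
      rw [evalAtNat_shiftBy _ _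
        (fun l => (m' + Finsupp.single (Sum.inl k) 1 : κ ⊕ Fin n →₀ ℕ) (Sum.inl l))]
      · congr 2
        abel
      · intro l
        simp [Finsupp.single_apply, Pi.single_apply, eq_comm]

/-- For monomials, the functional equation can be read in the families `(G_u)` of polynomials in
`s`: both modules embed into the distributions whose values are Laurent series in `x`. -/
theorem graphFunEq_monomial_iff (b : Polynomial ℂ) :
    GraphFunEq (fun k => monomial (e k) 1) b ↔
      BFunEq (monAct e) (fun k => Pi.single (expVec e k) 1) (Pi.single 0 1) b := by
  have hδ : LinearMap.compRight ℂ coeffFamily (graphDelta fun k => monomial (e k) 1) =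
      monToDist e (Pi.single 0 1) := by
    refine dist_ext fun m => ?_
    refine (graphDelta_monomial e m).trans (funext fun v => ?_)
    rw [monToDist_monomial]
    by_cases h : v = weight e m
    · simp [h]
    · rw [Pi.single_eq_of_ne h, Pi.single_eq_of_ne (by simpa [sub_eq_zero] using h), map_zero]
  unfold GraphFunEq
  rw [bFunEq_iff_of_injective (LinearMap.compRight ℂ coeffFamily) (ρ' := Dist.act seriesD)
    (T' := fun k => Dist.mul (X (Sum.inl k)) (monToDist e (Pi.single 0 1))) ?_ ?_ ?_ hδ b]
  · refine (bFunEq_iff_of_injective (monToDist e) (monToDist_injective e) (monToDist_act e) ?_ rfl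
      b).symm
    intro k
    refine dist_ext fun m => funext fun v => ?_
    rw [Dist.mul_apply, X_mul_monomial, monToDist_monomial, monToDist_monomial, weight_add_inl]
    by_cases h : v = weight e m + expVec e k
    · simp [h]
    · rw [Pi.single_eq_of_ne (by rwa [Ne, sub_eq_iff_eq_add']),
        Pi.single_eq_of_ne (by rwa [Ne, sub_eq_zero]), map_zero, map_zero]
  · intro v w h
    exact LinearMap.ext fun p => coeffFamily_injective (DFunLike.congr_fun h p)
  · intro γ v
    refine LinearMap.ext fun p => ?_
    cases γ with
    | x i => rfl
    | d i => simp [Dist.act, polyD, coeffFamily_pderiv]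
    | s i j => rfl
  · intro k
    rw [← hδ]
    rfl

end Monomial

/-! ### The ideal of the functional equation of monomials -/

section MonomialIdeal

variable {n : ℕ} {κ : Type*}

/-- The falling factorial `p (p - 1) ⋯ (p - m + 1)`. -/
def fallFac {R : Type*} [CommRing R] (p : R) (m : ℕ) : R := ∏ j ∈ Finset.range m, (p - j)

section fallFac
variable {R : Type*} [CommRing R]

@[simp] theorem fallFac_zero (p : R) : fallFac p 0 = 1 := rfl

theorem fallFac_succ (p : R) (m : ℕ) : fallFac p (m + 1) = fallFac p m * (p - m) :=
  Finset.prod_range_succ _ _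

theorem fallFac_succ' (p : R) (m : ℕ) : fallFac p (m + 1) = p * fallFac (p - 1) m := by
  rw [fallFac, Finset.prod_range_succ', mul_comm, fallFac]
  congr 1
  · simp
  · exact Finset.prod_congr rfl fun j _ => by push_cast; ring

theorem fallFac_dvd (p : R) {m m' : ℕ} (h : m ≤ m') : fallFac p m ∣ fallFac p m' :=
  Finset.prod_dvd_prod_of_subset _ _ _ (Finset.range_mono h)

theorem map_fallFac {R' : Type*} [CommRing R'] (φ : R →+* R') (p : R) (m : ℕ) :
    φ (fallFac p m) = fallFac (φ p) m := by
  simp [fallFac, map_prod]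

end fallFac

theorem shiftBy_zero (p : MvPolynomial κ ℂ) : shiftBy 0 p = p := by
  simp [shiftBy]

variable [Fintype κ] (e : κ → Fin n →₀ ℕ)

/-- The factor `∏_{cₖ < 0} sₖ (sₖ - 1) ⋯ (sₖ + cₖ + 1)`. -/
def negFactor (c : κ → ℤ) : MvPolynomial κ ℂ := ∏ k, fallFac (X k) (-c k).toNat

/-- The factor by which a differential operator of degree `u - ∑ₖ cₖ eₖ` acts on the monomial
`∏ₖ x^{(sₖ + cₖ) eₖ}`. -/
def derivFactor (c : κ → ℤ) (u : Fin n → ℤ) : MvPolynomial κ ℂ :=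
  ∏ i, fallFac (expForm e i + (expSum e c i : MvPolynomial κ ℂ)) (expSum e c i - u i).toNat

/-- The ideal of the polynomials `p(s)` such that `p(s) x^u ∏ₖ x^{sₖ eₖ}` lies in the module of
the right hand side of the functional equation. -/
def stepIdeal (u : Fin n → ℤ) : Ideal (MvPolynomial κ ℂ) :=
  Ideal.span {h | ∃ c : κ → ℤ, ∑ k, c k = 1 ∧ h = negFactor c * derivFactor e c u}

variable {e}

theorem expSum_add (c c' : κ → ℤ) : expSum e (c + c') = expSum e c + expSum e c' := by
  ext i; simp [expSum, add_mul, Finset.sum_add_distrib]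

theorem expSum_single [DecidableEq κ] (k : κ) : expSum e (Pi.single k 1) = expVec e k := by
  ext i; simp [expSum, expVec, Pi.single_apply]

theorem expSum_sub (c c' : κ → ℤ) : expSum e (c - c') = expSum e c - expSum e c' := by
  ext i; simp [expSum, sub_mul, Finset.sum_sub_distrib]

theorem shiftBy_expForm (c : κ → ℤ) (i : Fin n) :
    shiftBy c (expForm e i) = expForm e i + (expSum e c i : MvPolynomial κ ℂ) := by
  simp only [shiftBy, expForm, expSum, map_sum, map_mul, map_natCast, aeval_X, mul_add,
    Finset.sum_add_distrib, Int.cast_sum, Int.cast_mul, Int.cast_natCast]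
  refine congrArg₂ (· + ·) rfl (Finset.sum_congr rfl fun k _ => mul_comm _ _)

theorem shiftBy_derivFactor (c c' : κ → ℤ) (u : Fin n → ℤ) :
    shiftBy c (derivFactor e c' u) = derivFactor e (c' + c) (u + expSum e c) := by
  simp only [derivFactor, map_prod]
  refine Finset.prod_congr rfl fun i _ => ?_
  refine (map_fallFac (shiftBy c).toRingHom _ _).trans ?_
  congr 1
  · change shiftBy c (expForm e i + (expSum e c' i : MvPolynomial κ ℂ)) = _
    rw [map_add, shiftBy_expForm, map_intCast, expSum_add]
    simp; ring
  · congr 1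
    simp [expSum_add]

theorem derivFactor_dvd_of_le (c : κ → ℤ) {u u' : Fin n → ℤ} (h : u ≤ u') :
    derivFactor e c u' ∣ derivFactor e c u :=
  Finset.prod_dvd_prod_of_dvd _ _ fun i _ => fallFac_dvd _ (by
    have := h i
    exact Int.toNat_le_toNat (by linarith))

theorem derivFactor_dvd_mul (c : κ → ℤ) (u : Fin n → ℤ) (i : Fin n) :
    derivFactor e c u ∣ ((u i + 1 : ℤ) + expForm e i) * derivFactor e c (u + Pi.single i 1) := by
  have : (((u i + 1 : ℤ) : MvPolynomial κ ℂ) + expForm e i) =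
      ∏ i', if i' = i then (((u i' + 1 : ℤ) : MvPolynomial κ ℂ) + expForm e i') else 1 := by
    simp
  rw [this, derivFactor, derivFactor, ← Finset.prod_mul_distrib]
  refine Finset.prod_dvd_prod_of_dvd _ _ fun i' _ => ?_
  by_cases h : i' = i
  · subst h
    simp only [if_true, Pi.add_apply, Pi.single_eq_same]
    rcases le_or_gt (expSum e c i') (u i') with h | h
    · rw [show (expSum e c i' - u i').toNat = 0 by omega]
      simp
    · obtain ⟨m, hm⟩ : ∃ m : ℕ, expSum e c i' - (u i' + 1) = m :=
        ⟨_, (Int.toNat_of_nonneg (by omega)).symm⟩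
      rw [show (expSum e c i' - u i').toNat = m + 1 by omega, hm, Int.toNat_natCast, fallFac_succ]
      refine dvd_of_eq ?_
      have hm' : expSum e c i' = u i' + 1 + m := by omega
      rw [hm']
      push_cast
      ring
  · simp [h]

theorem mul_mem_of_mem_span {R : Type*} [CommRing R] {S : Set R} {J : Ideal R} (q : R)
    (φ : R →+* R) (h : ∀ p ∈ S, q * φ p ∈ J) {p : R} (hp : p ∈ Ideal.span S) : q * φ p ∈ J := by
  induction hp using Submodule.span_induction with
  | mem p hp => exact h p hp
  | zero => simp
  | add x y _ _ hx hy => rw [map_add, mul_add]; exact add_mem hx hy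
  | smul c x _ hx =>
    rw [smul_eq_mul, map_mul, mul_left_comm]
    exact J.mul_mem_left _ hx

theorem mem_stepIdeal_of_dvd {c : κ → ℤ} (hc : ∑ k, c k = 1) {u : Fin n → ℤ}
    {p : MvPolynomial κ ℂ} (h : negFactor c * derivFactor e c u ∣ p) : p ∈ stepIdeal e u :=
  Ideal.mem_of_dvd _ h (Ideal.subset_span ⟨c, hc, rfl⟩)

variable [DecidableEq κ]

theorem X_mul_shiftBy_negFactor (c : κ → ℤ) {j k : κ} :
    X j * shiftBy (Pi.single k 1 - Pi.single j 1) (negFactor c) =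
      ∏ l, (if l = j then X l else 1) * fallFac (X l + ((Pi.single k 1 - Pi.single j 1 : κ → ℤ) l :
        MvPolynomial κ ℂ)) (-c l).toNat := by
  rw [Finset.prod_mul_distrib, Finset.prod_ite_eq']
  simp only [Finset.mem_univ, if_true, negFactor, map_prod]
  congr 1
  refine Finset.prod_congr rfl fun l _ => ?_
  refine (map_fallFac (shiftBy (Pi.single k 1 - Pi.single j 1)).toRingHom _ _).trans ?_
  congr 1
  change shiftBy _ (X l) = _
  simp [shiftBy]

theorem negFactor_dvd (c : κ → ℤ) {j k : κ} (hjk : j ≠ k) :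
    negFactor (c + (Pi.single k 1 - Pi.single j 1)) ∣
      X j * shiftBy (Pi.single k 1 - Pi.single j 1) (negFactor c) := by
  rw [X_mul_shiftBy_negFactor]
  refine Finset.prod_dvd_prod_of_dvd _ _ fun l _ => ?_
  by_cases hj : l = j
  · subst hj
    simp only [Pi.add_apply, Pi.sub_apply, Pi.single_eq_same, Pi.single_eq_of_ne hjk, if_true]
    have h : (-(c l + (0 - 1))).toNat ≤ (-c l).toNat + 1 := by omega
    refine (fallFac_dvd _ h).trans ?_
    rw [fallFac_succ']
    simp [← sub_eq_add_neg]
  · by_cases hk : l = k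
    · subst hk
      simp only [Pi.add_apply, Pi.sub_apply, Pi.single_eq_same, Pi.single_eq_of_ne hj, hj, if_false,
        one_mul]
      rcases le_or_gt 0 (c l) with h | h
      · rw [show (-(c l + (1 - 0))).toNat = 0 by omega]
        simp
      · rw [show (-c l).toNat = (-(c l + (1 - 0))).toNat + 1 by omega, fallFac_succ']
        simp
    · simp [hj, hk]

theorem negFactor_eq (c : κ → ℤ) {j k : κ} (hjk : j ≠ k) (hj : c j ≤ 0) (hk : 0 ≤ c k) :
    negFactor (c + (Pi.single k 1 - Pi.single j 1)) =
      X j * shiftBy (Pi.single k 1 - Pi.single j 1) (negFactor c) := by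
  rw [X_mul_shiftBy_negFactor]
  refine Finset.prod_congr rfl fun l _ => ?_
  by_cases hlj : l = j
  · subst hlj
    simp only [Pi.add_apply, Pi.sub_apply, Pi.single_eq_same, Pi.single_eq_of_ne hjk, if_true]
    rw [show (-(c l + (0 - 1))).toNat = (-c l).toNat + 1 by omega, fallFac_succ']
    simp [← sub_eq_add_neg]
  · by_cases hlk : l = k
    · subst hlk
      simp only [Pi.add_apply, Pi.sub_apply, Pi.single_eq_same, Pi.single_eq_of_ne hlj, hlj,
        if_false, one_mul]
      rw [show (-(c l + (1 - 0))).toNat = 0 by omega, show (-c l).toNat = 0 by omega]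
      simp
    · simp [hlj, hlk]

theorem sum_single_sub_single (j k : κ) :
    ∑ l, (Pi.single k 1 - Pi.single j 1 : κ → ℤ) l = 0 := by
  simp [Finset.sum_sub_distrib, Finset.sum_pi_single']

/-- The component of degree `u` of the right hand side is contained in the ideal `stepIdeal e u`. -/
theorem opSpan_monAct_le : opSpan (monAct e) (Set.range fun k => Pi.single (expVec e k) 1) ≤
    { carrier := {G | ∀ u, G u ∈ stepIdeal e u}
      add_mem' := fun hG hG' u => add_mem (hG u) (hG' u)
      zero_mem' := fun u => zero_mem _
      smul_mem' := fun c G hG u => by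
        rw [Pi.smul_apply, smul_eq_C_mul]
        exact Ideal.mul_mem_left _ _ (hG u) } := by
  refine opSpan_le ?_ ?_
  · rintro _ ⟨k, rfl⟩ u
    by_cases h : u = expVec e k
    · subst h
      simp only [Pi.single_eq_same]
      refine mem_stepIdeal_of_dvd (c := Pi.single k 1) (by simp [Finset.sum_pi_single']) ?_
      have h1 : negFactor (Pi.single k 1 : κ → ℤ) = 1 := Finset.prod_eq_one fun l _ => by
        have : (-(Pi.single k 1 : κ → ℤ) l).toNat = 0 := by
          rw [Pi.single_apply]; split_ifs <;> simp
        rw [this, fallFac_zero]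
      rw [h1, derivFactor, expSum_single]
      simp
    · simp [Pi.single_eq_of_ne h]
  · intro γ G hG u
    cases γ with
    | x i =>
      have hle : stepIdeal e (u - Pi.single i 1) ≤ stepIdeal e u := by
        refine Ideal.span_le.2 ?_
        rintro _ ⟨c, hc, rfl⟩
        refine mem_stepIdeal_of_dvd hc (mul_dvd_mul_left _ (derivFactor_dvd_of_le c ?_))
        rw [sub_le_self_iff]
        exact Pi.single_nonneg.2 zero_le_one
      exact hle (hG _)
    | d i =>
      refine mul_mem_of_mem_span _ (RingHom.id _) ?_ (hG (u + Pi.single i 1))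
      rintro _ ⟨c, hc, rfl⟩
      refine mem_stepIdeal_of_dvd hc ?_
      rw [RingHom.id_apply, mul_left_comm]
      exact mul_dvd_mul_left _ (derivFactor_dvd_mul c u i)
    | s j k =>
      refine mul_mem_of_mem_span _ (shiftBy (Pi.single k 1 - Pi.single j 1)).toRingHom ?_
        (hG (u + expVec e j - expVec e k))
      rintro _ ⟨c, hc, rfl⟩
      change X j * shiftBy _ (negFactor c * _) ∈ _
      rw [map_mul, shiftBy_derivFactor, expSum_sub, expSum_single, expSum_single, ← mul_assoc]
      rw [show u + expVec e j - expVec e k + (expVec e k - expVec e j) = u by abel]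
      by_cases hjk : j = k
      · subst hjk
        refine mem_stepIdeal_of_dvd hc ?_
        rw [sub_self, add_zero, shiftBy_zero]
        exact mul_dvd_mul_right (dvd_mul_left _ _) _
      · refine mem_stepIdeal_of_dvd (c := c + (Pi.single k 1 - Pi.single j 1)) ?_
          (mul_dvd_mul_right (negFactor_dvd c hjk) _)
        simp only [Pi.add_apply, Finset.sum_add_distrib, sum_single_sub_single, hc, add_zero]

theorem monAct_x_single (i : Fin n) (u : Fin n → ℤ) (p : MvPolynomial κ ℂ) :
    monAct e (.x i) (Pi.single u p) = Pi.single (u + Pi.single i 1) p := by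
  funext v
  rw [monAct_x]
  simp only [Pi.single_apply, sub_eq_iff_eq_add]

theorem monAct_d_single (i : Fin n) (u : Fin n → ℤ) (p : MvPolynomial κ ℂ) :
    monAct e (.d i) (Pi.single u p) =
      Pi.single (u - Pi.single i 1) (((u i : ℤ) + expForm e i) * p) := by
  funext v
  rw [monAct_d]
  simp only [Pi.single_apply u, Pi.single_apply (u - _), ← eq_sub_iff_add_eq]
  split_ifs with h
  · subst h; simp
  · simp

theorem monAct_s_single (j k : κ) (u : Fin n → ℤ) (p : MvPolynomial κ ℂ) :
    monAct e (.s j k) (Pi.single u p) = Pi.single (u - expVec e j + expVec e k)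
      (X j * shiftBy (Pi.single k 1 - Pi.single j 1) p) := by
  funext v
  rw [monAct_s]
  by_cases h : v = u - expVec e j + expVec e k
  · subst h
    rw [Pi.single_eq_same, show u - expVec e j + expVec e k + expVec e j - expVec e k = u by abel,
      Pi.single_eq_same]
  · rw [Pi.single_eq_of_ne h, Pi.single_eq_of_ne, map_zero, mul_zero]
    rintro rfl
    exact h (by abel)

/-- The right hand side of the functional equation for the monomials `x^{eₖ}`. -/
def monSpan (e : κ → Fin n →₀ ℕ) : Submodule ℂ ((Fin n → ℤ) → MvPolynomial κ ℂ) :=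
  opSpan (monAct e) (Set.range fun k => Pi.single (expVec e k) 1)

theorem monAct_mem_monSpan (γ : Gen n κ) {v : (Fin n → ℤ) → MvPolynomial κ ℂ}
    (hv : v ∈ monSpan e) : monAct e γ v ∈ monSpan e :=
  apply_mem_opSpan γ hv

/-- A product of the `tₖ^{cₖ}` of total degree `1` can be formed out of one `tₖ` and operators
`s_{j,k}`, at the expense of the factor `negFactor c`. -/
theorem single_negFactor_mem (c : κ → ℤ) (hc : ∑ k, c k = 1) :
    Pi.single (expSum e c) (negFactor c) ∈ monSpan e := by
  induction hN : ∑ k, (-c k).toNat using Nat.strong_induction_on generalizing c with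
  | _ N ih =>
    by_cases hneg : ∃ j, c j < 0
    · obtain ⟨j, hj⟩ := hneg
      obtain ⟨k, hk⟩ : ∃ k, 0 < c k := by
        by_contra! h
        have := Finset.sum_nonpos fun k (_ : k ∈ Finset.univ) => h k
        omega
      have hjk : j ≠ k := by rintro rfl; omega
      set c' := c - (Pi.single k 1 - Pi.single j 1) with hc'
      have hcc : c = c' + (Pi.single k 1 - Pi.single j 1) := by rw [hc', sub_add_cancel]
      have hj' : c' j = c j + 1 := by simp [hc', hjk]
      have hk' : c' k = c k - 1 := by simp [hc', Ne.symm hjk]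
      have hsum : ∑ k, c' k = 1 := by
        rw [hc']
        simp only [Pi.sub_apply c, Finset.sum_sub_distrib, sum_single_sub_single, hc, sub_zero]
      have hlt : ∑ k, (-c' k).toNat < N := by
        rw [← hN]
        refine Finset.sum_lt_sum (fun l _ => ?_) ⟨j, Finset.mem_univ _, by omega⟩
        by_cases hlj : l = j
        · subst hlj; omega
        · by_cases hlk : l = k
          · subst hlk; omega
          · simp [hc', hlj, hlk]
      have h := monAct_mem_monSpan (.s j k) (ih _ hlt c' hsum rfl)
      rw [monAct_s_single, ← negFactor_eq c' hjk (by omega) (by omega), ← hcc] at h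
      have hv : expSum e c = expSum e c' - expVec e j + expVec e k := by
        rw [hc', expSum_sub, expSum_sub, expSum_single, expSum_single]
        abel
      rwa [hv]
    · push Not at hneg
      obtain ⟨k, hk⟩ : ∃ k, 0 < c k := by
        by_contra! h
        have := Finset.sum_nonpos fun k (_ : k ∈ Finset.univ) => h k
        omega
      have h1 : ∑ l ∈ Finset.univ.erase k, c l = 1 - c k := by
        rw [← hc, ← Finset.add_sum_erase _ _ (Finset.mem_univ k)]; ring
      have h2 : ∑ l ∈ Finset.univ.erase k, c l = 0 :=
        le_antisymm (by omega) (Finset.sum_nonneg fun l _ => hneg l)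
      have hck : c = Pi.single k 1 := by
        funext l
        by_cases hl : l = k
        · subst hl; simp; omega
        · rw [Pi.single_eq_of_ne hl]
          exact (Finset.sum_eq_zero_iff_of_nonneg fun l _ => hneg l).1 h2 l (by simp [hl])
      have h3 : negFactor c = 1 := Finset.prod_eq_one fun l _ => by
        have := hneg l
        rw [show (-c l).toNat = 0 by omega, fallFac_zero]
      rw [h3, hck, expSum_single]
      exact subset_opSpan _ _ ⟨k, rfl⟩

theorem single_add_mem {u : Fin n → ℤ} {p : MvPolynomial κ ℂ} (h : Pi.single u p ∈ monSpan e)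
    (i : Fin n) (m : ℕ) : Pi.single (u + Pi.single i (m : ℤ)) p ∈ monSpan e := by
  induction m with
  | zero => simpa using h
  | succ m ih =>
    have := monAct_mem_monSpan (.x i) ih
    rw [monAct_x_single, add_assoc, ← Pi.single_add] at this
    exact_mod_cast this

theorem single_sub_mem {u : Fin n → ℤ} {p : MvPolynomial κ ℂ} (h : Pi.single u p ∈ monSpan e)
    (i : Fin n) (m : ℕ) : Pi.single (u - Pi.single i (m : ℤ))
      (p * fallFac (expForm e i + (u i : MvPolynomial κ ℂ)) m) ∈ monSpan e := by
  induction m with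
  | zero => simpa using h
  | succ m ih =>
    have := monAct_mem_monSpan (.d i) ih
    rw [monAct_d_single, sub_sub, ← Pi.single_add] at this
    convert this using 2
    · simp
    rw [fallFac_succ]
    simp
    ring

theorem single_step_mem {u : Fin n → ℤ} {p : MvPolynomial κ ℂ} (h : Pi.single u p ∈ monSpan e)
    (i : Fin n) : Pi.single (Function.update u i 0)
      (p * fallFac (expForm e i + (u i : MvPolynomial κ ℂ)) (u i).toNat) ∈ monSpan e := by
  rcases le_total 0 (u i) with h0 | h0
  · obtain ⟨m, hm⟩ := Int.eq_ofNat_of_zero_le h0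
    have := single_sub_mem h i m
    rw [← hm] at this
    convert this using 2
    · ext j
      by_cases hj : j = i
      · subst hj; simp
      · simp [hj]
    · rw [hm, Int.toNat_natCast]
  · obtain ⟨m, hm⟩ := Int.eq_ofNat_of_zero_le (neg_nonneg.2 h0)
    have := single_add_mem h i m
    rw [← hm] at this
    convert this using 2
    · ext j
      by_cases hj : j = i
      · subst hj; simp
      · simp [hj]
    · rw [show (u i).toNat = 0 by omega, fallFac_zero, mul_one]

/-- The degree in `x` is brought to `0` by multiplication with the variables `xᵢ` and by
differentiation. -/
theorem single_zero_mem {u : Fin n → ℤ} {p : MvPolynomial κ ℂ} (h : Pi.single u p ∈ monSpan e) :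
    Pi.single 0 (p * ∏ i, fallFac (expForm e i + (u i : MvPolynomial κ ℂ)) (u i).toNat) ∈
      monSpan e := by
  have key : ∀ S : Finset (Fin n), Pi.single (fun i => if i ∈ S then 0 else u i)
      (p * ∏ i ∈ S, fallFac (expForm e i + (u i : MvPolynomial κ ℂ)) (u i).toNat) ∈
        monSpan e := by
    intro S
    induction S using Finset.induction_on with
    | empty => simpa using h
    | insert i S hi ih =>
      have := single_step_mem ih i
      rw [if_neg hi] at this
      rw [Finset.prod_insert hi]
      convert this using 2
      · ext j
        by_cases hj : j = i
        · subst hj; simp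
        · simp [hj]
      · ring
  simpa [← Pi.zero_def] using key Finset.univ

theorem single_mul_mem {u : Fin n → ℤ} {p : MvPolynomial κ ℂ} (h : Pi.single u p ∈ monSpan e)
    (q : MvPolynomial κ ℂ) : Pi.single u (q * p) ∈ monSpan e := by
  induction q using MvPolynomial.induction_on with
  | C c =>
    rw [← smul_eq_C_mul, Pi.single_smul]
    exact Submodule.smul_mem _ _ h
  | add q q' hq hq' =>
    rw [add_mul, Pi.single_add]
    exact add_mem hq hq'
  | mul_X q j hq =>
    have := monAct_mem_monSpan (.s j j) hq
    rw [monAct_s_single, sub_self, shiftBy_zero, sub_add_cancel] at this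
    convert this using 2
    ring

theorem single_zero_mem_iff (p : MvPolynomial κ ℂ) :
    Pi.single 0 p ∈ monSpan e ↔ p ∈ stepIdeal e 0 := by
  constructor
  · intro h
    have := opSpan_monAct_le h 0
    rwa [Pi.single_eq_same] at this
  · intro h
    induction h using Submodule.span_induction with
    | mem p hp =>
      obtain ⟨c, hc, rfl⟩ := hp
      have := single_zero_mem (single_negFactor_mem (e := e) c hc)
      simpa only [derivFactor, Pi.zero_apply, sub_zero] using this
    | zero => simp
    | add x y _ _ hx hy => rw [Pi.single_add]; exact add_mem hx hy
    | smul c x _ hx => exact single_mul_mem hx c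

/-- The functional equation for monomials is a membership in an ideal of `ℂ[s]`. -/
theorem graphFunEq_monomial_iff_mem (b : Polynomial ℂ) :
    GraphFunEq (fun k => monomial (e k) 1) b ↔
      Polynomial.aeval (∑ k, X k : MvPolynomial κ ℂ) b ∈ stepIdeal e 0 := by
  rw [graphFunEq_monomial_iff, BFunEq, ← single_zero_mem_iff]
  have h := aeval_comm_of_comm
    (LinearMap.single ℂ (fun _ : Fin n → ℤ => MvPolynomial κ ℂ) 0)
    (A := LinearMap.mulLeft ℂ (∑ k, X k : MvPolynomial κ ℂ))
    (A' := ∑ k, monAct e (.s k k)) (fun v => by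
      simp only [LinearMap.mulLeft_apply, LinearMap.coe_single, LinearMap.sum_apply,
        monAct_s_single, sub_self, shiftBy_zero, sub_add_cancel, Finset.sum_mul]
      exact map_sum (LinearMap.single ℂ (fun _ : Fin n → ℤ => MvPolynomial κ ℂ) 0) _ _) b 1
  have h2 : Polynomial.aeval (LinearMap.mulLeft ℂ (∑ k, X k : MvPolynomial κ ℂ)) b =
      LinearMap.mulLeft ℂ (Polynomial.aeval (∑ k, X k : MvPolynomial κ ℂ) b) :=
    Polynomial.aeval_algHom_apply (Algebra.lmul ℂ (MvPolynomial κ ℂ)) (∑ k, X k) b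
  rw [h2, LinearMap.mulLeft_apply, mul_one] at h
  simp only [LinearMap.coe_single] at h
  rw [← h]
  rfl

end MonomialIdeal

/-! ### Linear inequalities -/

/-- Farkas' lemma: a linear functional which is nonpositive wherever the functionals `A i` are
nonpositive is a combination of the `A i` with nonnegative coefficients. -/
theorem farkas {V ι : Type*} [AddCommGroup V] [Module ℚ V] (S : Finset ι)
    (A : ι → V →ₗ[ℚ] ℚ) (g : V →ₗ[ℚ] ℚ) (h : ∀ v, (∀ i ∈ S, A i v ≤ 0) → g v ≤ 0) :
    ∃ c : ι → ℚ, (∀ i, 0 ≤ c i) ∧ g = ∑ i ∈ S, c i • A i := by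
  classical
  induction S using Finset.induction_on generalizing A g with
  | empty =>
    refine ⟨0, fun _ => le_rfl, LinearMap.ext fun v => ?_⟩
    have h1 := h v (by simp)
    have h2 := h (-v) (by simp)
    rw [map_neg] at h2
    simp
    linarith
  | insert a S ha ih =>
    by_cases h0 : ∀ v, (∀ i ∈ S, A i v ≤ 0) → g v ≤ 0
    · obtain ⟨c, hc, hg⟩ := ih A g h0
      refine ⟨fun i => if i ∈ S then c i else 0, fun i => ?_, ?_⟩
      · dsimp only
        split_ifs
        exacts [hc i, le_rfl]
      · rw [Finset.sum_insert ha]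
        dsimp only
        rw [if_neg ha, zero_smul, zero_add, hg]
        exact Finset.sum_congr rfl fun i hi => by rw [if_pos hi]
    · -- `A a` is positive at `v₀`, so that one can project along `v₀` to the kernel of `A a`.
      push Not at h0
      obtain ⟨v₀, hv₀, hg₀⟩ := h0
      have hpos : 0 < A a v₀ := by
        by_contra hle
        refine hg₀.not_ge (h v₀ fun i hi => ?_)
        rcases Finset.mem_insert.1 hi with rfl | hi
        exacts [not_lt.1 hle, hv₀ i hi]
      obtain ⟨c, hc, hg⟩ := ih (fun i => A i - (A i v₀ / A a v₀) • A a)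
        (g - (g v₀ / A a v₀) • A a) (by
          intro v hv
          have := h (v - (A a v / A a v₀) • v₀) (by
            intro i hi
            rcases Finset.mem_insert.1 hi with rfl | hi
            · simp [hpos.ne']
            · have := hv i hi
              simp only [LinearMap.sub_apply, LinearMap.smul_apply, smul_eq_mul, map_sub,
                map_smul] at this ⊢
              convert this using 2
              ring)
          simp only [LinearMap.sub_apply, LinearMap.smul_apply, smul_eq_mul, map_sub,
            map_smul] at this ⊢
          convert this using 2
          ring)
      refine ⟨fun i => if i = a then g v₀ / A a v₀ - ∑ i ∈ S, c i * (A i v₀ / A a v₀) else c i,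
        fun i => ?_, ?_⟩
      · dsimp only
        split_ifs
        · refine sub_nonneg.2 ((Finset.sum_nonpos fun i hi => ?_).trans (div_pos hg₀ hpos).le)
          exact mul_nonpos_of_nonneg_of_nonpos (hc i)
            (div_nonpos_of_nonpos_of_nonneg (hv₀ i hi) hpos.le)
        · exact hc i
      · rw [Finset.sum_insert ha]
        dsimp only
        have h1 : ∑ i ∈ S, (if i = a then g v₀ / A a v₀ - ∑ i ∈ S, c i * (A i v₀ / A a v₀)
            else c i) • A i = ∑ i ∈ S, c i • A i :=
          Finset.sum_congr rfl fun i hi => by rw [if_neg (ne_of_mem_of_not_mem hi ha)]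
        rw [h1, if_pos rfl]
        conv_lhs => rw [← sub_add_cancel g ((g v₀ / A a v₀) • A a), hg]
        simp only [smul_sub, Finset.sum_sub_distrib, sub_smul, smul_smul, ← Finset.sum_smul]
        abel

/-- A polyhedron which contains no line has a vertex on the smallest face containing a given
point. -/
theorem exists_vertex {V C : Type*} [AddCommGroup V] [Module ℝ V] [Fintype C]
    (σ : C → V →ₗ[ℝ] ℝ) (b : C → ℝ) (hσ : ∀ d, (∀ c, σ c d = 0) → d = 0) (x₀ : V)
    (hx₀ : ∀ c, b c ≤ σ c x₀) :
    ∃ x, (∀ c, b c ≤ σ c x) ∧ (∀ c, σ c x₀ = b c → σ c x = b c) ∧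
      ∀ d, (∀ c, σ c x = b c → σ c d = 0) → d = 0 := by
  classical
  induction hN : (Finset.univ.filter fun c => σ c x₀ ≠ b c).card using Nat.strong_induction_on
    generalizing x₀ with
  | _ N ih =>
    by_cases hd : ∀ d, (∀ c, σ c x₀ = b c → σ c d = 0) → d = 0
    · exact ⟨x₀, hx₀, fun _ h => h, hd⟩
    · have : ∃ d, (∀ c, σ c x₀ = b c → σ c d = 0) ∧ ∃ c, σ c d < 0 := by
        push Not at hd
        obtain ⟨d, hd, hd0⟩ := hd
        have : ∃ c, σ c d ≠ 0 := by
          by_contra! h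
          exact hd0 (hσ d h)
        obtain ⟨c, hc⟩ := this
        rcases lt_or_gt_of_ne hc with hc | hc
        · exact ⟨d, hd, c, hc⟩
        · exact ⟨-d, fun c h => by simp [hd c h], c, by simpa using hc⟩
      obtain ⟨d, hd, c₀, hc₀⟩ := this
      -- move along `d` until the first inequality becomes an equality
      obtain ⟨c₁, hc₁, hmin⟩ := Finset.exists_min_image
        (Finset.univ.filter fun c => σ c d < 0) (fun c => (σ c x₀ - b c) / (-σ c d))
        ⟨c₀, by simpa using hc₀⟩
      simp only [Finset.mem_filter, Finset.mem_univ, true_and] at hc₁ hmin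
      set t := (σ c₁ x₀ - b c₁) / (-σ c₁ d) with ht
      have ht0 : 0 ≤ t := div_nonneg (sub_nonneg.2 (hx₀ _)) (by linarith)
      have hx₁ : ∀ c, b c ≤ σ c (x₀ + t • d) := by
        intro c
        rw [map_add, map_smul, smul_eq_mul]
        rcases lt_or_ge (σ c d) 0 with h | h
        · have := hmin c h
          rw [le_div_iff₀ (by linarith)] at this
          linarith
        · have := mul_nonneg ht0 h
          linarith [hx₀ c]
      have htight : ∀ c, σ c x₀ = b c → σ c (x₀ + t • d) = b c := by
        intro c hc
        rw [map_add, map_smul, hd c hc, hc]; simp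
      have hnew : σ c₁ (x₀ + t • d) = b c₁ := by
        rw [map_add, map_smul, smul_eq_mul, ht]
        have : σ c₁ d ≠ 0 := hc₁.ne
        field_simp
        ring
      have hlt : (Finset.univ.filter fun c => σ c (x₀ + t • d) ≠ b c).card < N := by
        rw [← hN]
        refine Finset.card_lt_card (Finset.ssubset_iff_of_subset ?_ |>.2 ⟨c₁, ?_, ?_⟩)
        · intro c
          simp only [Finset.mem_filter, Finset.mem_univ, true_and]
          exact fun h h' => h (htight c h')
        · simp only [Finset.mem_filter, Finset.mem_univ, true_and]
          exact fun h => hc₁.ne (hd _ h)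
        · simpa using hnew
      obtain ⟨x, h1, h2, h3⟩ := ih _ hlt _ hx₁ rfl
      exact ⟨x, h1, fun c hc => h2 c (htight c hc), h3⟩

/-! ### Vertices of the dual polyhedron -/

section Vertex

variable {n : ℕ} {κ : Type*} (e : κ → Fin n →₀ ℕ)

/-- The exponent vector `eₖ` in `ℝⁿ`. -/
def expReal (k : κ) (i : Fin n) : ℝ := e k i

/-- The pairing `∑ᵢ βᵢ xᵢ` with a vector `β`, as a linear form. -/
def pairing (β : Fin n → ℝ) : (Fin n → ℝ) →ₗ[ℝ] ℝ := Fintype.linearCombination ℝ β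

theorem pairing_apply (β x : Fin n → ℝ) : pairing β x = ∑ i, x i * β i := rfl

/-- The vertices `β` of the polyhedron `{β ≥ 0, β · eₖ ≥ 1 for all k}`: the inequalities which
are equalities at `β` determine `β`. -/
structure IsDualVertex (β : Fin n → ℝ) : Prop where
  nonneg : ∀ i, 0 ≤ β i
  one_le : ∀ k, 1 ≤ pairing β (expReal e k)
  span_eq_top : Submodule.span ℝ ({v | ∃ k, pairing β (expReal e k) = 1 ∧ v = expReal e k} ∪
    {v | ∃ i, β i = 0 ∧ v = Pi.single i 1}) = ⊤

variable {e}

theorem pairing_single (β : Fin n → ℝ) (i : Fin n) : pairing β (Pi.single i 1) = β i := by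
  simp [pairing_apply, Pi.single_apply]

theorem pairing_eta (L : (Fin n → ℝ) →ₗ[ℝ] ℝ) : pairing (fun i => L (Pi.single i 1)) = L :=
  LinearMap.pi_ext' fun i => LinearMap.ext_ring (by simp [pairing_single])

theorem IsDualVertex.ext_linear {β : Fin n → ℝ} (hβ : IsDualVertex e β)
    {W : Type*} [AddCommGroup W] [Module ℝ W]
    {L L' : (Fin n → ℝ) →ₗ[ℝ] W} (h1 : ∀ k, pairing β (expReal e k) = 1 →
      L (expReal e k) = L' (expReal e k))
    (h2 : ∀ i, β i = 0 → L (Pi.single i 1) = L' (Pi.single i 1)) : L = L' := by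
  refine LinearMap.ext_on hβ.span_eq_top ?_
  rintro _ (⟨k, hk, rfl⟩ | ⟨i, hi, rfl⟩)
  exacts [h1 k hk, h2 i hi]

theorem exists_isDualVertex [Fintype κ] (β₀ : Fin n → ℝ) (h0 : ∀ i, 0 ≤ β₀ i)
    (h1 : ∀ k, 1 ≤ pairing β₀ (expReal e k)) :
    ∃ β, IsDualVertex e β ∧ (∀ i, β₀ i = 0 → β i = 0) ∧
      ∀ k, pairing β₀ (expReal e k) = 1 → pairing β (expReal e k) = 1 := by
  have hcomm : ∀ β x : Fin n → ℝ, pairing x β = pairing β x := fun β x => by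
    simp [pairing_apply, mul_comm]
  obtain ⟨β, hb, ht, hu⟩ := exists_vertex (C := κ ⊕ Fin n) (V := Fin n → ℝ)
    (Sum.elim (fun k => pairing (expReal e k)) fun i => LinearMap.proj i)
    (Sum.elim (fun _ => 1) fun _ => 0)
    (fun d hd => funext fun i => by simpa using hd (Sum.inr i)) β₀ (by
      rintro (k | i)
      · simpa [hcomm β₀] using h1 k
      · simpa using h0 i)
  refine ⟨β, ⟨fun i => by simpa using hb (Sum.inr i), fun k => by
    simpa [hcomm β] using hb (Sum.inl k), ?_⟩, fun i hi => by simpa using ht (Sum.inr i) hi,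
    fun k hk => by
      rw [← hcomm] at hk ⊢
      exact ht (Sum.inl k) hk⟩
  by_contra hne
  obtain ⟨L, hL0, hL⟩ := Submodule.exists_le_ker_of_lt_top _ (lt_top_iff_ne_top.2 hne)
  refine hL0 ?_
  rw [← pairing_eta L]
  have : (fun i => L (Pi.single i 1)) = 0 := hu _ (by
    rintro (k | i) hc
    · simp only [Sum.elim_inl] at hc ⊢
      rw [← hcomm, pairing_eta]
      exact hL (Submodule.subset_span (Or.inl ⟨k, by rw [← hcomm]; exact hc, rfl⟩))
    · simp only [Sum.elim_inr, LinearMap.proj_apply] at hc ⊢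
      exact hL (Submodule.subset_span (Or.inr ⟨i, hc, rfl⟩)))
  rw [this]
  exact LinearMap.ext fun x => by simp [pairing_apply]

/-- A vertex is the unique solution of a system of linear equations over `ℚ`. -/
theorem IsDualVertex.exists_rat {β : Fin n → ℝ} (hβ : IsDualVertex e β) :
    ∃ q : Fin n → ℚ, ∀ i, β i = q i := by
  -- a `ℚ`-linear retraction of `ℝ` onto `ℚ` maps the solution `β` to a solution over `ℚ`
  obtain ⟨π, hπ⟩ := (Algebra.linearMap ℚ ℝ).exists_leftInverse_of_injective
    (LinearMap.ker_eq_bot.2 (algebraMap ℚ ℝ).injective)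
  have hπ1 : ∀ q : ℚ, π (q : ℝ) = q := fun q => DFunLike.congr_fun hπ q
  refine ⟨fun i => π (β i), fun i => ?_⟩
  have := hβ.ext_linear (L := pairing β) (L' := pairing fun i => (π (β i) : ℝ)) ?_ ?_
  · simpa [pairing_single] using DFunLike.congr_fun this (Pi.single i 1)
  · intro k hk
    rw [hk]
    have h2 : π (pairing β (expReal e k)) = ∑ i, (e k i : ℚ) * π (β i) := by
      rw [pairing_apply, map_sum]
      refine Finset.sum_congr rfl fun i _ => ?_
      have := π.map_smul (e k i : ℚ) (β i)
      simpa [expReal, Rat.smul_def] using this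
    rw [hk] at h2
    have h3 : π (1 : ℝ) = 1 := by simpa using hπ1 1
    rw [h3] at h2
    have h4 := congrArg (Rat.cast : ℚ → ℝ) h2
    simpa [pairing_apply, expReal] using h4
  · intro i hi
    simp [pairing_single, hi]

/-- The positive integers `m` for which `m β` is integral. -/
def denomSet (β : Fin n → ℝ) : Set ℕ := {m | 0 < m ∧ ∀ i, ∃ z : ℤ, (m : ℝ) * β i = z}

theorem IsDualVertex.denomSet_nonempty {β : Fin n → ℝ} (hβ : IsDualVertex e β) :
    (denomSet β).Nonempty := by
  obtain ⟨q, hq⟩ := hβ.exists_rat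
  refine ⟨∏ i, (q i).den, Finset.prod_pos fun i _ => (q i).pos, fun i => ?_⟩
  refine ⟨(∏ j ∈ Finset.univ.erase i, (q j).den : ℕ) * (q i).num, ?_⟩
  rw [← Finset.mul_prod_erase _ _ (Finset.mem_univ i), hq]
  have : ((q i : ℚ) : ℝ) * ((q i).den : ℝ) = (q i).num := by exact_mod_cast Rat.mul_den_eq_num (q i)
  push_cast
  linear_combination (∏ j ∈ Finset.univ.erase i, ((q j).den : ℝ)) * this

/-- The subgroup of `ℚ/ℤ` generated by the coordinates of `β` is generated by `1/m`, where `m` is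
the least common denominator. -/
theorem exists_sum_eq_inv {β : Fin n → ℝ} (h : (denomSet β).Nonempty) :
    ∃ (y : Fin n → ℤ) (w : ℤ), ∑ i, (y i : ℝ) * β i + w = 1 / (sInf (denomSet β) : ℕ) := by
  set m := sInf (denomSet β) with hm
  obtain ⟨hpos, hint⟩ : m ∈ denomSet β := Nat.sInf_mem h
  have hm0 : (m : ℝ) ≠ 0 := by exact_mod_cast hpos.ne'
  let H : AddSubgroup ℤ :=
    { carrier := {z | ∃ (y : Fin n → ℤ) (w : ℤ), (z : ℝ) = m * (∑ i, (y i : ℝ) * β i + w)}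
      zero_mem' := ⟨0, 0, by simp⟩
      add_mem' := by
        rintro a b ⟨y, w, h⟩ ⟨y', w', h'⟩
        refine ⟨y + y', w + w', ?_⟩
        push_cast [Pi.add_apply]
        rw [h, h']
        simp only [add_mul, Finset.sum_add_distrib]
        ring
      neg_mem' := by
        rintro a ⟨y, w, h⟩
        refine ⟨-y, -w, ?_⟩
        push_cast [Pi.neg_apply]
        rw [h]
        simp only [neg_mul, Finset.sum_neg_distrib]
        ring }
  obtain ⟨d, hd⟩ := Int.subgroup_cyclic H
  have hmem : ∀ z, z ∈ H ↔ d ∣ z := fun z => by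
    rw [hd, ← AddSubgroup.zmultiples_eq_closure, Int.mem_zmultiples_iff]
  have hdm : d ∣ m := (hmem m).1 ⟨0, 1, by simp⟩
  obtain ⟨k, hk⟩ := Int.natAbs_dvd_natAbs.2 hdm
  rw [Int.natAbs_natCast] at hk
  have hk0 : 0 < k := Nat.pos_of_ne_zero (by rintro rfl; simp at hk; omega)
  have hd0 : (d.natAbs : ℝ) ≠ 0 := by
    have : d.natAbs ≠ 0 := by rintro h; rw [h] at hk; simp at hk; omega
    exact_mod_cast this
  have hkmem : k ∈ denomSet β := by
    refine ⟨hk0, fun i => ?_⟩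
    obtain ⟨z, hz⟩ := hint i
    obtain ⟨q, hq⟩ : (d.natAbs : ℤ) ∣ z := by
      rw [Int.natAbs_dvd]
      exact (hmem z).1 ⟨Pi.single i 1, 0, by simp [Pi.single_apply, ← hz]⟩
    refine ⟨q, ?_⟩
    have h1 : (m : ℝ) = d.natAbs * k := by exact_mod_cast hk
    have h2 : (z : ℝ) = d.natAbs * q := by rw [hq, Int.cast_mul, Int.cast_natCast]
    rw [h1, h2, mul_assoc] at hz
    exact mul_left_cancel₀ hd0 hz
  have hle : m ≤ k := Nat.sInf_le hkmem
  have hd1 : d.natAbs = 1 := by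
    have : d.natAbs ≠ 0 := by exact_mod_cast hd0
    by_contra hne
    have : 2 * k ≤ d.natAbs * k := Nat.mul_le_mul_right k (by omega)
    omega
  obtain ⟨y, w, hyw⟩ := (hmem 1).2 (Int.natAbs_dvd.1 (by rw [hd1]; exact one_dvd _))
  refine ⟨y, w, ?_⟩
  rw [eq_div_iff hm0, mul_comm, ← hyw]
  simp

end Vertex

/-! ### The zero set of the ideal -/

section ZeroSet

variable {n : ℕ} {κ : Type*} [Fintype κ] (e : κ → Fin n →₀ ℕ)

/-- The value `ℓᵢ(s) = ∑ₖ sₖ e_{k,i}`. -/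
def expEval (s : κ → ℂ) (i : Fin n) : ℂ := ∑ k, s k * e k i

/-- The condition that the generator of the ideal for the vector `c` vanishes at `s`. -/
def GenVanishes (s : κ → ℂ) (c : κ → ℤ) : Prop :=
  (∃ k, ∃ j < (-c k).toNat, s k = (j : ℕ)) ∨
    ∃ i, ∃ j < (expSum e c i).toNat, expEval e s i + expSum e c i = (j : ℕ)

/-- The zero set of `stepIdeal e 0`. -/
def zeroSet : Set (κ → ℂ) := {s | ∀ c : κ → ℤ, ∑ k, c k = 1 → GenVanishes e s c}

variable {e}

theorem fallFac_eq_zero_iff (z : ℂ) (m : ℕ) : fallFac z m = 0 ↔ ∃ j < m, z = (j : ℕ) := by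
  simp [fallFac, Finset.prod_eq_zero_iff, sub_eq_zero]

theorem eval_expForm (s : κ → ℂ) (i : Fin n) : eval s (expForm e i) = expEval e s i := by
  simp [expForm, expEval, mul_comm]

theorem eval_gen_eq_zero_iff (s : κ → ℂ) (c : κ → ℤ) :
    eval s (negFactor c * derivFactor e c 0) = 0 ↔ GenVanishes e s c := by
  have h1 : ∀ k, eval s (fallFac (X k) (-c k).toNat) = fallFac (s k) (-c k).toNat := fun k => by
    rw [map_fallFac, eval_X]
  have h2 : ∀ i, eval s (fallFac (expForm e i + (expSum e c i : MvPolynomial κ ℂ))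
      (expSum e c i).toNat) = fallFac (expEval e s i + expSum e c i) (expSum e c i).toNat :=
    fun i => by rw [map_fallFac, map_add, eval_expForm, map_intCast]
  rw [map_mul, mul_eq_zero, negFactor, derivFactor, map_prod, map_prod, Finset.prod_eq_zero_iff,
    Finset.prod_eq_zero_iff]
  simp only [Pi.zero_apply, sub_zero, h1, h2, fallFac_eq_zero_iff, Finset.mem_univ, true_and,
    GenVanishes]

theorem mem_zeroLocus_stepIdeal (s : κ → ℂ) :
    s ∈ zeroLocus ℂ (stepIdeal e 0) ↔ s ∈ zeroSet e := by
  rw [stepIdeal, zeroLocus_span]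
  simp only [Set.mem_ofPred_eq, zeroSet, ← eval_gen_eq_zero_iff]
  constructor
  · intro h c hc
    exact h _ ⟨c, hc, rfl⟩
  · rintro h _ ⟨c, hc, rfl⟩
    exact h c hc

/-- At a point `s` of the zero set, an integral direction `v` along which no natural number `sₖ` can
decrease and no negative integer `ℓᵢ(s)` can increase has a nonpositive sum. -/
theorem nonpos_of_mem_zeroSet [Nonempty κ] {s : κ → ℂ} (hs : s ∈ zeroSet e) (v : κ → ℤ)
    (h1 : ∀ k, (∃ j : ℕ, s k = j) → 0 ≤ v k)
    (h2 : ∀ i, (∃ j : ℕ, expEval e s i = -(j + 1)) → expSum e v i ≤ 0) : ∑ k, v k ≤ 0 := by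
  classical
  -- some `sₖ` is not a natural number: otherwise no `ℓᵢ(s)` could be a negative integer
  obtain ⟨k₀, hk₀⟩ : ∃ k, ¬∃ j : ℕ, s k = j := by
    by_contra! hall
    choose m hm using hall
    obtain ⟨k⟩ := ‹Nonempty κ›
    rcases hs (Pi.single k 1) (by simp [Finset.sum_pi_single']) with ⟨l, j, hj, -⟩ | ⟨i, j, hj, h⟩
    · have : (0 : ℤ) ≤ (Pi.single k 1 : κ → ℤ) l := by
        rw [Pi.single_apply]; split_ifs <;> simp
      omega
    · have he : expEval e s i = ((∑ k, m k * e k i : ℕ) : ℂ) := by simp [expEval, hm]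
      rw [he] at h
      have h' : ((∑ k, m k * e k i : ℕ) : ℤ) + expSum e (Pi.single k 1) i = j := by
        exact_mod_cast h
      omega
  by_contra! hpos
  -- `c` is `v`, lowered at `k₀` in order to have sum `1`
  set c : κ → ℤ := v - Pi.single k₀ (∑ k, v k - 1) with hc
  have hsum : ∑ k, c k = 1 := by
    simp [hc, Finset.sum_sub_distrib, Finset.sum_pi_single']
  have hcv : ∀ k, c k ≤ v k := by
    intro k
    simp only [hc, Pi.sub_apply, Pi.single_apply]
    split_ifs <;> omega
  have hne : ∀ k, k ≠ k₀ → c k = v k := fun k hk => by simp [hc, hk]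
  rcases hs c hsum with ⟨k, j, hj, h⟩ | ⟨i, j, hj, h⟩
  · have hk : k ≠ k₀ := by rintro rfl; exact hk₀ ⟨j, h⟩
    have := h1 k ⟨j, h⟩
    rw [hne k hk] at hj
    omega
  · have hle : expSum e c i ≤ expSum e v i :=
      Finset.sum_le_sum fun k _ => mul_le_mul_of_nonneg_right (hcv k) (by positivity)
    have hi : expSum e v i ≤ 0 := by
      refine h2 i ⟨(expSum e c i - j - 1).toNat, ?_⟩
      have : ((expSum e c i - j - 1).toNat : ℤ) = expSum e c i - j - 1 :=
        Int.toNat_of_nonneg (by omega)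
      have h3 : (((expSum e c i - j - 1).toNat : ℕ) : ℂ) = expSum e c i - j - 1 := by
        exact_mod_cast this
      rw [h3]
      linear_combination h
    omega

/-- The integrality conditions which a point of the zero set satisfies, with respect to some
vertex. -/
theorem exists_isDualVertex_of_mem_zeroSet [Nonempty κ] {s : κ → ℂ} (hs : s ∈ zeroSet e) :
    ∃ β, IsDualVertex e β ∧ (∀ i, β i ≠ 0 → ∃ j : ℕ, expEval e s i = -(j + 1)) ∧
      ∀ k, pairing β (expReal e k) ≠ 1 → ∃ j : ℕ, s k = j := by
  classical
  let S : Finset (κ ⊕ Fin n) := Finset.univ.filter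
    (Sum.elim (fun k => ∃ j : ℕ, s k = j) fun i => ∃ j : ℕ, expEval e s i = -(j + 1))
  let A : κ ⊕ Fin n → (κ → ℚ) →ₗ[ℚ] ℚ := Sum.elim (fun k => -LinearMap.proj k)
    fun i => ∑ k, (e k i : ℚ) • LinearMap.proj k
  have hA : ∀ (i : Fin n) (v : κ → ℚ), A (Sum.inr i) v = ∑ k, v k * e k i := by
    intro i v; simp [A, mul_comm]
  obtain ⟨c, hc, hg⟩ := farkas S A (∑ k, LinearMap.proj k) (by
    intro v hv
    -- clear denominators
    set N : ℕ := ∏ k, (v k).den with hN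
    have hNpos : (0 : ℚ) < N := by exact_mod_cast Finset.prod_pos fun k _ => (v k).pos
    have : ∀ k, ∃ z : ℤ, (z : ℚ) = N * v k := by
      intro k
      refine ⟨(∏ j ∈ Finset.univ.erase k, (v j).den : ℕ) * (v k).num, ?_⟩
      rw [hN, ← Finset.mul_prod_erase _ _ (Finset.mem_univ k)]
      have := Rat.mul_den_eq_num (v k)
      push_cast
      linear_combination -(∏ j ∈ Finset.univ.erase k, ((v j).den : ℚ)) * this
    choose z hz using this
    have h := nonpos_of_mem_zeroSet hs z (by
      intro k hk
      have h1 := hv (Sum.inl k) (by simpa [S] using hk)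
      have h2 : (0 : ℚ) ≤ z k := by
        rw [hz]
        simp only [A, Sum.elim_inl, LinearMap.neg_apply, LinearMap.proj_apply] at h1
        exact mul_nonneg hNpos.le (by linarith)
      exact_mod_cast h2) (by
      intro i hi
      have h1 := hv (Sum.inr i) (by simpa [S] using hi)
      rw [hA] at h1
      have h2 : (expSum e z i : ℚ) = N * ∑ k, v k * e k i := by
        simp [expSum, hz, Finset.mul_sum, mul_assoc]
      have h3 : (expSum e z i : ℚ) ≤ 0 := by
        rw [h2]; exact mul_nonpos_of_nonneg_of_nonpos hNpos.le h1
      exact_mod_cast h3)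
    have h1 : ((∑ k, z k : ℤ) : ℚ) = N * ∑ k, v k := by simp [hz, Finset.mul_sum]
    have h2 : ((∑ k, z k : ℤ) : ℚ) ≤ 0 := by exact_mod_cast h
    rw [h1] at h2
    simpa using nonpos_of_mul_nonpos_right h2 hNpos)
  set c' : κ ⊕ Fin n → ℚ := fun x => if x ∈ S then c x else 0 with hc'
  have hc0 : ∀ x, 0 ≤ c' x := fun x => by
    simp only [hc']; split_ifs
    exacts [hc x, le_rfl]
  have hg' : ∑ k, LinearMap.proj k = ∑ x, c' x • A x := by
    rw [hg, ← Finset.sum_subset (Finset.subset_univ S) fun x _ hx => by simp [hc', hx]]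
    exact Finset.sum_congr rfl fun x hx => by simp [hc', hx]
  have key : ∀ k, 1 + c' (Sum.inl k) = ∑ i, c' (Sum.inr i) * e k i := by
    intro k
    have h := DFunLike.congr_fun hg' (Pi.single k 1)
    rw [Fintype.sum_sum_type] at h
    simp only [LinearMap.sum_apply, LinearMap.add_apply, LinearMap.smul_apply, hA, smul_eq_mul,
      LinearMap.proj_apply] at h
    simp [A, Pi.single_apply] at h
    linarith
  have key' : ∀ k, pairing (fun i => (c' (Sum.inr i) : ℝ)) (expReal e k) =
      1 + (c' (Sum.inl k) : ℝ) := by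
    intro k
    have := congrArg (Rat.cast : ℚ → ℝ) (key k)
    push_cast at this
    rw [this, pairing_apply]
    exact Finset.sum_congr rfl fun i _ => mul_comm _ _
  obtain ⟨β, hβ, hβ0, hβ1⟩ := exists_isDualVertex (e := e) (fun i => (c' (Sum.inr i) : ℝ))
    (fun i => by exact_mod_cast hc0 _) (fun k => by
      rw [key' k]
      have : (0 : ℝ) ≤ c' (Sum.inl k) := by exact_mod_cast hc0 _
      linarith)
  refine ⟨β, hβ, fun i hi => ?_, fun k hk => ?_⟩
  · by_contra hS
    refine hi (hβ0 i ?_)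
    have : Sum.inr i ∉ S := by simpa [S] using hS
    simp [hc', this]
  · by_contra hS
    refine hk (hβ1 k ?_)
    have : Sum.inl k ∉ S := by simpa [S] using hS
    rw [key']
    simp [hc', this]

theorem sum_eq_sub (β : Fin n → ℝ) (s : κ → ℂ) :
    ∑ k, s k = ∑ i, (β i : ℂ) * expEval e s i -
      ∑ k, ((pairing β (expReal e k) - 1 : ℝ) : ℂ) * s k := by
  have : ∑ i, (β i : ℂ) * expEval e s i = ∑ k, ((pairing β (expReal e k) : ℝ) : ℂ) * s k := by
    simp only [expEval, pairing_apply, expReal, Finset.mul_sum, Complex.ofReal_sum,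
      Complex.ofReal_mul, Finset.sum_mul]
    rw [Finset.sum_comm]
    refine Finset.sum_congr rfl fun k _ => Finset.sum_congr rfl fun i _ => ?_
    push_cast
    ring
  rw [this, ← Finset.sum_sub_distrib]
  exact Finset.sum_congr rfl fun k _ => by push_cast; ring

/-- The sum `∑ₖ sₖ` for a point `s` of the zero set is a multiple of `1/m`, where `m` is the
common denominator of the coordinates of a vertex. -/
theorem exists_denom_of_mem_zeroSet [Nonempty κ] {s : κ → ℂ} (hs : s ∈ zeroSet e) :
    ∃ β, IsDualVertex e β ∧ ∃ z : ℤ, ∑ k, s k = ((z / (sInf (denomSet β) : ℕ) : ℚ) : ℂ) := by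
  obtain ⟨β, hβ, h1, h2⟩ := exists_isDualVertex_of_mem_zeroSet hs
  refine ⟨β, hβ, ?_⟩
  obtain ⟨hpos, hint⟩ := Nat.sInf_mem hβ.denomSet_nonempty
  generalize sInf (denomSet β) = m at hpos hint
  choose z hz using hint
  have hz' : ∀ i, (m : ℂ) * β i = z i := fun i => by exact_mod_cast congrArg Complex.ofReal (hz i)
  have hA : ∀ i, ∃ w : ℤ, (m : ℂ) * ((β i : ℂ) * expEval e s i) = w := by
    intro i
    by_cases hi : β i = 0
    · exact ⟨0, by simp [hi]⟩
    · obtain ⟨j, hj⟩ := h1 i hi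
      exact ⟨z i * -(j + 1), by rw [hj, ← mul_assoc, hz']; push_cast; ring⟩
  have hB : ∀ k, ∃ w : ℤ, (m : ℂ) * (((pairing β (expReal e k) - 1 : ℝ) : ℂ) * s k) = w := by
    intro k
    by_cases hk : pairing β (expReal e k) = 1
    · exact ⟨0, by simp [hk]⟩
    · obtain ⟨j, hj⟩ := h2 k hk
      refine ⟨(∑ i, e k i * z i - m) * j, ?_⟩
      rw [hj, pairing_apply]
      simp only [expReal]
      push_cast
      simp only [← hz']
      rw [← mul_assoc, mul_sub, Finset.mul_sum, mul_one]
      congr 2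
      exact Finset.sum_congr rfl fun i _ => by ring
  choose wA hwA using hA
  choose wB hwB using hB
  refine ⟨∑ i, wA i - ∑ k, wB k, ?_⟩
  have hm0 : (m : ℂ) ≠ 0 := by exact_mod_cast hpos.ne'
  push_cast
  rw [eq_div_iff hm0, sum_eq_sub (e := e) β s, mul_comm, mul_sub, Finset.mul_sum, Finset.mul_sum]
  simp only [hwA, hwB]

/-- Every class modulo `ℤ` in the group generated by the coordinates of a vertex `β` is the class of
`∑ₖ sₖ` for a point `s` of the zero set. -/
theorem exists_mem_zeroSet {β : Fin n → ℝ} (hβ : IsDualVertex e β) (y : Fin n → ℤ) :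
    ∃ s ∈ zeroSet e, ∃ z : ℤ, ∑ k, s k = ((∑ i, (y i : ℝ) * β i : ℝ) : ℂ) + z := by
  classical
  -- the points of this set whose sum is maximal lie in the zero set
  let S : Set (κ → ℂ) := {s | (∀ i, β i ≠ 0 → ∃ j : ℕ, expEval e s i = -(j + 1)) ∧
      ∀ k, pairing β (expReal e k) ≠ 1 → ∃ j : ℕ, s k = j}
  let P : ℤ → Prop := fun z => ∃ s ∈ S, ∑ k, s k = ((∑ i, (y i : ℝ) * β i : ℝ) : ℂ) + z
  have hbdd : ∀ z, P z → z ≤ ⌈-∑ i, (y i : ℝ) * β i⌉ := by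
    rintro z ⟨s, ⟨h1, h2⟩, hz⟩
    have hA : ∀ i, ∃ x : ℝ, 0 ≤ x ∧ (β i : ℂ) * expEval e s i = ((-x : ℝ) : ℂ) := by
      intro i
      by_cases hi : β i = 0
      · exact ⟨0, le_rfl, by simp [hi]⟩
      · obtain ⟨j, hj⟩ := h1 i hi
        exact ⟨β i * (j + 1), mul_nonneg (hβ.nonneg i) (by positivity), by
          rw [hj]; push_cast; ring⟩
    have hB : ∀ k, ∃ x : ℝ, 0 ≤ x ∧
        ((pairing β (expReal e k) - 1 : ℝ) : ℂ) * s k = (x : ℂ) := by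
      intro k
      by_cases hk : pairing β (expReal e k) = 1
      · exact ⟨0, le_rfl, by simp [hk]⟩
      · obtain ⟨j, hj⟩ := h2 k hk
        exact ⟨(pairing β (expReal e k) - 1) * j,
          mul_nonneg (sub_nonneg.2 (hβ.one_le k)) (by positivity), by rw [hj]; push_cast; ring⟩
    choose xA hA0 hA using hA
    choose xB hB0 hB using hB
    rw [sum_eq_sub (e := e) β s] at hz
    simp only [hA, hB] at hz
    have hz' : ∑ i, -xA i - ∑ k, xB k = ∑ i, (y i : ℝ) * β i + z := by exact_mod_cast hz
    have h3 : 0 ≤ ∑ i, xA i := Finset.sum_nonneg fun i _ => hA0 i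
    have h4 : 0 ≤ ∑ k, xB k := Finset.sum_nonneg fun k _ => hB0 k
    rw [Finset.sum_neg_distrib] at hz'
    have h5 : (z : ℝ) ≤ -∑ i, (y i : ℝ) * β i := by linarith
    exact_mod_cast h5.trans (Int.le_ceil _)
  have hne : ∃ z, P z := by
    obtain ⟨hpos, hint⟩ := Nat.sInf_mem hβ.denomSet_nonempty
    generalize sInf (denomSet β) = m at hpos hint
    choose w hw using hint
    have hspan : ∀ v : Fin n → ℝ, ∃ s : κ → ℝ, (∀ k, pairing β (expReal e k) ≠ 1 → s k = 0) ∧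
        ∀ i, β i ≠ 0 → ∑ k, s k * e k i = v i := by
      intro v
      have hv : v ∈ (⊤ : Submodule ℝ (Fin n → ℝ)) := trivial
      rw [← hβ.span_eq_top] at hv
      induction hv using Submodule.span_induction with
      | mem v hv =>
        rcases hv with ⟨k, hk, rfl⟩ | ⟨i, hi, rfl⟩
        · exact ⟨Pi.single k 1, fun l hl => Pi.single_eq_of_ne (by rintro rfl; exact hl hk) _,
            fun i _ => by simp [Pi.single_apply, expReal]⟩
        · exact ⟨0, fun _ _ => rfl, fun l hl => by
            rw [Pi.single_eq_of_ne (by rintro rfl; exact hl hi)]; simp⟩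
      | zero => exact ⟨0, fun _ _ => rfl, fun _ _ => by simp⟩
      | add v w _ _ hv hw =>
        obtain ⟨s, h1, h2⟩ := hv
        obtain ⟨t, h1', h2'⟩ := hw
        exact ⟨s + t, fun k hk => by simp [h1 k hk, h1' k hk], fun i hi => by
          simp [add_mul, Finset.sum_add_distrib, h2 i hi, h2' i hi]⟩
      | smul c v _ hv =>
        obtain ⟨s, h1, h2⟩ := hv
        exact ⟨c • s, fun k hk => by simp [h1 k hk], fun i hi => by
          simp [mul_assoc, ← Finset.mul_sum, h2 i hi]⟩
    -- `y' ≤ -1`, and `y' ≡ y` modulo the common denominator `m`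
    set y' : Fin n → ℤ := fun i => y i - m * (|y i| + 1) with hy'
    have hneg : ∀ i, y' i ≤ -1 := by
      intro i
      have h1 := le_abs_self (y i)
      have h2 : (1 : ℤ) * (|y i| + 1) ≤ m * (|y i| + 1) :=
        mul_le_mul_of_nonneg_right (by exact_mod_cast hpos) (by positivity)
      simp only [hy']
      linarith
    obtain ⟨s, hs1, hs2⟩ := hspan fun i => y' i
    have hE : ∀ i, expEval e (fun k => (s k : ℂ)) i = ((∑ k, s k * e k i : ℝ) : ℂ) := by
      intro i; simp [expEval]
    refine ⟨-∑ i, w i * (|y i| + 1), fun k => s k, ⟨fun i hi => ?_, fun k hk =>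
      ⟨0, by simp [hs1 k hk]⟩⟩, ?_⟩
    · refine ⟨(-y' i - 1).toNat, ?_⟩
      have h3 : (((-y' i - 1).toNat : ℕ) : ℤ) = -y' i - 1 :=
        Int.toNat_of_nonneg (by have := hneg i; omega)
      have h4 : (((-y' i - 1).toNat : ℕ) : ℂ) = -y' i - 1 := by exact_mod_cast h3
      rw [h4, hE, hs2 i hi]
      push_cast
      ring
    · rw [sum_eq_sub (e := e) β fun k => (s k : ℂ)]
      have h5 : ∑ k, ((pairing β (expReal e k) - 1 : ℝ) : ℂ) * (s k : ℂ) = 0 :=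
        Finset.sum_eq_zero fun k _ => by
          by_cases hk : pairing β (expReal e k) = 1
          · simp [hk]
          · simp [hs1 k hk]
      have h6 : ∑ i, (β i : ℂ) * expEval e (fun k => (s k : ℂ)) i =
          ∑ i, ((β i * y' i : ℝ) : ℂ) := Finset.sum_congr rfl fun i _ => by
        by_cases hi : β i = 0
        · simp [hi]
        · rw [hE, hs2 i hi]; push_cast; rfl
      have h7 : ∑ i, β i * y' i = ∑ i, (y i : ℝ) * β i - (∑ i, w i * (|y i| + 1) : ℤ) := by
        rw [Int.cast_sum, ← Finset.sum_sub_distrib]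
        refine Finset.sum_congr rfl fun i _ => ?_
        rw [Int.cast_mul, ← hw]
        simp only [hy']
        push_cast
        ring
      rw [h5, h6, sub_zero, ← Complex.ofReal_sum, h7, Complex.ofReal_sub, Complex.ofReal_intCast,
        Int.cast_neg, sub_eq_add_neg]
  obtain ⟨z, ⟨s, hs, hz⟩, hmax⟩ := Int.exists_greatest_of_bdd ⟨_, hbdd⟩ hne
  refine ⟨s, fun c hc => ?_, z, hz⟩
  by_contra hv
  rw [GenVanishes, not_or] at hv
  push Not at hv
  obtain ⟨hv1, hv2⟩ := hv
  have hlin : ∀ i, expEval e (fun k => s k + c k) i = expEval e s i + expSum e c i := by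
    intro i
    simp [expEval, expSum, add_mul, Finset.sum_add_distrib]
  have : P (z + 1) := by
    refine ⟨fun k => s k + c k, ⟨fun i hi => ?_, fun k hk => ?_⟩, ?_⟩
    · obtain ⟨j, hj⟩ := hs.1 i hi
      have hlt : expSum e c i ≤ j := by
        by_contra! hlt
        refine hv2 i (expSum e c i - (j + 1)).toNat (by omega) ?_
        have h3 : (((expSum e c i - (j + 1)).toNat : ℕ) : ℤ) = expSum e c i - (j + 1) :=
          Int.toNat_of_nonneg (by omega)
        have h4 : (((expSum e c i - (j + 1)).toNat : ℕ) : ℂ) = expSum e c i - (j + 1) := by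
          exact_mod_cast h3
        rw [h4, hj]
        ring
      refine ⟨(j - expSum e c i).toNat, ?_⟩
      have h3 : (((j - expSum e c i).toNat : ℕ) : ℤ) = j - expSum e c i :=
        Int.toNat_of_nonneg (by omega)
      have h4 : (((j - expSum e c i).toNat : ℕ) : ℂ) = j - expSum e c i := by exact_mod_cast h3
      rw [hlin, hj, h4]
      ring
    · obtain ⟨j, hj⟩ := hs.2 k hk
      have hlt : 0 ≤ j + c k := by
        by_contra! hlt
        exact hv1 k j (by omega) hj
      refine ⟨(j + c k).toNat, ?_⟩
      have h3 : (((j + c k).toNat : ℕ) : ℤ) = j + c k := Int.toNat_of_nonneg hlt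
      have h4 : (((j + c k).toNat : ℕ) : ℂ) = j + c k := by exact_mod_cast h3
      rw [h4]
      change s k + c k = _
      rw [hj]
    · rw [Finset.sum_add_distrib, hz]
      have : ((∑ k, c k : ℤ) : ℂ) = 1 := by rw [hc]; simp
      rw [← Int.cast_sum, this]
      push_cast
      ring
  have := hmax _ this
  omega

end ZeroSet

/-! ### The polynomial that generates the elimination ideal -/

section Elimination

variable {n : ℕ} {κ : Type*} [Fintype κ] {e : κ → Fin n →₀ ℕ}

theorem expEval_lineMap (s t : κ → ℂ) (z : ℂ) (i : Fin n) :
    expEval e (fun k => s k + z * (t k - s k)) i =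
      expEval e s i + z * (expEval e t i - expEval e s i) := by
  simp only [expEval, ← Finset.sum_sub_distrib, Finset.mul_sum, ← Finset.sum_add_distrib]
  exact Finset.sum_congr rfl fun k _ => by ring

variable (e) in
/-- The vanishing at `s` of one of the affine forms `s_k - j` (with `j` a natural number) and
`ℓᵢ(s) - z` (with `z` an integer), of which the generators of the ideal are products. -/
def FactorVanishes (s : κ → ℂ) : (κ × ℕ) ⊕ (Fin n × ℤ) → Prop
  | Sum.inl (k, j) => s k = j
  | Sum.inr (i, z) => expEval e s i = z

theorem FactorVanishes.lineMap {s t : κ → ℂ} {φ : (κ × ℕ) ⊕ (Fin n × ℤ)}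
    (hs : FactorVanishes e s φ) (ht : FactorVanishes e t φ) (z : ℂ) :
    FactorVanishes e (fun k => s k + z * (t k - s k)) φ := by
  rcases φ with ⟨k, j⟩ | ⟨i, w⟩
  · simp only [FactorVanishes] at *
    rw [hs, ht]; ring
  · simp only [FactorVanishes] at *
    rw [expEval_lineMap, hs, ht]; ring

variable (e) in
/-- The indices of the affine forms which are factors of the generator for the vector `c`. -/
def factorSet (c : κ → ℤ) : Set ((κ × ℕ) ⊕ (Fin n × ℤ)) :=
  (⋃ k, (fun j => Sum.inl (k, j)) '' Set.Iio (-c k).toNat) ∪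
    ⋃ i, (fun j : ℕ => Sum.inr (i, (j : ℤ) - expSum e c i)) '' Set.Iio (expSum e c i).toNat

theorem finite_factorSet (c : κ → ℤ) : (factorSet e c).Finite :=
  (Set.finite_iUnion fun _ => (Set.finite_Iio _).image _).union
    (Set.finite_iUnion fun _ => (Set.finite_Iio _).image _)

theorem genVanishes_iff (s : κ → ℂ) (c : κ → ℤ) :
    GenVanishes e s c ↔ ∃ φ ∈ factorSet e c, FactorVanishes e s φ := by
  constructor
  · rintro (⟨k, j, hj, h⟩ | ⟨i, j, hj, h⟩)
    · exact ⟨Sum.inl (k, j), Or.inl (Set.mem_iUnion.2 ⟨k, j, hj, rfl⟩), h⟩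
    · refine ⟨_, Or.inr (Set.mem_iUnion.2 ⟨i, j, hj, rfl⟩), ?_⟩
      simp only [FactorVanishes]
      push_cast
      linear_combination h
  · rintro ⟨φ, h | h, hφ⟩
    · obtain ⟨k, j, hj, rfl⟩ := Set.mem_iUnion.1 h
      exact Or.inl ⟨k, j, hj, hφ⟩
    · obtain ⟨i, j, hj, rfl⟩ := Set.mem_iUnion.1 h
      refine Or.inr ⟨i, j, hj, ?_⟩
      simp only [FactorVanishes] at hφ
      push_cast at hφ
      linear_combination hφ

variable (e) in
/-- By Noetherianity, finitely many of the generators cut out the zero set. -/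
theorem exists_finset_zeroSet_eq :
    ∃ T : Set (κ → ℤ), T.Finite ∧ ∀ s, s ∈ zeroSet e ↔ ∀ c ∈ T, GenVanishes e s c := by
  classical
  obtain ⟨T, hT, hT'⟩ := (Submodule.fg_span_iff_fg_span_finset_subset _).1
    (IsNoetherian.noetherian (stepIdeal e 0))
  let g : (κ → ℤ) → MvPolynomial κ ℂ := fun c => negFactor c * derivFactor e c 0
  have hT1 : (T : Set (MvPolynomial κ ℂ)) ⊆ g '' {c | ∑ k, c k = 1} := by
    intro p hp
    obtain ⟨c, hc, rfl⟩ := hT hp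
    exact ⟨c, hc, rfl⟩
  obtain ⟨V, hVU, hV⟩ := Finset.subset_set_image_iff.1 hT1
  refine ⟨V, V.finite_toSet, fun s => ⟨fun hs c hc => hs c (hVU hc), fun hs => ?_⟩⟩
  rw [← mem_zeroLocus_stepIdeal]
  have : stepIdeal e 0 = Ideal.span (g '' V) := by
    rw [← Finset.coe_image, hV]
    exact hT'
  rw [this, zeroLocus_span]
  rintro _ ⟨c, hc, rfl⟩
  exact (eval_gen_eq_zero_iff s c).2 (hs c hc)

variable (e) in
/-- The values of `∑ₖ sₖ` on the zero set are finite in number: the zero set is a finite union of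
affine subspaces, and the sum is constant on each of them because its values are rational. -/
theorem finite_sums [Nonempty κ] : ((fun s : κ → ℂ => ∑ k, s k) '' zeroSet e).Finite := by
  classical
  obtain ⟨T, hT, hTs⟩ := exists_finset_zeroSet_eq e
  set F := ⋃ c ∈ T, factorSet e c with hF
  have hFfin : F.Finite := hT.biUnion fun c _ => finite_factorSet c
  let Ch : (κ → ℂ) → Set ((κ × ℕ) ⊕ (Fin n × ℤ)) := fun s => {φ ∈ F | FactorVanishes e s φ}
  have hCh : ∀ s ∈ zeroSet e, ∀ t ∈ zeroSet e, Ch s = Ch t → ∑ k, s k = ∑ k, t k := by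
    intro s hs t _ hst
    by_contra hne
    set z : ℂ := (Complex.I - ∑ k, s k) / (∑ k, t k - ∑ k, s k) with hz
    have hmem : (fun k => s k + z * (t k - s k)) ∈ zeroSet e := by
      rw [hTs]
      intro c hc
      obtain ⟨φ, hφ, hφs⟩ := (genVanishes_iff s c).1 ((hTs s).1 hs c hc)
      have hφt : φ ∈ Ch t := hst ▸ ⟨Set.mem_biUnion hc hφ, hφs⟩
      exact (genVanishes_iff _ c).2 ⟨φ, hφ, hφs.lineMap hφt.2 z⟩
    obtain ⟨β, -, w, hw⟩ := exists_denom_of_mem_zeroSet hmem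
    have hsub : ∑ k, t k - ∑ k, s k ≠ 0 := sub_ne_zero.2 (Ne.symm hne)
    rw [Finset.sum_add_distrib, ← Finset.mul_sum, Finset.sum_sub_distrib, hz,
      div_mul_cancel₀ _ hsub, add_sub_cancel] at hw
    have := congrArg Complex.im hw
    rw [Complex.I_im, Complex.ratCast_im] at this
    exact one_ne_zero this
  refine (hFfin.finite_subsets.image fun A =>
    if h : ∃ s ∈ zeroSet e, Ch s = A then ∑ k, h.choose k else 0).subset ?_
  rintro _ ⟨s, hs, rfl⟩
  have h : ∃ t ∈ zeroSet e, Ch t = Ch s := ⟨s, hs, rfl⟩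
  refine ⟨Ch s, fun φ hφ => hφ.1, ?_⟩
  simp only [dif_pos h]
  exact hCh _ h.choose_spec.1 s hs h.choose_spec.2

variable (e) in
/-- The polynomials `b` for which `b(∑ₖ sₖ)` lies in the ideal are the multiples of a monic
polynomial, whose roots are the values of `∑ₖ sₖ` on the zero set. -/
theorem exists_generator [Nonempty κ] :
    ∃ b : Polynomial ℂ, b.Monic ∧
      (∀ p, Polynomial.aeval (∑ k, X k : MvPolynomial κ ℂ) p ∈ stepIdeal e 0 ↔ b ∣ p) ∧
      ∀ α, b.IsRoot α ↔ ∃ s ∈ zeroSet e, ∑ k, s k = α := by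
  classical
  let J : Ideal (Polynomial ℂ) :=
    (stepIdeal e 0).comap (Polynomial.aeval (∑ k, X k : MvPolynomial κ ℂ)).toRingHom
  have hJ : ∀ p, p ∈ J ↔ Polynomial.aeval (∑ k, X k : MvPolynomial κ ℂ) p ∈ stepIdeal e 0 :=
    fun p => Iff.rfl
  have heval : ∀ (s : κ → ℂ) (p : Polynomial ℂ),
      aeval s (Polynomial.aeval (∑ k, X k : MvPolynomial κ ℂ) p) = p.eval (∑ k, s k) := by
    intro s p
    have := Polynomial.aeval_algHom_apply (aeval s : MvPolynomial κ ℂ →ₐ[ℂ] ℂ) (∑ k, X k) p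
    rw [map_sum] at this
    simp only [aeval_X] at this
    rw [← this, Polynomial.coe_aeval_eq_eval]
  let q : Polynomial ℂ := ∏ x ∈ (finite_sums e).toFinset, (Polynomial.X - Polynomial.C x)
  have hq0 : q ≠ 0 := (Polynomial.monic_prod_X_sub_C _ _).ne_zero
  have hqroot : ∀ α, q.IsRoot α ↔ ∃ s ∈ zeroSet e, ∑ k, s k = α := by
    intro α
    simp [q, Polynomial.IsRoot.def, Polynomial.eval_prod, Finset.prod_eq_zero_iff, sub_eq_zero]
  -- by the Nullstellensatz a power of `q` lies in `J`
  obtain ⟨N, hN⟩ : ∃ N : ℕ, q ^ N ∈ J := by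
    have : Polynomial.aeval (∑ k, X k : MvPolynomial κ ℂ) q ∈ (stepIdeal e 0).radical := by
      rw [← vanishingIdeal_zeroLocus_eq_radical (K := ℂ), mem_vanishingIdeal_iff]
      intro s hs
      rw [mem_zeroLocus_stepIdeal] at hs
      rw [heval]
      exact (hqroot _).2 ⟨s, hs, rfl⟩
    obtain ⟨N, hN⟩ := this
    exact ⟨N, by rw [hJ, map_pow]; exact hN⟩
  obtain ⟨g, hg⟩ := (IsPrincipalIdealRing.principal J).principal
  have hg' : ∀ p, p ∈ J ↔ g ∣ p := fun p => by rw [hg]; exact Ideal.mem_span_singleton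
  have hg0 : g ≠ 0 := by
    rintro rfl
    exact pow_ne_zero N hq0 (zero_dvd_iff.1 ((hg' _).1 hN))
  have hb : ∀ p, p ∈ J ↔ normalize g ∣ p := fun p => by rw [hg', normalize_dvd_iff]
  refine ⟨normalize g, Polynomial.monic_normalize hg0, fun p => (hJ p).symm.trans (hb p),
    fun α => ⟨fun h => ?_, ?_⟩⟩
  · rw [← hqroot]
    have := h.dvd ((hb _).1 hN)
    rw [Polynomial.IsRoot.def, Polynomial.eval_pow] at this
    exact eq_zero_of_pow_eq_zero this
  · rintro ⟨s, hs, rfl⟩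
    rw [← mem_zeroLocus_stepIdeal] at hs
    have h := hs _ ((hJ _).1 ((hb _).2 dvd_rfl))
    rwa [heval] at h

end Elimination

/-! ### Facets of the Newton polyhedron -/

section Facets

variable {n : ℕ} {κ : Type*} (e : κ → Fin n →₀ ℕ)

/-- The Newton polyhedron of the ideal generated by the monomials `x^{eₖ}`: the convex hull of the
exponents which are bounded below by one of the `eₖ`. -/
def newtonHull : Set (Fin n → ℝ) :=
  convexHull ℝ ((fun (u : Fin n →₀ ℕ) (i : Fin n) => (u i : ℝ)) '' {u | ∃ k, e k ≤ u})

/-- The face of the Newton polyhedron on which the linear form `β` is equal to `1`. -/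
def dualFace (β : Fin n → ℝ) : Set (Fin n → ℝ) := {x ∈ newtonHull e | pairing β x = 1}

variable {e}

theorem mem_newtonHull {u : Fin n →₀ ℕ} {k : κ} (h : e k ≤ u) :
    (fun i => (u i : ℝ)) ∈ newtonHull e :=
  subset_convexHull ℝ _ ⟨u, ⟨k, h⟩, rfl⟩

theorem expReal_mem_newtonHull (k : κ) : expReal e k ∈ newtonHull e := mem_newtonHull le_rfl

theorem expReal_add_single_mem_newtonHull (k : κ) (i : Fin n) (m : ℕ) :
    expReal e k + (m : ℝ) • Pi.single i 1 ∈ newtonHull e := by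
  classical
  have : expReal e k + (m : ℝ) • Pi.single i 1 =
      fun j => ((e k + Finsupp.single i m : Fin n →₀ ℕ) j : ℝ) := by
    funext j
    by_cases h : j = i
    · subst h; simp [expReal]
    · simp [expReal, h]
  rw [this]
  exact mem_newtonHull le_self_add

theorem nonneg_of_mem_newtonHull {x : Fin n → ℝ} (hx : x ∈ newtonHull e) (i : Fin n) :
    0 ≤ x i := by
  have h : newtonHull e ⊆ {x | 0 ≤ x i} := by
    refine convexHull_min ?_ (convex_halfSpace_ge (f := fun x : Fin n → ℝ => x i)
      (LinearMap.proj (R := ℝ) (φ := fun _ : Fin n => ℝ) i).isLinear 0)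
    rintro _ ⟨u, -, rfl⟩
    exact Nat.cast_nonneg (α := ℝ) (u i)
  exact h hx

theorem pairing_le_pairing {β : Fin n → ℝ} (h0 : ∀ i, 0 ≤ β i) {x y : Fin n → ℝ} (h : x ≤ y) :
    pairing β x ≤ pairing β y := by
  rw [pairing_apply, pairing_apply]
  exact Finset.sum_le_sum fun i _ => mul_le_mul_of_nonneg_right (h i) (h0 i)

theorem one_le_pairing {β : Fin n → ℝ} (h0 : ∀ i, 0 ≤ β i)
    (h1 : ∀ k, 1 ≤ pairing β (expReal e k)) {x : Fin n → ℝ} (hx : x ∈ newtonHull e) :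
    1 ≤ pairing β x := by
  have h : newtonHull e ⊆ {x | 1 ≤ pairing β x} := by
    refine convexHull_min ?_ (convex_halfSpace_ge (pairing β).isLinear 1)
    rintro _ ⟨u, ⟨k, hk⟩, rfl⟩
    exact (h1 k).trans (pairing_le_pairing h0 fun i => Nat.cast_le.2 (hk i))
  exact h hx

theorem single_mem_vectorSpan {S : Set (Fin n → ℝ)} {k : κ} {i : Fin n}
    (h1 : expReal e k ∈ S) (h2 : expReal e k + ((1 : ℕ) : ℝ) • Pi.single i 1 ∈ S) :
    Pi.single i 1 ∈ vectorSpan ℝ S := by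
  have := vsub_mem_vectorSpan ℝ h2 h1
  simpa using this

theorem vectorSpan_newtonHull [Nonempty κ] : vectorSpan ℝ (newtonHull e) = ⊤ := by
  obtain ⟨k⟩ := ‹Nonempty κ›
  rw [eq_top_iff, ← (Pi.basisFun ℝ (Fin n)).span_eq, Submodule.span_le]
  rintro _ ⟨i, rfl⟩
  rw [Pi.basisFun_apply]
  exact single_mem_vectorSpan (expReal_mem_newtonHull k) (expReal_add_single_mem_newtonHull k i 1)

theorem finrank_vectorSpan_newtonHull [Nonempty κ] :
    Module.finrank ℝ (vectorSpan ℝ (newtonHull e)) = n := by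
  rw [vectorSpan_newtonHull, finrank_top, Module.finrank_fin_fun]

theorem IsDualVertex.exists_tight [Nonempty κ] {β : Fin n → ℝ} (hβ : IsDualVertex e β) :
    ∃ k, pairing β (expReal e k) = 1 := by
  by_contra! h
  obtain ⟨k⟩ := ‹Nonempty κ›
  have h0 : pairing β = 0 := hβ.ext_linear (fun k hk => absurd hk (h k)) fun i hi => by
    simp [pairing_single, hi]
  have := hβ.one_le k
  rw [h0] at this
  norm_num at this

theorem expReal_mem_dualFace {β : Fin n → ℝ} {k : κ} (hk : pairing β (expReal e k) = 1) :
    expReal e k ∈ dualFace e β := ⟨expReal_mem_newtonHull k, hk⟩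

theorem expReal_add_single_mem_dualFace {β : Fin n → ℝ} {k : κ} {i : Fin n}
    (hk : pairing β (expReal e k) = 1) (hi : β i = 0) :
    expReal e k + ((1 : ℕ) : ℝ) • Pi.single i 1 ∈ dualFace e β :=
  ⟨expReal_add_single_mem_newtonHull k i 1, by simp [map_add, pairing_single, hk, hi]⟩

theorem vectorSpan_dualFace_le_ker (β : Fin n → ℝ) :
    vectorSpan ℝ (dualFace e β) ≤ LinearMap.ker (pairing β) := by
  rw [vectorSpan_def, Submodule.span_le]
  rintro _ ⟨x, hx, y, hy, rfl⟩
  change pairing β (x - y) = 0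
  rw [map_sub, hx.2, hy.2, sub_self]

theorem IsDualVertex.dualFace_mem_noncoordinateFacets [Nonempty κ] {β : Fin n → ℝ}
    (hβ : IsDualVertex e β) : dualFace e β ∈ noncoordinateFacets (newtonHull e) := by
  obtain ⟨k₀, hk₀⟩ := hβ.exists_tight
  refine ⟨⟨⟨_, expReal_mem_dualFace hk₀⟩, fun _ => ?_, ?_⟩, fun i hi => ?_⟩
  · refine ⟨-(pairing β).toContinuousLinearMap, Set.ext fun x => and_congr_right fun hx => ?_⟩
    constructor
    · intro h y hy
      have := one_le_pairing hβ.nonneg hβ.one_le hy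
      simp only [neg_apply, LinearMap.coe_toContinuousLinearMap', h]
      linarith
    · intro h
      have h1 := h _ (expReal_mem_newtonHull k₀)
      have h2 := one_le_pairing hβ.nonneg hβ.one_le hx
      simp only [neg_apply, LinearMap.coe_toContinuousLinearMap', hk₀] at h1
      linarith
  · rw [finrank_vectorSpan_newtonHull]
    have hsup : vectorSpan ℝ (dualFace e β) ⊔ Submodule.span ℝ {expReal e k₀} = ⊤ := by
      rw [eq_top_iff, ← hβ.span_eq_top, Submodule.span_le]
      rintro _ (⟨k, hk, rfl⟩ | ⟨i, hi, rfl⟩)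
      · rw [← sub_add_cancel (expReal e k) (expReal e k₀)]
        exact Submodule.add_mem_sup
          (vsub_mem_vectorSpan ℝ (expReal_mem_dualFace hk) (expReal_mem_dualFace hk₀))
          (Submodule.mem_span_singleton_self _)
      · exact Submodule.mem_sup_left (single_mem_vectorSpan (expReal_mem_dualFace hk₀)
          (expReal_add_single_mem_dualFace hk₀ hi))
    have h1 := Submodule.finrank_add_le_finrank_add_finrank (vectorSpan ℝ (dualFace e β))
      (Submodule.span ℝ {expReal e k₀})
    rw [hsup, finrank_top, Module.finrank_fin_fun] at h1
    have h2 := finrank_span_le_card (R := ℝ) {expReal e k₀}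
    rw [Set.toFinset_card, Fintype.card_unique] at h2
    have h3 : vectorSpan ℝ (dualFace e β) ≠ ⊤ := fun h => by
      have : expReal e k₀ ∈ LinearMap.ker (pairing β) :=
        vectorSpan_dualFace_le_ker β (h ▸ Submodule.mem_top)
      rw [LinearMap.mem_ker, hk₀] at this
      exact one_ne_zero this
    have h4 := Submodule.finrank_lt h3
    rw [Module.finrank_fin_fun] at h4
    omega
  · have h0 : (LinearMap.proj i : (Fin n → ℝ) →ₗ[ℝ] ℝ) = 0 := by
      refine hβ.ext_linear (fun k hk => hi (expReal_mem_dualFace hk)) fun j hj => ?_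
      have h1 : expReal e k₀ i = 0 := hi (expReal_mem_dualFace hk₀)
      have h2 := hi (expReal_add_single_mem_dualFace hk₀ hj)
      simpa [h1] using h2
    have := DFunLike.congr_fun h0 (Pi.single i 1)
    simp at this

/-- The linear form `L_Q` of the face `Q` of a vertex `β` has the coefficient vector `β`. -/
theorem IsDualVertex.facetDenominator_dualFace [Nonempty κ] {β : Fin n → ℝ}
    (hβ : IsDualVertex e β) : facetDenominator (dualFace e β) = sInf (denomSet β) := by
  obtain ⟨k₀, hk₀⟩ := hβ.exists_tight
  refine congrArg sInf (Set.ext fun m => and_congr_right fun _ => ⟨?_, fun h => ?_⟩)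
  · rintro ⟨L, hL, h⟩
    have : L = pairing β := by
      refine hβ.ext_linear (fun k hk => by rw [hL _ (expReal_mem_dualFace hk), hk]) fun i hi => ?_
      have h1 := hL _ (expReal_add_single_mem_dualFace hk₀ hi)
      rw [map_add, hL _ (expReal_mem_dualFace hk₀)] at h1
      simpa [pairing_single, hi] using h1
    simpa [this, pairing_single] using h
  · exact ⟨pairing β, fun x hx => hx.2, by simpa [pairing_single] using h⟩

/-- The points of the Newton polyhedron with `β · x = 1` are combinations of the `eₖ` with
`β · eₖ = 1` and of the basis vectors with `βᵢ = 0`. -/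
theorem dualFace_subset_span {β : Fin n → ℝ} (h0 : ∀ i, 0 ≤ β i)
    (h1 : ∀ k, 1 ≤ pairing β (expReal e k)) :
    dualFace e β ⊆ Submodule.span ℝ ({v | ∃ k, pairing β (expReal e k) = 1 ∧ v = expReal e k} ∪
      {v | ∃ i, β i = 0 ∧ v = Pi.single i 1}) := by
  classical
  set E := Submodule.span ℝ ({v | ∃ k, pairing β (expReal e k) = 1 ∧ v = expReal e k} ∪
      {v | ∃ i, β i = 0 ∧ v = Pi.single i 1})
  have h : newtonHull e ⊆ {x | 1 ≤ pairing β x ∧ (pairing β x = 1 → x ∈ E)} := by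
    refine convexHull_min ?_ ?_
    · rintro _ ⟨u, ⟨k, hk⟩, rfl⟩
      have hle : expReal e k ≤ fun i => (u i : ℝ) := fun i => Nat.cast_le.2 (hk i)
      have h2 := pairing_le_pairing h0 hle
      refine ⟨(h1 k).trans h2, fun hu => ?_⟩
      have hk1 : pairing β (expReal e k) = 1 := le_antisymm (hu ▸ h2) (h1 k)
      have hz : ∑ i, ((u i : ℝ) - expReal e k i) * β i = 0 := by
        have : pairing β ((fun i => (u i : ℝ)) - expReal e k) = 0 := by
          rw [map_sub, hu, hk1, sub_self]
        exact this
      rw [Finset.sum_eq_zero_iff_of_nonneg fun i _ =>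
        mul_nonneg (sub_nonneg.2 (hle i)) (h0 i)] at hz
      have hu' : (fun i => (u i : ℝ)) = expReal e k +
          ∑ i, ((u i : ℝ) - expReal e k i) • (Pi.single i 1 : Fin n → ℝ) := by
        funext j
        simp [Finset.sum_apply, Pi.single_apply]
      change (fun i => (u i : ℝ)) ∈ E
      rw [hu']
      refine E.add_mem (Submodule.subset_span (Or.inl ⟨k, hk1, rfl⟩)) (E.sum_mem fun i hi => ?_)
      rcases mul_eq_zero.1 (hz i hi) with h | h
      · rw [h, zero_smul]; exact E.zero_mem
      · exact E.smul_mem _ (Submodule.subset_span (Or.inr ⟨i, h, rfl⟩))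
    · intro x hx y hy a b ha hb hab
      have hval : pairing β (a • x + b • y) = a * pairing β x + b * pairing β y := by simp
      refine ⟨?_, fun h => ?_⟩
      · rw [hval]
        nlinarith [mul_le_mul_of_nonneg_left hx.1 ha, mul_le_mul_of_nonneg_left hy.1 hb]
      · rw [hval] at h
        have hx1 : a * (pairing β x - 1) = 0 := by
          have := mul_nonneg ha (sub_nonneg.2 hx.1)
          have := mul_nonneg hb (sub_nonneg.2 hy.1)
          linarith
        have hy1 : b * (pairing β y - 1) = 0 := by linarith
        refine E.add_mem ?_ ?_
        · rcases mul_eq_zero.1 hx1 with h | h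
          · rw [h, zero_smul]; exact E.zero_mem
          · exact E.smul_mem _ (hx.2 (by linarith))
        · rcases mul_eq_zero.1 hy1 with h | h
          · rw [h, zero_smul]; exact E.zero_mem
          · exact E.smul_mem _ (hy.2 (by linarith))
  exact fun x hx => (h hx.1).2 hx.2

/-- A noncoordinate facet comes from a vertex: the linear form which exposes it is, up to sign,
nonnegative on the coordinate vectors and positive on the facet, and the dimension of the facet
forces the equations `β · eₖ = 1` and `βᵢ = 0` to determine `β`. -/
theorem exists_eq_dualFace [Nonempty κ] {Q : Set (Fin n → ℝ)}
    (hQ : Q ∈ noncoordinateFacets (newtonHull e)) : ∃ β, IsDualVertex e β ∧ Q = dualFace e β := by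
  obtain ⟨⟨⟨q, hq⟩, hexp, hdim⟩, hcoord⟩ := hQ
  rw [finrank_vectorSpan_newtonHull] at hdim
  obtain ⟨l, hl⟩ := hexp ⟨q, hq⟩
  have hqP : q ∈ newtonHull e ∧ ∀ y ∈ newtonHull e, l y ≤ l q := by rw [hl] at hq; exact hq
  set w : Fin n → ℝ := fun i => -l (Pi.single i 1) with hw
  have hwl : ∀ x, pairing w x = -l x := by
    have := pairing_eta (-(l : (Fin n → ℝ) →ₗ[ℝ] ℝ))
    exact fun x => DFunLike.congr_fun this x
  obtain ⟨k₀⟩ := ‹Nonempty κ›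
  have : Nonempty κ := ⟨k₀⟩
  have hw0 : ∀ i, 0 ≤ w i := by
    intro i
    by_contra! hi
    obtain ⟨m, hm⟩ := exists_nat_gt ((l q - l (expReal e k₀)) / -w i)
    rw [div_lt_iff₀ (by linarith)] at hm
    have := hqP.2 _ (expReal_add_single_mem_newtonHull k₀ i m)
    rw [map_add, map_smul, smul_eq_mul] at this
    simp only [hw] at hm
    linarith
  have hc0 : 0 ≤ pairing w q := by
    rw [pairing_apply]
    exact Finset.sum_nonneg fun i _ => mul_nonneg (nonneg_of_mem_newtonHull hqP.1 i) (hw0 i)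
  have hQ' : ∀ x, x ∈ Q ↔ x ∈ newtonHull e ∧ pairing w x = pairing w q := by
    intro x
    rw [hl]
    refine and_congr_right fun hx => ⟨fun h => ?_, fun h y hy => ?_⟩
    · rw [hwl, hwl, le_antisymm (hqP.2 x hx) (h q hqP.1)]
    · rw [hwl, hwl, neg_inj] at h
      rw [h]
      exact hqP.2 y hy
  have hc : 0 < pairing w q := by
    refine lt_of_le_of_ne hc0 fun hc => ?_
    by_cases hwz : ∃ i, w i ≠ 0
    · obtain ⟨i, hi⟩ := hwz
      refine hcoord i fun x hx => ?_
      obtain ⟨hxP, hx⟩ := (hQ' x).1 hx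
      rw [← hc, pairing_apply, Finset.sum_eq_zero_iff_of_nonneg fun i _ =>
        mul_nonneg (nonneg_of_mem_newtonHull hxP i) (hw0 i)] at hx
      exact (mul_eq_zero.1 (hx i (Finset.mem_univ i))).resolve_right hi
    · push Not at hwz
      have hQP : Q = newtonHull e := Set.ext fun x => by
        rw [hQ' x, and_iff_left]
        simp [pairing_apply, hwz]
      rw [hQP, finrank_vectorSpan_newtonHull] at hdim
      omega
  set c := pairing w q with hcdef
  have hpair : ∀ x, pairing (fun i => w i / c) x = pairing w x / c := by
    intro x
    simp only [pairing_apply, Finset.sum_div, mul_div_assoc]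
  have hQβ : Q = dualFace e fun i => w i / c := Set.ext fun x => by
    rw [hQ' x, dualFace, Set.mem_sep_iff, hpair, div_eq_one_iff_eq hc.ne']
  have h0 : ∀ i, 0 ≤ w i / c := fun i => div_nonneg (hw0 i) hc.le
  have h1 : ∀ k, 1 ≤ pairing (fun i => w i / c) (expReal e k) := by
    intro k
    rw [hpair, one_le_div hc, hcdef, hwl, hwl, neg_le_neg_iff]
    exact hqP.2 _ (expReal_mem_newtonHull k)
  refine ⟨_, ⟨h0, h1, ?_⟩, hQβ⟩
  have hsub := dualFace_subset_span h0 h1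
  set E := Submodule.span ℝ ({v | ∃ k, pairing (fun i => w i / c) (expReal e k) = 1 ∧
    v = expReal e k} ∪ {v | ∃ i, w i / c = 0 ∧ v = Pi.single i 1})
  -- `E` contains the direction of `Q` strictly
  have hlt : vectorSpan ℝ Q < E := by
    refine SetLike.lt_iff_le_and_exists.2 ⟨?_, q, ?_, fun h => ?_⟩
    · rw [vectorSpan_def, Submodule.span_le]
      rintro _ ⟨x, hx, y, hy, rfl⟩
      rw [hQβ] at hx hy
      exact E.sub_mem (hsub hx) (hsub hy)
    · rw [hQβ] at hq
      exact hsub hq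
    · rw [hQβ] at h
      have := vectorSpan_dualFace_le_ker _ h
      rw [LinearMap.mem_ker, hpair, div_self hc.ne'] at this
      exact one_ne_zero this
  have := Submodule.finrank_lt_finrank_of_lt hlt
  refine Submodule.eq_top_of_finrank_eq ?_
  refine le_antisymm (Submodule.finrank_le _) ?_
  rw [Module.finrank_fin_fun]
  omega

theorem noncoordinateFacets_newtonHull [Nonempty κ] :
    noncoordinateFacets (newtonHull e) = {Q | ∃ β, IsDualVertex e β ∧ Q = dualFace e β} := by
  refine Set.ext fun Q => ⟨exists_eq_dualFace, ?_⟩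
  rintro ⟨β, hβ, rfl⟩
  exact hβ.dualFace_mem_noncoordinateFacets

end Facets

/-! ### Monomial ideals and their integral closure -/

section MonomialIdeal

variable {n : ℕ}

theorem IsMonomialIdeal.mem_exponents {a : Ideal (PolyRing n)} (ha : IsMonomialIdeal a)
    {p : PolyRing n} (hp : p ∈ a) {u : Fin n →₀ ℕ} (hu : u ∈ p.support) : u ∈ exponents a := by
  classical
  obtain ⟨S, rfl⟩ := ha
  obtain ⟨v, hv, hvu⟩ := mem_ideal_span_monomial_image.1 hp u hu
  refine mem_ideal_span_monomial_image.2 fun w hw => ⟨v, hv, ?_⟩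
  rw [support_monomial, if_neg one_ne_zero, Finset.mem_singleton] at hw
  exact hw ▸ hvu

theorem mem_newtonPolyhedron {a : Ideal (PolyRing n)} {u : Fin n →₀ ℕ} (hu : u ∈ exponents a) :
    (fun i => (u i : ℝ)) ∈ newtonPolyhedron a :=
  subset_convexHull ℝ _ ⟨u, hu, rfl⟩

open scoped Pointwise in
/-- The exponents in the power `a ^ (k + 1)` lie in the dilation of the Newton polyhedron by
`k + 1`. -/
theorem mem_smul_newtonPolyhedron {a : Ideal (PolyRing n)} (ha : IsMonomialIdeal a) (k : ℕ)
    {p : PolyRing n} (hp : p ∈ a ^ (k + 1)) {u : Fin n →₀ ℕ} (hu : u ∈ p.support) :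
    (fun i => (u i : ℝ)) ∈ ((k : ℝ) + 1) • newtonPolyhedron a := by
  classical
  induction k generalizing p u with
  | zero =>
    rw [zero_add, pow_one] at hp
    rw [Nat.cast_zero, zero_add, one_smul]
    exact mem_newtonPolyhedron (ha.mem_exponents hp hu)
  | succ k ih =>
    rw [pow_succ] at hp
    have hconv : Convex ℝ (newtonPolyhedron a) := convex_convexHull ℝ _
    rw [Nat.cast_succ, hconv.add_smul (by positivity) zero_le_one, one_smul]
    induction hp using Submodule.mul_induction_on' generalizing u with
    | mem_mul_mem p hp q hq =>
      obtain ⟨v, hv, w, hw, rfl⟩ := Finset.mem_add.1 (support_mul p q hu)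
      refine ⟨_, ih hp hv, _, mem_newtonPolyhedron (ha.mem_exponents hq hw), ?_⟩
      funext i
      simp
    | add p _ q _ hp hq =>
      rcases Finset.mem_union.1 (support_add hu) with h | h
      exacts [hp h, hq h]

open scoped Pointwise in
/-- If `x^u` satisfies an equation of integral dependence of degree `d`, a comparison of the
coefficients of `x^{du}` gives `x^{ku} ∈ a^k` for some `k ≥ 1`. -/
theorem mem_newtonPolyhedron_of_mem_integralClosure {a : Ideal (PolyRing n)}
    (ha : IsMonomialIdeal a) {u : Fin n →₀ ℕ}
    (hu : monomial u (1 : ℂ) ∈ idealIntegralClosure a) :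
    (fun i => (u i : ℝ)) ∈ newtonPolyhedron a := by
  classical
  obtain ⟨d, -, c, hc, h⟩ := hu
  obtain ⟨k, hk, hne⟩ : ∃ k ∈ Finset.Icc 1 d, coeff (k • u) (c k) ≠ 0 := by
    by_contra! hall
    have h1 := congrArg (coeff (d • u)) h
    rw [coeff_add, coeff_sum, monomial_pow, one_pow, coeff_monomial, if_pos rfl, coeff_zero,
      Finset.sum_eq_zero, add_zero] at h1
    · exact one_ne_zero h1
    · intro k hk
      have hsplit : d • u = k • u + (d - k) • u := by
        rw [← add_smul, Nat.add_sub_cancel' (Finset.mem_Icc.1 hk).2]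
      rw [monomial_pow, one_pow, hsplit, coeff_mul_monomial, hall k hk, zero_mul]
  obtain ⟨m, rfl⟩ := Nat.exists_eq_succ_of_ne_zero
    (Nat.one_le_iff_ne_zero.1 (Finset.mem_Icc.1 hk).1)
  have := mem_smul_newtonPolyhedron ha m (hc _) (mem_support_iff.2 hne)
  have heq : (fun i => (((m + 1) • u : Fin n →₀ ℕ) i : ℝ)) =
      ((m : ℝ) + 1) • fun i => (u i : ℝ) := by
    funext i
    simp
  rw [Nat.succ_eq_add_one, heq, Set.smul_mem_smul_set_iff₀ (by positivity)] at this
  exact this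

theorem subset_idealIntegralClosure {R : Type*} [CommRing R] (a : Ideal R) :
    (a : Set R) ⊆ idealIntegralClosure a := by
  intro z hz
  refine ⟨1, one_pos, fun k => if k = 1 then -z else 0, fun k => ?_, by simp⟩
  dsimp only
  split_ifs with h
  · rw [h, pow_one]; exact a.neg_mem hz
  · exact zero_mem _

theorem newtonPolyhedron_subset_of_integralClosure_subset {a a' : Ideal (PolyRing n)}
    (ha : IsMonomialIdeal a) (h : idealIntegralClosure a' ⊆ idealIntegralClosure a) :
    newtonPolyhedron a' ⊆ newtonPolyhedron a := by
  refine convexHull_min ?_ (convex_convexHull ℝ _)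
  rintro _ ⟨u, hu, rfl⟩
  exact mem_newtonPolyhedron_of_mem_integralClosure ha (h (subset_idealIntegralClosure a' hu))

theorem newtonPolyhedron_eq_newtonHull {κ : Type*} (e : κ → Fin n →₀ ℕ) :
    newtonPolyhedron (Ideal.span (Set.range fun k => monomial (e k) (1 : ℂ))) = newtonHull e := by
  classical
  have : exponents (Ideal.span (Set.range fun k => monomial (e k) (1 : ℂ))) =
      {u | ∃ k, e k ≤ u} := by
    ext u
    have hr : (Set.range fun k => monomial (e k) (1 : ℂ)) =
        (fun u => monomial u (1 : ℂ)) '' Set.range e := by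
      rw [← Set.range_comp]; rfl
    rw [exponents, Set.mem_ofPred_eq, hr, mem_ideal_span_monomial_image, support_monomial,
      if_neg one_ne_zero]
    simp
  rw [newtonPolyhedron, this, newtonHull]

/-- The monomials which occur in generators of a nonzero monomial ideal generate it. -/
theorem IsMonomialIdeal.exists_exponents {a : Ideal (PolyRing n)} (ha : IsMonomialIdeal a)
    (ha0 : a ≠ ⊥) {r : ℕ} {f : Fin r → PolyRing n} (hf : Ideal.span (Set.range f) = a) :
    ∃ S : Finset (Fin n →₀ ℕ), S.Nonempty ∧
      Ideal.span (Set.range fun u : S => monomial (u : Fin n →₀ ℕ) (1 : ℂ)) = a := by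
  classical
  have hfa : ∀ j, f j ∈ a := fun j => hf ▸ Ideal.subset_span ⟨j, rfl⟩
  have hspan : Ideal.span (Set.range fun u : (Finset.univ.biUnion fun j => (f j).support :
      Finset (Fin n →₀ ℕ)) => monomial (u : Fin n →₀ ℕ) (1 : ℂ)) = a := by
    refine le_antisymm (Ideal.span_le.2 ?_) ?_
    · rintro _ ⟨⟨u, hu⟩, rfl⟩
      obtain ⟨j, -, hu⟩ := Finset.mem_biUnion.1 hu
      exact ha.mem_exponents (hfa j) hu
    · conv_lhs => rw [← hf]
      refine Ideal.span_le.2 ?_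
      rintro _ ⟨j, rfl⟩
      rw [SetLike.mem_coe, (f j).as_sum]
      refine Ideal.sum_mem _ fun u hu => ?_
      have h1 : monomial u (coeff u (f j)) = C (coeff u (f j)) * monomial u 1 := by
        rw [C_mul_monomial, mul_one]
      rw [h1]
      exact Ideal.mul_mem_left _ _ (Ideal.subset_span
        ⟨⟨u, Finset.mem_biUnion.2 ⟨j, Finset.mem_univ j, hu⟩⟩, rfl⟩)
  refine ⟨_, ?_, hspan⟩
  by_contra hne
  rw [Finset.not_nonempty_iff_eq_empty] at hne
  rw [hne] at hspan
  refine ha0 (hspan.symm.trans ?_)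
  rw [Ideal.span_eq_bot]
  rintro _ ⟨⟨u, hu⟩, -⟩
  simp at hu

end MonomialIdeal

/-! ### The classes of the roots -/

section RootClasses

theorem zsmul_mk_inv_eq_mk_iff {q : ℚ} {m : ℕ} {j : ℤ} :
    j • (QuotientAddGroup.mk (1 / (m : ℚ)) : QmodZ) = QuotientAddGroup.mk q ↔
      ∃ z : ℤ, q = j / m + z := by
  rw [← QuotientAddGroup.mk_zsmul, QuotientAddGroup.eq, AddSubgroup.mem_zmultiples_iff]
  refine exists_congr fun z => ?_
  rw [zsmul_eq_mul, zsmul_eq_mul, mul_one, mul_one_div, eq_neg_add_iff_add_eq, eq_comm]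

variable {n : ℕ} {κ : Type*} [Fintype κ] [Nonempty κ] {e : κ → Fin n →₀ ℕ}

/-- The Bernstein–Sato polynomial, for generators of an ideal generated by monomials `x^{eₖ}`. -/
theorem exists_bernsteinSato_of_span_eq [DecidableEq κ] {r : ℕ} {f : Fin r → PolyRing n}
    (hf0 : ∀ j, f j ≠ 0)
    (hf : Ideal.span (Set.range f) = Ideal.span (Set.range fun k => monomial (e k) (1 : ℂ))) :
    ∃ b : Polynomial ℂ, (∀ p, IsBernsteinSatoPolynomial f p ↔ p = b) ∧
      ∀ α, b.IsRoot α ↔ ∃ s ∈ zeroSet e, ∑ k, s k = α := by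
  obtain ⟨b, hb, hdvd, hroot⟩ := exists_generator e
  have hFE : ∀ p, FunctionalEquation f p ↔ b ∣ p := fun p => by
    rw [functionalEquation_iff_graphFunEq f hf0, graphFunEq_iff_of_span_eq hf,
      graphFunEq_monomial_iff_mem, hdvd]
  refine ⟨b, fun p => ⟨?_, ?_⟩, hroot⟩
  · rintro ⟨hp, hpf, hmin⟩
    exact Polynomial.eq_of_monic_of_dvd_of_natDegree_le hb hp ((hFE p).1 hpf)
      (hmin b hb ((hFE b).2 dvd_rfl))
  · rintro rfl
    exact ⟨hb, (hFE _).2 dvd_rfl, fun p hp hpf =>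
      Polynomial.natDegree_le_of_dvd ((hFE p).1 hpf) hp.ne_zero⟩

theorem mem_rootClasses_iff {b : Polynomial ℂ}
    (hb : ∀ α, b.IsRoot α ↔ ∃ s ∈ zeroSet e, ∑ k, s k = α) (x : QmodZ) :
    x ∈ rootClasses b ↔ ∃ β, IsDualVertex e β ∧
      x ∈ AddSubgroup.zmultiples (QuotientAddGroup.mk (1 / (sInf (denomSet β) : ℕ) : ℚ) :
        QmodZ) := by
  constructor
  · rintro ⟨q, hq, rfl⟩
    obtain ⟨s, hs, hsq⟩ := (hb _).1 hq
    obtain ⟨β, hβ, z, hz⟩ := exists_denom_of_mem_zeroSet hs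
    rw [hsq] at hz
    refine ⟨β, hβ, z, zsmul_mk_inv_eq_mk_iff.2 ⟨0, ?_⟩⟩
    rw [Int.cast_zero, add_zero]
    exact_mod_cast hz
  · rintro ⟨β, hβ, j, rfl⟩
    obtain ⟨y, w, hyw⟩ := exists_sum_eq_inv hβ.denomSet_nonempty
    obtain ⟨s, hs, z, hz⟩ := exists_mem_zeroSet hβ fun i => j * y i
    have h1 : ∑ i, ((j * y i : ℤ) : ℝ) * β i =
        ((j / (sInf (denomSet β) : ℕ) - j * w : ℚ) : ℝ) := by
      have h2 : ∑ i, ((j * y i : ℤ) : ℝ) * β i = j * ∑ i, (y i : ℝ) * β i := by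
        rw [Finset.mul_sum]
        exact Finset.sum_congr rfl fun i _ => by push_cast; ring
      rw [h2, eq_sub_of_add_eq hyw]
      push_cast
      ring
    refine ⟨j / (sInf (denomSet β) : ℕ) + (z - j * w : ℤ), ?_,
      (zsmul_mk_inv_eq_mk_iff.2 ⟨_, rfl⟩).symm⟩
    rw [hb]
    refine ⟨s, hs, ?_⟩
    rw [hz, h1]
    push_cast
    ring

theorem rootClasses_eq_iUnion {b : Polynomial ℂ}
    (hb : ∀ α, b.IsRoot α ↔ ∃ s ∈ zeroSet e, ∑ k, s k = α) :
    rootClasses b = ⋃ Q ∈ noncoordinateFacets (newtonHull e),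
      (AddSubgroup.zmultiples (QuotientAddGroup.mk (1 / (facetDenominator Q : ℚ)) : QmodZ) :
        Set QmodZ) := by
  ext x
  simp only [mem_rootClasses_iff hb, noncoordinateFacets_newtonHull, Set.mem_iUnion,
    Set.mem_ofPred_eq, exists_prop, SetLike.mem_coe]
  constructor
  · rintro ⟨β, hβ, hx⟩
    exact ⟨_, ⟨β, hβ, rfl⟩, by rwa [hβ.facetDenominator_dualFace]⟩
  · rintro ⟨_, ⟨β, hβ, rfl⟩, hx⟩
    exact ⟨β, hβ, by rwa [hβ.facetDenominator_dualFace] at hx⟩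

end RootClasses

theorem IsMonomialIdeal.exists_bernsteinSato {n : ℕ} {a : Ideal (PolyRing n)}
    (ha : IsMonomialIdeal a) (ha0 : a ≠ ⊥) {r : ℕ} (f : Fin r → PolyRing n) (hf0 : ∀ j, f j ≠ 0)
    (hf : Ideal.span (Set.range f) = a) :
    ∃ b : Polynomial ℂ, (∀ p, IsBernsteinSatoPolynomial f p ↔ p = b) ∧
      (∀ α : ℂ, b.IsRoot α → ∃ q : ℚ, α = (q : ℂ)) ∧
      rootClasses b = ⋃ Q ∈ noncoordinateFacets (newtonPolyhedron a),
        (AddSubgroup.zmultiples (QuotientAddGroup.mk (1 / (facetDenominator Q : ℚ)) : QmodZ) :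
          Set QmodZ) := by
  classical
  obtain ⟨S, hS, hSa⟩ := ha.exists_exponents ha0 hf
  have : Nonempty S := hS.to_subtype
  obtain ⟨b, hb, hroot⟩ := exists_bernsteinSato_of_span_eq hf0 (hf.trans hSa.symm)
  refine ⟨b, hb, fun α hα => ?_, ?_⟩
  · obtain ⟨s, hs, rfl⟩ := (hroot α).1 hα
    obtain ⟨β, -, z, hz⟩ := exists_denom_of_mem_zeroSet hs
    exact ⟨_, hz⟩
  · rw [rootClasses_eq_iUnion hroot, ← newtonPolyhedron_eq_newtonHull, hSa]

end BernsteinSato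
end

theorem theorem1p2 {n : ℕ} (a : Ideal (BernsteinSato.PolyRing n))
    (ha : BernsteinSato.IsMonomialIdeal a) (ha0 : a ≠ ⊥)
    {r : ℕ} (f : Fin r → BernsteinSato.PolyRing n) (hf0 : ∀ j, f j ≠ 0)
    (hf : Ideal.span (Set.range f) = a) :
    ∃ b : Polynomial ℂ,
      (∀ p, BernsteinSato.IsBernsteinSatoPolynomial f p ↔ p = b) ∧
      (∀ α : ℂ, b.IsRoot α → ∃ q : ℚ, α = (q : ℂ)) ∧
      BernsteinSato.rootClasses b =
        ⋃ Q ∈ BernsteinSato.noncoordinateFacets (BernsteinSato.newtonPolyhedron a),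
          (AddSubgroup.zmultiples (QuotientAddGroup.mk
            (1 / (BernsteinSato.facetDenominator Q : ℚ)) : BernsteinSato.QmodZ) :
              Set BernsteinSato.QmodZ) ∧
      ∀ (a' : Ideal (BernsteinSato.PolyRing n)), BernsteinSato.IsMonomialIdeal a' → a' ≠ ⊥ →
        ∀ {r' : ℕ} (f' : Fin r' → BernsteinSato.PolyRing n), (∀ j, f' j ≠ 0) →
        Ideal.span (Set.range f') = a' →
        ∀ b' : Polynomial ℂ, BernsteinSato.IsBernsteinSatoPolynomial f' b' →
          (BernsteinSato.newtonPolyhedron a' = BernsteinSato.newtonPolyhedron a →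
            BernsteinSato.rootClasses b' = BernsteinSato.rootClasses b) ∧
          (BernsteinSato.idealIntegralClosure a' = BernsteinSato.idealIntegralClosure a →
            BernsteinSato.rootClasses b' = BernsteinSato.rootClasses b)
    := by
  obtain ⟨b, hb, hrat, hcl⟩ := ha.exists_bernsteinSato ha0 f hf0 hf
  refine ⟨b, hb, hrat, hcl, fun a' ha' ha0' r' f' hf0' hf' b' hb' => ?_⟩
  have key : BernsteinSato.newtonPolyhedron a' = BernsteinSato.newtonPolyhedron a →
      BernsteinSato.rootClasses b' = BernsteinSato.rootClasses b := by
    intro h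
    obtain ⟨b'', hu, -, hcl'⟩ := ha'.exists_bernsteinSato ha0' f' hf0' hf'
    rw [(hu b').1 hb', hcl', hcl, h]
  exact ⟨key, fun h => key
    ((BernsteinSato.newtonPolyhedron_subset_of_integralClosure_subset ha h.le).antisymm
      (BernsteinSato.newtonPolyhedron_subset_of_integralClosure_subset ha' h.ge))⟩
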